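/- Let $X=\mathbb{H}^2/\Gamma$ and $Y=\mathbb{H}^2/\Gamma'$ be closed orientable hyperbolic surfaces and let $\varphi\colon X\to Y$ be a homeomorphism (a marking), so that $[(Y,\varphi)]$ is a point of the Teichmüller space of $X$. Let $\mathcal{G}$ be the space of unoriented bi-infinite geodesics of $\mathbb{H}^2=\widetilde X$, i.e. of unordered pairs of distinct points of $\partial\mathbb{H}^2=\mathbb{R}\cup\{\infty\}$, and let $L$ be the Liouville measure on $\mathcal{G}$, i.e. $dx\,dy/(x-y)^2$ on pairs $\{x,y\}$ of real endpoints, so that $L([a,b]\times[c,d])=\left|\log\frac{|a-c||b-d|}{|a-d||b-c|}\right|$. Let $\mu=\mathcal{L}_Y$ be the Liouville current of $Y$ as a geodesic current on $X$, i.e. the push-forward of $L$ under the map of $\mathcal{G}$ induced by the boundary extension of $\widetilde\varphi^{-1}$, where $\widetilde\varphi\colon\mathbb{H}^2\to\mathbb{H}^2$ is a lift of $\varphi$. For $x,y\in\mathbb{H}^2$ put $d_\mu(x,y)=\frac12\{\mu(G[x,y))+\mu(G(x,y])\}$, where $G(\tau)$ is the set of geodesics that meet the segment $\tau$ in exactly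 one point, and let the dual space $X_\mu$ be the metric quotient of $(\mathbb{H}^2,d_\mu)$. Put $$\delta_\mu=\tfrac12\sup_{a,b,c,d}\min\{\mu(B^+)+\mu(B^-),\ \mu((B^\perp)^+)+\mu((B^\perp)^-)\},$$ where $a,b,c,d$ ranges over the quadruples of distinct points of $\partial\mathbb{H}^2$ in counter-clockwise order, $B^+=(a,b]\times[c,d)$, $B^-=[a,b)\times(c,d]$, $(B^\perp)^+=[b,c)\times(d,a]$ and $(B^\perp)^-=(b,c]\times[d,a)$. A metric space is called $\delta$-hyperbolic if for any four points $x,y,z,w$ the two largest of $d(x,y)+d(z,w)$, $d(x,z)+d(y,w)$, $d(y,z)+d(x,w)$ differ by at most $2\delta$. Then $\delta_\mu=\log 2$, and $\log 2$ is the optimal hyperbolicity constant of the dual of $\mu$: it is the least $\delta$ for which $X_\mu$ is $\delta$-hyperbolic. Moreover $\log 2$ is also the optimal hyperbolicity constant of the hyperbolic plane $\mathbb{H}^2$ (of curvature $-1$). -/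

import Mathlib

open scoped MatrixGroups UpperHalfPlane Topology ENNReal
open Filter MeasureTheory UpperHalfPlane

noncomputable section

namespace DualCurrent

/-! ### The boundary circle of the hyperbolic plane -/

/-- The boundary at infinity of the upper half plane `ℍ`, i.e. the circle `ℝ ∪ {∞}`. -/
abbrev Bdry : Type := OnePoint ℝ

/-- The trace on `ℍ` of the neighbourhoods of a boundary point `ξ` in the closed disk `ℍ ∪ ∂ℍ`,
which is seen inside the Riemann sphere `ℂ ∪ {∞}`. -/
def atBdry (ξ : Bdry) : Filter ℍ :=
  comap (fun z : ℍ => ((z : ℂ) : OnePoint ℂ)) (𝓝 (OnePoint.map (fun t : ℝ => (t : ℂ)) ξ))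

/-- The boundary map of `φ : ℍ → ℍ`: the image of `ξ` is the boundary point to which `φ z`
converges as `z` tends to `ξ` (an arbitrary point if there is no such limit). -/
def boundaryMap (φ : ℍ → ℍ) (ξ : Bdry) : Bdry :=
  Classical.epsilon fun η : Bdry => Tendsto φ (atBdry ξ) (atBdry η)

/-- The identification of the boundary with `ℝ ∪ {∞}` where `∞` is the largest element; it cuts
the circle open at `∞`. -/
def cut (ξ : Bdry) : WithTop ℝ := ξ.elim ⊤ (fun t => (t : WithTop ℝ))

/-- `a`, `b`, `c` are distinct and appear in this counter-clockwise order on the boundary. -/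
def Ccw (a b c : Bdry) : Prop :=
  (cut a < cut b ∧ cut b < cut c) ∨ (cut b < cut c ∧ cut c < cut a) ∨
    (cut c < cut a ∧ cut a < cut b)

/-- `a`, `b`, `c`, `d` are distinct and appear in this counter-clockwise order. -/
def Ccw4 (a b c d : Bdry) : Prop := Ccw a b c ∧ Ccw a c d

/-- The half-open interval `[a, b)` of the boundary circle, for `a ≠ b`. -/
def arcCO (a b : Bdry) : Set Bdry := {ξ | ξ = a ∨ Ccw a ξ b}

/-- The half-open interval `(a, b]` of the boundary circle, for `a ≠ b`. -/
def arcOC (a b : Bdry) : Set Bdry := {ξ | ξ = b ∨ Ccw a ξ b}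

/-! ### The space of unoriented bi-infinite geodesics -/

/-- Unoriented geodesics of `ℍ`, identified with the unordered pairs of their (distinct)
endpoints at infinity. -/
def Geod : Type := {p : Sym2 Bdry // ¬ p.IsDiag}

/-- The geodesic with endpoints `p.1` and `p.2`. -/
def Geod.mk (p : {p : Bdry × Bdry // p.1 ≠ p.2}) : Geod :=
  ⟨s(p.1.1, p.1.2), fun h => p.2 (Sym2.mk_isDiag_iff.1 h)⟩

/-- The quotient topology of `{(x, y) | x ≠ y}` by `(x, y) ∼ (y, x)`. -/
instance : TopologicalSpace Geod := TopologicalSpace.coinduced Geod.mk inferInstance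

instance : MeasurableSpace Geod := borel Geod

instance : BorelSpace Geod := ⟨rfl⟩

/-- The points of the geodesic: the half circle with diameter `[a, b]` if the endpoints are the
real numbers `a`, `b`, the vertical line over `a` if they are `a` and `∞`. -/
def Geod.line (g : Geod) : Set ℍ :=
  {z | (∃ a b : ℝ, g.1 = s((a : Bdry), (b : Bdry)) ∧ (z.re - a) * (z.re - b) + z.im ^ 2 = 0) ∨
    (∃ a : ℝ, g.1 = s((a : Bdry), OnePoint.infty) ∧ z.re = a)}

open Classical in
/-- The map that an injective map `f` of the boundary induces on geodesics. -/
def Geod.map (f : Bdry → Bdry) (g : Geod) : Geod :=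
  if h : (g.1.map f).IsDiag then g else ⟨g.1.map f, h⟩

/-- The box of geodesics `I × J`. -/
def box (I J : Set Bdry) : Set Geod := {g | ∃ x ∈ I, ∃ y ∈ J, g.1 = s(x, y)}

/-- The geodesics that meet `τ` transversely, for `τ` an open, half-open or closed geodesic
segment: those that meet it in exactly one point. -/
def transversal (τ : Set ℍ) : Set Geod := {g | ∃ p, g.line ∩ τ = {p}}

/-- The closed geodesic segment `[x, y]`. -/
def seg (x y : ℍ) : Set ℍ := {z | dist x z + dist z y = dist x y}

/-- The half-open geodesic segment `[x, y)`. -/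
def segCO (x y : ℍ) : Set ℍ := seg x y \ {y}

/-- The half-open geodesic segment `(x, y]`. -/
def segOC (x y : ℍ) : Set ℍ := seg x y \ {x}

/-! ### The dual space of a current and the quantity `δ_μ` -/

/-- `d_μ(x, y) = (μ(G[x, y)) + μ(G(x, y])) / 2`. -/
def dualPseudoDist (μ : Measure Geod) (x y : ℍ) : ℝ :=
  ((μ (transversal (segCO x y)) + μ (transversal (segOC x y))) / 2).toReal

/-- The dual space `X_μ`: the metric quotient of `ℍ`, where `x ∼ y` if `d_μ(x, y) = 0`. -/
def DualSpace (μ : Measure Geod) : Type := Quot fun x y : ℍ => dualPseudoDist μ x y = 0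

/-- The distance on the dual space: the quotient distance, i.e. the infimum of `d_μ` over the
representatives (all of which give the same value, as `d_μ` is a pseudo-distance). -/
def dualDist (μ : Measure Geod) (p q : DualSpace μ) : ℝ :=
  sInf {r : ℝ | ∃ x y : ℍ, (Quot.mk _ x : DualSpace μ) = p ∧ (Quot.mk _ y : DualSpace μ) = q ∧
    r = dualPseudoDist μ x y}

/-- `δ`-hyperbolicity (the four point condition): the two largest of the three sums of distances
of opposite pairs differ by at most `2δ`, that is, each sum exceeds the larger of the other two
by at most `2δ`. -/
def IsGromovHyperbolic {α : Type*} (d : α → α → ℝ) (δ : ℝ) : Prop :=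
  ∀ x y z w : α, d x z + d y w ≤ max (d x y + d z w) (d y z + d x w) + 2 * δ

/-- `δ_μ`: half the supremum, over boxes with vertices `a, b, c, d` in counter-clockwise order, of
`min {μ(B⁺) + μ(B⁻), μ((B^⊥)⁺) + μ((B^⊥)⁻)}`, where `B⁺ = (a, b] × [c, d)`,
`B⁻ = [a, b) × (c, d]`, `(B^⊥)⁺ = [b, c) × (d, a]` and `(B^⊥)⁻ = (b, c] × [d, a)`. -/
def deltaBox (μ : Measure Geod) : ℝ≥0∞ :=
  (⨆ (a : Bdry) (b : Bdry) (c : Bdry) (d : Bdry) (_ : Ccw4 a b c d),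
    min (μ (box (arcOC a b) (arcCO c d)) + μ (box (arcCO a b) (arcOC c d)))
      (μ (box (arcCO b c) (arcOC d a)) + μ (box (arcOC b c) (arcCO d a)))) / 2

/-! ### Closed hyperbolic surfaces, markings and Liouville currents -/

/-- `Γ` acts on `ℍ` as the deck group of a closed hyperbolic surface `ℍ / Γ`: freely (up to `±1`,
which acts trivially), properly discontinuously and cocompactly. -/
structure IsClosedSurfaceGroup (Γ : Subgroup SL(2, ℝ)) : Prop where
  free : ∀ A ∈ Γ, (∃ z : ℍ, A • z = z) → ∀ w : ℍ, A • w = w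
  properlyDiscontinuous : ∀ K : Set ℍ, IsCompact K →
    {A : SL(2, ℝ) | A ∈ Γ ∧ ∃ z ∈ K, A • z ∈ K}.Finite
  cocompact : ∃ K : Set ℍ, IsCompact K ∧ ∀ z : ℍ, ∃ A ∈ Γ, A • z ∈ K

/-- `φ` is the lift to universal covers of a homeomorphism from `ℍ / Γ` to `ℍ / Γ'`: it conjugates
the transformation group `Γ` to the transformation group `Γ'`. -/
structure IsMarking (Γ Γ' : Subgroup SL(2, ℝ)) (φ : ℍ ≃ₜ ℍ) : Prop where
  map : ∀ A ∈ Γ, ∃ B ∈ Γ', ∀ z : ℍ, φ (A • z) = B • φ z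
  inv : ∀ B ∈ Γ', ∃ A ∈ Γ, ∀ z : ℍ, φ (A • z) = B • φ z

/-- The geodesic with real endpoints `p.1 < p.2`. -/
def Geod.ofReal (p : {p : ℝ × ℝ // p.1 < p.2}) : Geod :=
  Geod.mk ⟨((p.1.1 : Bdry), (p.1.2 : Bdry)), fun h => p.2.ne (OnePoint.coe_injective h)⟩

/-- The Liouville measure `dx dy / (y - x)²` on the geodesics of `ℍ` (those with endpoint `∞` form
a null set). -/
def liouville : Measure Geod :=
  ((volume.comap (Subtype.val : {p : ℝ × ℝ // p.1 < p.2} → ℝ × ℝ)).withDensity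
    fun p => ENNReal.ofReal (1 / (p.1.2 - p.1.1) ^ 2)).map Geod.ofReal

/-! The value of the Liouville measure on boxes, which is its usual description. -/

section LiouvilleBox

open Set

theorem measurable_ofReal : Measurable Geod.ofReal := by
  have h1 : Continuous Geod.mk := continuous_coinduced_rng
  refine Continuous.measurable (h1.comp ?_)
  refine Continuous.subtype_mk ?_ _
  exact (OnePoint.continuous_coe.comp (continuous_fst.comp continuous_subtype_val)).prodMk
    (OnePoint.continuous_coe.comp (continuous_snd.comp continuous_subtype_val))

theorem isClosed_box {a b c d : ℝ} :
    IsClosed (box ((fun t : ℝ => (t : Bdry)) '' Icc a b) ((fun t : ℝ => (t : Bdry)) '' Icc c d)) := by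
  rw [isClosed_coinduced]
  set I := ((fun t : ℝ => (t : Bdry)) '' Icc a b)
  set J := ((fun t : ℝ => (t : Bdry)) '' Icc c d)
  have hI : IsClosed I := (isCompact_Icc.image OnePoint.continuous_coe).isClosed
  have hJ : IsClosed J := (isCompact_Icc.image OnePoint.continuous_coe).isClosed
  have : Geod.mk ⁻¹' box I J = Subtype.val ⁻¹' ((I ×ˢ J) ∪ (J ×ˢ I)) := by
    ext ⟨⟨x, y⟩, h⟩
    constructor
    · rintro ⟨u, hu, v, hv, he⟩
      rcases Sym2.eq_iff.1 he with ⟨h1, h2⟩ | ⟨h1, h2⟩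
      · dsimp only at h1 h2; subst h1 h2; exact Or.inl ⟨hu, hv⟩
      · dsimp only at h1 h2; subst h1 h2; exact Or.inr ⟨hv, hu⟩
    · rintro (⟨hu, hv⟩ | ⟨hu, hv⟩)
      · exact ⟨x, hu, y, hv, rfl⟩
      · exact ⟨y, hv, x, hu, Sym2.eq_swap⟩
  rw [this]
  exact ((hI.prod hJ).union (hJ.prod hI)).preimage continuous_subtype_val

/-- The Liouville measure of the box `[a, b] × [c, d]` is the logarithm of the cross ratio. -/
theorem liouville_box {a b c d : ℝ} (hab : a < b) (hbc : b < c) (hcd : c < d) :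
    liouville (box ((fun t : ℝ => (t : Bdry)) '' Icc a b) ((fun t : ℝ => (t : Bdry)) '' Icc c d))
      = ENNReal.ofReal |Real.log (|a - c| * |b - d| / (|a - d| * |b - c|))| := by
  have hm := (isClosed_box (a := a) (b := b) (c := c) (d := d)).measurableSet
  rw [liouville, Measure.map_apply measurable_ofReal hm,
    withDensity_apply _ (measurable_ofReal hm)]
  have hpre : Geod.ofReal ⁻¹' box ((fun t : ℝ => (t : Bdry)) '' Icc a b)
      ((fun t : ℝ => (t : Bdry)) '' Icc c d) = Subtype.val ⁻¹' (Icc a b ×ˢ Icc c d) := by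
    ext ⟨⟨x, y⟩, h⟩
    constructor
    · rintro ⟨_, ⟨u, hu, rfl⟩, _, ⟨v, hv, rfl⟩, he⟩
      rcases Sym2.eq_iff.1 he with ⟨h1, h2⟩ | ⟨h1, h2⟩
      · obtain rfl := OnePoint.coe_injective h1
        obtain rfl := OnePoint.coe_injective h2
        exact ⟨hu, hv⟩
      · obtain rfl := OnePoint.coe_injective h1
        obtain rfl := OnePoint.coe_injective h2
        have h' : x < y := h
        exact absurd h' (by simp only [mem_Icc] at *; linarith)
    · rintro ⟨hu, hv⟩
      exact ⟨_, ⟨x, hu, rfl⟩, _, ⟨y, hv, rfl⟩, rfl⟩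
  rw [hpre]
  have hS : MeasurableSet {p : ℝ × ℝ | p.1 < p.2} := measurableSet_lt measurable_fst measurable_snd
  have hemb := MeasurableEmbedding.subtype_coe hS
  have hR : MeasurableSet (Icc a b ×ˢ Icc c d) := measurableSet_Icc.prod measurableSet_Icc
  have step : ∫⁻ p in (Subtype.val ⁻¹' (Icc a b ×ˢ Icc c d) : Set {p : ℝ × ℝ | p.1 < p.2}),
      ENNReal.ofReal (1 / (p.1.2 - p.1.1) ^ 2)
        ∂(volume.comap (Subtype.val : {p : ℝ × ℝ | p.1 < p.2} → ℝ × ℝ))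
      = ∫⁻ p in Icc a b ×ˢ Icc c d, ENNReal.ofReal (1 / (p.2 - p.1) ^ 2) := by
    have := hemb.lintegral_map (μ := (volume.comap (Subtype.val : {p : ℝ × ℝ | p.1 < p.2} → ℝ × ℝ)).restrict (Subtype.val ⁻¹' (Icc a b ×ˢ Icc c d)))
      (fun p : ℝ × ℝ => ENNReal.ofReal (1 / (p.2 - p.1) ^ 2))
    rw [← this, ← hemb.restrict_map, hemb.map_comap, Measure.restrict_restrict hR]
    congr 2
    rw [Subtype.range_coe]
    ext ⟨x, y⟩
    simp only [mem_inter_iff, mem_prod, mem_Icc, mem_ofPred_eq]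
    constructor
    · exact fun h => h.1
    · exact fun h => ⟨h, by linarith [h.1.2, h.2.1]⟩
  refine step.trans ?_
  rw [Measure.volume_eq_prod, ← Measure.prod_restrict, lintegral_prod _ (by fun_prop)]
  have inner : ∀ x ∈ Icc a b, ∫⁻ y in Icc c d, ENNReal.ofReal (1 / (y - x) ^ 2)
      = ENNReal.ofReal (1 / (c - x) - 1 / (d - x)) := by
    intro x hx
    have hne : ∀ y ∈ uIcc c d, y - x ≠ 0 := by
      intro y hy; rw [uIcc_of_le hcd.le] at hy
      have : 0 < y - x := by linarith [hx.2, hy.1]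
      exact this.ne'
    have hc : ContinuousOn (fun y : ℝ => 1 / (y - x) ^ 2) (uIcc c d) :=
      ContinuousOn.div (by fun_prop) (by fun_prop) (fun y hy => pow_ne_zero _ (hne y hy))
    have hi := intervalIntegral.integral_eq_sub_of_hasDerivAt (a := c) (b := d)
      (f := fun y => - (1 / (y - x))) (f' := fun y => 1 / (y - x) ^ 2)
      (fun y hy => by
        have := ((hasDerivAt_id y).sub_const x).inv (hne y hy)
        convert this.neg using 1
        · ext; simp
        · simp; field_simp ) hc.intervalIntegrable
    rw [← ofReal_integral_eq_lintegral_ofReal, integral_Icc_eq_integral_Ioc,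
      ← intervalIntegral.integral_of_le hcd.le, hi]
    · congr 1; ring
    · rw [uIcc_of_le hcd.le] at hc
      exact hc.integrableOn_Icc
    · exact Eventually.of_forall fun y => by positivity
  rw [setLIntegral_congr_fun measurableSet_Icc inner]
  have hne : ∀ t, b < t → ∀ x ∈ uIcc a b, t - x ≠ 0 := by
    intro t ht x hx; rw [uIcc_of_le hab.le] at hx
    have : 0 < t - x := by linarith [hx.2]
    exact this.ne'
  have hbd : b < d := hbc.trans hcd
  have hc : ContinuousOn (fun x : ℝ => 1 / (c - x) - 1 / (d - x)) (uIcc a b) :=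
    (ContinuousOn.div (by fun_prop) (by fun_prop) (hne c hbc)).sub
      (ContinuousOn.div (by fun_prop) (by fun_prop) (hne d hbd))
  have hi := intervalIntegral.integral_eq_sub_of_hasDerivAt (a := a) (b := b)
      (f := fun x => Real.log (d - x) - Real.log (c - x)) (f' := fun x => 1 / (c - x) - 1 / (d - x))
      (fun x hx => by
        have h1 := ((hasDerivAt_id x).const_sub d).log (hne d hbd x hx)
        have h2 := ((hasDerivAt_id x).const_sub c).log (hne c hbc x hx)
        exact (h1.sub h2).congr_deriv (by simp only [id]; ring)) hc.intervalIntegrable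
  rw [← ofReal_integral_eq_lintegral_ofReal, integral_Icc_eq_integral_Ioc,
      ← intervalIntegral.integral_of_le hab.le, hi]
  · have hac : 0 < c - a := by linarith
    have hbd' : 0 < d - b := by linarith
    have had : 0 < d - a := by linarith
    have hbc' : 0 < c - b := by linarith
    rw [abs_sub_comm a c, abs_sub_comm b d, abs_sub_comm a d, abs_sub_comm b c, abs_of_pos hac,
      abs_of_pos hbd', abs_of_pos had, abs_of_pos hbc', abs_of_nonneg, Real.log_div (by positivity) (by positivity),
      Real.log_mul (by positivity) (by positivity), Real.log_mul (by positivity) (by positivity)]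
    · congr 1; ring
    · apply Real.log_nonneg
      rw [le_div_iff₀ (by positivity)]
      nlinarith
  · rw [uIcc_of_le hab.le] at hc
    exact hc.integrableOn_Icc
  · refine (ae_restrict_mem measurableSet_Icc).mono fun x hx => ?_
    have h1 : 0 < c - x := by linarith [hx.2]
    exact sub_nonneg.2 (one_div_le_one_div_of_le h1 (by linarith))

end LiouvilleBox

/-- The Liouville current `𝓛_Y` of `Y = ℍ / Γ'` as a current on `X = ℍ / Γ`, for a lift
`φ : ℍ → ℍ` of the marking `X → Y`: the push-forward of the Liouville measure under the boundary
map of `φ⁻¹`. -/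
def liouvilleCurrent (φ : ℍ ≃ₜ ℍ) : Measure Geod :=
  liouville.map (Geod.map (boundaryMap φ.symm))

end DualCurrent

end

namespace DualCurrent

/-! ### The four point inequality in the hyperbolic plane -/

/-! The marking enters only through the boundary homeomorphism `f` of its inverse. By cocompactness
the lift and its inverse are coarsely bi-Lipschitz, so exponentials of Gromov products show that
both extend continuously to the circle. A circle homeomorphism preserves linking of pairs, so it
carries a box and its perpendicular box to such a pair again. By `liouville_obox` these have
Liouville measures `log u` and `log v`, cross ratios with `1/u + 1/v = 1` by the Plücker relation
(`Ccw4.inv_cr_add_inv_cr`). Hence the smaller measure is at most `log 2`, with equality for a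
harmonic quadruple, and this gives `δ_μ`. `IsLiouvilleLike` records these facts and the nullity of
the pencils; nothing else about the current is used afterwards.

Since pencils are null, `d_μ(x, y)` is the measure of the geodesics strictly separating `x` from
`y`. For four points only the geodesics that split them two against two matter: `d(x,z) + d(y,w)`
exceeds `d(x,y) + d(z,w)` by `2 (μ(xy|zw) - μ(xz|yw))` (`IsLiouvilleLike.sepDist_four_point`). If
`xy|zw` and `xw|zy` are both nonempty, then extending the diagonals to infinity places them in
perpendicular boxes, so one of them has measure at most `log 2` (`IsLiouvilleLike.sep4_le`); this is
`log 2`-hyperbolicity. For optimality, the four points tend to the vertices of a harmonic box along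
its diagonals, with crossing diagonals so that `xz|yw` is empty (`IsLiouvilleLike.log_two_le`).

For `ℍ` itself, Ptolemy's inequality summed over complex conjugates gives an exponential four point
inequality whose only loss is a factor `2`; large symmetric squares show that nothing better holds.
-/

theorem two_mul_exp_half_dist (z w : ℍ) :
    2 * Real.sqrt z.im * Real.sqrt w.im * Real.exp (dist z w / 2)
      = dist (z : ℂ) w + dist (z : ℂ) (starRingEnd ℂ w) := by
  have hz := z.im_pos
  have hw := w.im_pos
  rw [exp_half_dist, Real.sqrt_mul hz.le]
  have := Real.sqrt_pos.2 hz
  have := Real.sqrt_pos.2 hw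
  field_simp

theorem dist_conj_left (z w : ℂ) :
    dist (starRingEnd ℂ z) w = dist z (starRingEnd ℂ w) := by
  rw [← Complex.dist_conj_conj, Complex.conj_conj]

/-- A strong form of the four point condition, from Ptolemy's inequality. -/
theorem exp_four_point (x y z w : ℍ) :
    Real.exp ((dist x z + dist y w) / 2) ≤
      Real.exp ((dist x y + dist z w) / 2) + Real.exp ((dist y z + dist x w) / 2) := by
  have hpos : 0 < (2 * Real.sqrt x.im * Real.sqrt z.im) * (2 * Real.sqrt y.im * Real.sqrt w.im) := by
    have := Real.sqrt_pos.2 x.im_pos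
    have := Real.sqrt_pos.2 y.im_pos
    have := Real.sqrt_pos.2 z.im_pos
    have := Real.sqrt_pos.2 w.im_pos
    positivity
  refine le_of_mul_le_mul_left ?_ hpos
  have e1 := two_mul_exp_half_dist x z
  have e2 := two_mul_exp_half_dist y w
  have e3 := two_mul_exp_half_dist x y
  have e4 := two_mul_exp_half_dist z w
  have e5 := two_mul_exp_half_dist y z
  have e6 := two_mul_exp_half_dist x w
  simp only [add_div, Real.exp_add]
  set cj := starRingEnd ℂ
  -- Each factor is a distance to a point plus a distance to its conjugate. Up to simultaneous
  -- conjugation there are eight ways to conjugate some of the four points; in the sum of the eight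
  -- Ptolemy inequalities every term of the expanded products occurs twice.
  have h1 := EuclideanGeometry.mul_dist_le_mul_dist_add_mul_dist (x : ℂ) y z w
  have h2 := EuclideanGeometry.mul_dist_le_mul_dist_add_mul_dist (cj x : ℂ) y z w
  have h3 := EuclideanGeometry.mul_dist_le_mul_dist_add_mul_dist (x : ℂ) (cj y) z w
  have h4 := EuclideanGeometry.mul_dist_le_mul_dist_add_mul_dist (x : ℂ) y (cj z) w
  have h5 := EuclideanGeometry.mul_dist_le_mul_dist_add_mul_dist (x : ℂ) y z (cj w)
  have h6 := EuclideanGeometry.mul_dist_le_mul_dist_add_mul_dist (x : ℂ) y (cj z) (cj w)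
  have h7 := EuclideanGeometry.mul_dist_le_mul_dist_add_mul_dist (x : ℂ) (cj y) z (cj w)
  have h8 := EuclideanGeometry.mul_dist_le_mul_dist_add_mul_dist (x : ℂ) (cj y) (cj z) w
  simp only [cj, dist_conj_left, Complex.conj_conj] at h2 h3 h4 h5 h6 h7 h8
  calc _ = (2 * √x.im * √z.im * Real.exp (dist x z / 2)) *
        (2 * √y.im * √w.im * Real.exp (dist y w / 2)) := by ring
    _ ≤ (2 * √x.im * √y.im * Real.exp (dist x y / 2)) *
          (2 * √z.im * √w.im * Real.exp (dist z w / 2)) +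
        (2 * √y.im * √z.im * Real.exp (dist y z / 2)) *
          (2 * √x.im * √w.im * Real.exp (dist x w / 2)) := by
      rw [e1, e2, e3, e4, e5, e6]
      linarith
    _ = _ := by ring

theorem isGromovHyperbolic_log_two :
    IsGromovHyperbolic (fun z w : ℍ => dist z w) (Real.log 2) := by
  intro x y z w
  have h := exp_four_point x y z w
  set M := max (dist x y + dist z w) (dist y z + dist x w)
  have h1 : Real.exp ((dist x y + dist z w) / 2) ≤ Real.exp (M / 2) :=
    Real.exp_le_exp.2 (by linarith [le_max_left (dist x y + dist z w) (dist y z + dist x w)])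
  have h2 : Real.exp ((dist y z + dist x w) / 2) ≤ Real.exp (M / 2) :=
    Real.exp_le_exp.2 (by linarith [le_max_right (dist x y + dist z w) (dist y z + dist x w)])
  have h3 : Real.exp ((dist x z + dist y w) / 2) ≤ Real.exp (M / 2 + Real.log 2) := by
    rw [Real.exp_add, Real.exp_log two_pos]; linarith
  have := Real.exp_le_exp.1 h3
  show dist x z + dist y w ≤ M + 2 * Real.log 2
  linarith

/-- The point at signed distance `s` from `i r` on the geodesic `|z| = r`. -/
noncomputable def circlePt (r : ℝ) (hr : 0 < r) (s : ℝ) : ℍ :=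
  ⟨⟨r * Real.tanh s, r / Real.cosh s⟩, div_pos hr (Real.cosh_pos s)⟩

/-- The point `i r`. -/
noncomputable def axisPt (r : ℝ) (hr : 0 < r) : ℍ := ⟨⟨0, r⟩, hr⟩

theorem eq_of_cosh_eq {a b : ℝ} (ha : 0 ≤ a) (hb : 0 ≤ b) (h : Real.cosh a = Real.cosh b) : a = b :=
  Real.cosh_strictMonoOn.injOn (Set.mem_Ici.2 ha) (Set.mem_Ici.2 hb) h

theorem cosh_dist_coords (z w : ℍ) : Real.cosh (dist z w) =
    ((z.re - w.re) ^ 2 + z.im ^ 2 + w.im ^ 2) / (2 * z.im * w.im) := cosh_dist' z w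

theorem circlePt_re (r : ℝ) (hr : 0 < r) (s : ℝ) : (circlePt r hr s).re = r * Real.tanh s := rfl
theorem circlePt_im (r : ℝ) (hr : 0 < r) (s : ℝ) : (circlePt r hr s).im = r / Real.cosh s := rfl
theorem axisPt_re (r : ℝ) (hr : 0 < r) : (axisPt r hr).re = 0 := rfl
theorem axisPt_im (r : ℝ) (hr : 0 < r) : (axisPt r hr).im = r := rfl

theorem dist_circlePt (r : ℝ) (hr : 0 < r) (s t : ℝ) :
    dist (circlePt r hr s) (circlePt r hr t) = |s - t| := by
  have h : Real.cosh (dist (circlePt r hr s) (circlePt r hr t)) = Real.cosh (s - t) := by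
    rw [cosh_dist_coords, circlePt_re, circlePt_re, circlePt_im, circlePt_im, Real.cosh_sub,
      Real.tanh_eq_sinh_div_cosh, Real.tanh_eq_sinh_div_cosh]
    have h1 := Real.cosh_sq s
    have h2 := Real.cosh_sq t
    have := (Real.cosh_pos s).ne'
    have := (Real.cosh_pos t).ne'
    field_simp
    linear_combination -(Real.cosh t ^ 2 * h1 + Real.cosh s ^ 2 * h2)
  rw [← Real.cosh_abs (s - t)] at h
  exact eq_of_cosh_eq dist_nonneg (abs_nonneg _) h

theorem dist_axisPt (r t : ℝ) (hr : 0 < r) (ht : 0 < t) :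
    dist (axisPt r hr) (axisPt t ht) = |Real.log r - Real.log t| := by
  exact (dist_of_re_eq (show (axisPt r hr).re = (axisPt t ht).re from rfl)).trans (Real.dist_eq _ _)

/-- Hyperbolic Pythagoras for the right angle at `i r`: the fraction is `cosh (log (r / t))`. -/
theorem cosh_dist_axisPt_circlePt (r t s : ℝ) (hr : 0 < r) (ht : 0 < t) :
    Real.cosh (dist (axisPt t ht) (circlePt r hr s)) = (r ^ 2 + t ^ 2) / (2 * r * t) * Real.cosh s := by
  rw [cosh_dist_coords, circlePt_re, circlePt_im, axisPt_re, axisPt_im,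
      Real.tanh_eq_sinh_div_cosh]
  have h1 := Real.cosh_sq s
  have := (Real.cosh_pos s).ne'
  field_simp
  linear_combination - r ^ 2 * h1

/-- Take the four points at distance `n` from `i` on two perpendicular geodesics. The diagonals have
length `2n`, and the sides have `cosh` equal to `cosh n ^ 2`, hence length at most `2n - log 2 +
o(1)`. Comparing sums forces `2δ ≥ 2 log 2 - o(1)`. -/
theorem log_two_le_of_isGromovHyperbolic {δ : ℝ}
    (h : IsGromovHyperbolic (fun z w : ℍ => dist z w) δ) : Real.log 2 ≤ δ := by
  have key : ∀ n : ℝ, 0 ≤ n → Real.log 2 - 2 * Real.log (1 + Real.exp (-(2 * n))) ≤ δ := by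
    intro n hn
    have h1 := h (axisPt (Real.exp n) (Real.exp_pos _)) (circlePt 1 one_pos n)
      (axisPt (Real.exp (-n)) (Real.exp_pos _)) (circlePt 1 one_pos (-n))
    simp only [dist_axisPt, dist_circlePt, Real.log_exp] at h1
    rw [sub_neg_eq_add, abs_of_nonneg (by linarith)] at h1
    set S := Real.log (2 * Real.cosh n ^ 2)
    have hc := Real.cosh_pos n
    have side : ∀ e s, (e = n ∨ e = -n) → (s = n ∨ s = -n) →
        dist (axisPt (Real.exp e) (Real.exp_pos _)) (circlePt 1 one_pos s) ≤ S := by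
      intro e s he hs
      have h2 := cosh_dist_axisPt_circlePt 1 (Real.exp e) s one_pos (Real.exp_pos _)
      have h3 : Real.cosh s = Real.cosh n := by rcases hs with rfl | rfl <;> simp
      have h4 : (1 ^ 2 + Real.exp e ^ 2) / (2 * 1 * Real.exp e) = Real.cosh n := by
        have : Real.cosh e = Real.cosh n := by rcases he with rfl | rfl <;> simp
        rw [← this, Real.cosh_eq, Real.exp_neg]
        have := Real.exp_pos e
        field_simp
        ring
      rw [h3, h4] at h2
      -- `exp d ≤ 2 cosh d`, which is where the factor `2` in `S` comes from.
      rw [Real.le_log_iff_exp_le (by positivity)]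
      have := Real.cosh_eq (dist (axisPt (Real.exp e) (Real.exp_pos _)) (circlePt 1 one_pos s))
      nlinarith [Real.exp_pos (-(dist (axisPt (Real.exp e) (Real.exp_pos _)) (circlePt 1 one_pos s)))]
    have s1 := side n n (.inl rfl) (.inl rfl)
    have s2 := side n (-n) (.inl rfl) (.inr rfl)
    have s3 := side (-n) n (.inr rfl) (.inl rfl)
    have s4 := side (-n) (-n) (.inr rfl) (.inr rfl)
    rw [dist_comm (circlePt 1 one_pos n)] at h1
    have hS : S = 2 * n + 2 * Real.log (1 + Real.exp (-(2 * n))) - Real.log 2 := by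
      have e1 : Real.cosh n = Real.exp n * (1 + Real.exp (-(2 * n))) / 2 := by
        rw [Real.cosh_eq, mul_add, ← Real.exp_add]; ring_nf
      have := Real.exp_pos n
      have : 0 < 1 + Real.exp (-(2 * n)) := by positivity
      simp only [S]
      rw [Real.log_mul (by norm_num) (by positivity), Real.log_pow, e1, Real.log_div (by positivity)
        (by norm_num), Real.log_mul (by positivity) (by positivity), Real.log_exp]
      push_cast; ring
    have := max_le (add_le_add s1 s4) (add_le_add s3 s2)
    linarith
  have hlim : Tendsto (fun n : ℝ => Real.log 2 - 2 * Real.log (1 + Real.exp (-(2 * n))))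
      atTop (𝓝 (Real.log 2 - 2 * Real.log (1 + 0))) := by
    have h1 : Tendsto (fun n : ℝ => Real.exp (-(2 * n))) atTop (𝓝 0) :=
      Real.tendsto_exp_neg_atTop_nhds_zero.comp (tendsto_id.const_mul_atTop two_pos)
    have h2 := (h1.const_add 1).log (by norm_num)
    exact (h2.const_mul 2).const_sub _
  have := le_of_tendsto hlim ((eventually_ge_atTop 0).mono key)
  simpa using this

/-! ### Geodesic segments in the paraboloid model `z ↦ (re z, |z|²)` -/

/-- The squared modulus; together with the real part it is an affine chart of `ℍ` in which the
geodesics are straight. -/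
noncomputable def sqn (z : ℍ) : ℝ := z.re ^ 2 + z.im ^ 2

theorem ext_of_re_sqn {z w : ℍ} (h1 : z.re = w.re) (h2 : sqn z = sqn w) : z = w := by
  have h3 : z.im = w.im := by
    unfold sqn at h2
    rw [h1] at h2
    exact (sq_eq_sq₀ z.im_pos.le w.im_pos.le).1 (by linarith)
  exact UpperHalfPlane.ext (Complex.ext h1 h3)

theorem sq_re_lt_sqn (z : ℍ) : z.re ^ 2 < sqn z := by
  have := z.im_pos
  unfold sqn; nlinarith

theorem exists_re_sqn {u v : ℝ} (h : u ^ 2 < v) : ∃ z : ℍ, z.re = u ∧ sqn z = v := by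
  refine ⟨⟨⟨u, Real.sqrt (v - u ^ 2)⟩, Real.sqrt_pos.2 (by linarith)⟩, rfl, ?_⟩
  show u ^ 2 + Real.sqrt (v - u ^ 2) ^ 2 = v
  rw [Real.sq_sqrt (by linarith)]; ring

/-- The polar form of the paraboloid. -/
noncomputable def qd (z w : ℍ) : ℝ := (sqn z + sqn w) / 2 - z.re * w.re

theorem qd_self (z : ℍ) : qd z z = z.im ^ 2 := by unfold qd sqn; ring

/-- Dividing the vector `(re z, |z|², 1)` by `im z` gives the hyperboloid model with form `qd`; this
turns metric statements into bilinear algebra. -/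
theorem qd_eq (z w : ℍ) : qd z w = z.im * w.im * Real.cosh (dist z w) := by
  have := z.im_pos
  have := w.im_pos
  rw [cosh_dist_coords]; unfold qd sqn; field_simp; ring

/-- `z` is the point of the straight segment from `x` to `y` with barycentric coordinates
`α`, `1 - α`. -/
def IsBary (x y z : ℍ) (α : ℝ) : Prop :=
  z.re = α * x.re + (1 - α) * y.re ∧ sqn z = α * sqn x + (1 - α) * sqn y

theorem IsBary.symm {x y z : ℍ} {α : ℝ} (h : IsBary x y z α) : IsBary y x z (1 - α) :=
  ⟨by rw [h.1]; ring, by rw [h.2]; ring⟩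

theorem exists_isBary (x y : ℍ) {α : ℝ} (h0 : 0 ≤ α) (h1 : α ≤ 1) : ∃ z, IsBary x y z α := by
  refine exists_re_sqn ?_
  have hx := sq_re_lt_sqn x
  have hy := sq_re_lt_sqn y
  rcases h0.eq_or_lt with rfl | h0
  · simpa using hy
  · nlinarith [mul_pos h0 (sub_pos.2 hx), mul_nonneg (sub_nonneg.2 h1) (sub_pos.2 hy).le,
      mul_nonneg h0.le (sub_nonneg.2 h1), mul_nonneg (mul_nonneg h0.le (sub_nonneg.2 h1)) (sq_nonneg (x.re - y.re))]

theorem IsBary.im_mul_cosh {x y z : ℍ} {α : ℝ} (h : IsBary x y z α) :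
    z.im * Real.cosh (dist x z) = α * x.im + (1 - α) * y.im * Real.cosh (dist x y) := by
  have hx := x.im_pos
  refine mul_left_cancel₀ hx.ne' ?_
  have h1 : qd x z = α * qd x x + (1 - α) * qd x y := by
    unfold qd; rw [h.1, h.2]; ring
  rw [qd_self, qd_eq, qd_eq] at h1
  linear_combination h1

/-- Bilinearity gives `im z` times the hyperbolic cosines of both partial distances. Squaring gives
the hyperbolic sines, whose signs are known since `0 ≤ α ≤ 1`, and the addition formula for `cosh`
concludes. -/
theorem IsBary.dist_add_dist {x y z : ℍ} {α : ℝ} (h : IsBary x y z α) (h0 : 0 ≤ α) (h1 : α ≤ 1) :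
    dist x z + dist z y = dist x y := by
  have hx := x.im_pos
  have hy := y.im_pos
  have hz := z.im_pos
  have e1 := h.im_mul_cosh
  have e2 := h.symm.im_mul_cosh
  rw [dist_comm y z, dist_comm y x, sub_sub_cancel] at e2
  have e3 : z.im ^ 2 = α ^ 2 * x.im ^ 2 + (1 - α) ^ 2 * y.im ^ 2 +
      2 * α * (1 - α) * (x.im * y.im * Real.cosh (dist x y)) := by
    rw [← qd_self, ← qd_self, ← qd_self, ← qd_eq]
    unfold qd; rw [h.1, h.2]; ring
  set s := dist x z
  set t := dist z y
  set D := dist x y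
  have hs : 0 ≤ s := dist_nonneg
  have ht : 0 ≤ t := dist_nonneg
  have hD : 0 ≤ D := dist_nonneg
  have cD := Real.cosh_sq D
  have cs := Real.cosh_sq s
  have ct := Real.cosh_sq t
  have f1 : z.im * Real.sinh s = (1 - α) * y.im * Real.sinh D := by
    refine (sq_eq_sq₀ (mul_nonneg hz.le (Real.sinh_nonneg_iff.2 hs)) (mul_nonneg (mul_nonneg
      (by linarith) hy.le) (Real.sinh_nonneg_iff.2 hD))).1 ?_
    linear_combination (z.im * Real.cosh s + (α * x.im + (1 - α) * y.im * Real.cosh D)) * e1 - e3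
      + (1 - α) ^ 2 * y.im ^ 2 * cD - z.im ^ 2 * cs
  have f2 : z.im * Real.sinh t = α * x.im * Real.sinh D := by
    refine (sq_eq_sq₀ (mul_nonneg hz.le (Real.sinh_nonneg_iff.2 ht)) (mul_nonneg (mul_nonneg
      h0 hx.le) (Real.sinh_nonneg_iff.2 hD))).1 ?_
    linear_combination (z.im * Real.cosh t + ((1 - α) * y.im + α * x.im * Real.cosh D)) * e2 - e3
      + α ^ 2 * x.im ^ 2 * cD - z.im ^ 2 * ct
  refine eq_of_cosh_eq (by positivity) hD ?_
  refine mul_left_cancel₀ (pow_ne_zero 2 hz.ne') ?_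
  rw [Real.cosh_add]
  calc z.im ^ 2 * (Real.cosh s * Real.cosh t + Real.sinh s * Real.sinh t)
      = (z.im * Real.cosh s) * (z.im * Real.cosh t) + (z.im * Real.sinh s) * (z.im * Real.sinh t) := by ring
    _ = _ := by
      rw [e1, e2, f1, f2, e3]
      linear_combination - (α * x.im) * ((1 - α) * y.im) * cD

/-- Equality in the triangle inequality makes the Gram determinant of the three hyperboloid vectors
vanish (`hg`), and that determinant is a multiple of the square of the collinearity determinant. -/
theorem collinear_of_dist_add_dist {x y z : ℍ} (h : dist x z + dist z y = dist x y) :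
    (z.re - x.re) * (sqn y - sqn x) = (y.re - x.re) * (sqn z - sqn x) := by
  have hg : Real.cosh (dist x y) ^ 2 + Real.cosh (dist x z) ^ 2 + Real.cosh (dist z y) ^ 2 =
      1 + 2 * Real.cosh (dist x y) * Real.cosh (dist x z) * Real.cosh (dist z y) := by
    rw [← h, Real.cosh_add]
    have c1 := Real.cosh_sq (dist x z)
    have c2 := Real.cosh_sq (dist z y)
    have c3 : (Real.sinh (dist x z) * Real.sinh (dist z y)) ^ 2 =
      (Real.cosh (dist x z) ^ 2 - 1) * (Real.cosh (dist z y) ^ 2 - 1) := by rw [c1, c2]; ring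
    linear_combination c3
  have e1 := qd_eq x y
  have e2 := qd_eq x z
  have e3 := qd_eq z y
  have g1 := qd_self x
  have g2 := qd_self y
  have g3 := qd_self z
  have hq : z.im ^ 2 * qd x y ^ 2 + y.im ^ 2 * qd x z ^ 2 + x.im ^ 2 * qd z y ^ 2 =
      x.im ^ 2 * y.im ^ 2 * z.im ^ 2 + 2 * qd x y * qd x z * qd z y := by
    rw [e1, e2, e3]
    linear_combination x.im ^ 2 * y.im ^ 2 * z.im ^ 2 * hg
  rw [← g1, ← g2, ← g3] at hq
  refine sub_eq_zero.1 (pow_eq_zero_iff two_ne_zero |>.1 ?_)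
  unfold qd at hq
  linear_combination -4 * hq

theorem exists_isBary_of_collinear {x y z : ℍ} (hxy : x ≠ y)
    (h : (z.re - x.re) * (sqn y - sqn x) = (y.re - x.re) * (sqn z - sqn x)) :
    ∃ α, IsBary x y z α := by
  by_cases h1 : y.re = x.re
  · have h2 : sqn y - sqn x ≠ 0 := fun h2 => hxy (ext_of_re_sqn h1.symm (by linarith))
    have h3 : z.re = x.re := by
      rw [h1, sub_self, zero_mul] at h
      rcases mul_eq_zero.1 h with h | h
      · linarith
      · exact absurd h h2
    refine ⟨1 - (sqn z - sqn x) / (sqn y - sqn x), ?_, ?_⟩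
    · rw [h1, h3]; ring
    · field_simp; ring
  · have h2 : y.re - x.re ≠ 0 := sub_ne_zero.2 h1
    refine ⟨1 - (z.re - x.re) / (y.re - x.re), ?_, ?_⟩
    · field_simp; ring
    · field_simp; linear_combination -h

/-- If `z = α x + (1 - α) y` with `α > 1`, then `x` lies between `z` and `y`. -/
theorem IsBary.extend {x y z : ℍ} {α : ℝ} (h : IsBary x y z α) (h1 : 1 < α) :
    IsBary z y x α⁻¹ := by
  have : α ≠ 0 := by linarith
  constructor
  · rw [h.1]; field_simp; ring
  · rw [h.2]; field_simp; ring

/-- Collinearity provides some `α`. If `α` were outside `[0, 1]`, then `x` or `y` would lie between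
`z` and the other end; adding the two distance equalities collapses `z` onto that point, so the
coordinate may be replaced by `1` or `0`. -/
theorem mem_seg_iff {x y z : ℍ} : z ∈ seg x y ↔ ∃ α, 0 ≤ α ∧ α ≤ 1 ∧ IsBary x y z α := by
  constructor
  · intro h
    replace h : dist x z + dist z y = dist x y := h
    by_cases hxy : x = y
    · subst hxy
      have : z = x := by
        rw [dist_self] at h
        have := dist_nonneg (x := x) (y := z)
        have := dist_nonneg (x := z) (y := x)
        exact dist_le_zero.1 (by linarith)
      subst this
      exact ⟨1, zero_le_one, le_rfl, by simp [IsBary]⟩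
    · obtain ⟨α, hα⟩ := exists_isBary_of_collinear hxy (collinear_of_dist_add_dist h)
      rcases lt_or_ge α 0 with h0 | h0
      · have e := (hα.symm.extend (by linarith)).dist_add_dist
          (inv_nonneg.2 (by linarith)) (inv_le_one_of_one_le₀ (by linarith))
        have : dist z y ≤ 0 := by
          rw [dist_comm z x, dist_comm y x] at e
          linarith
        obtain rfl := dist_le_zero.1 this
        exact ⟨0, le_rfl, zero_le_one, by simp [IsBary]⟩
      rcases lt_or_ge 1 α with h1 | h1
      · have e := (hα.extend h1).dist_add_dist
          (inv_nonneg.2 (by linarith)) (inv_le_one_of_one_le₀ (by linarith))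
        have : dist x z ≤ 0 := by
          rw [dist_comm z x] at e
          linarith
        obtain rfl := dist_le_zero.1 this
        exact ⟨1, zero_le_one, le_rfl, by simp [IsBary]⟩
      · exact ⟨α, h0, h1, hα⟩
  · rintro ⟨α, h0, h1, hα⟩
    exact hα.dist_add_dist h0 h1

theorem exists_midpoint (x y : ℍ) : ∃ z, dist x z = dist x y / 2 ∧ dist z y = dist x y / 2 := by
  have hx := x.im_pos
  have hy := y.im_pos
  -- The midpoint is proportional to the sum of the normalized vectors, so the weights of `x` and
  -- `y` are proportional to `1 / x.im` and `1 / y.im`.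
  have h0 : 0 ≤ y.im / (x.im + y.im) := by positivity
  have h1 : y.im / (x.im + y.im) ≤ 1 := by rw [div_le_one (by positivity)]; linarith
  obtain ⟨z, hz⟩ := exists_isBary x y h0 h1
  have hd := hz.dist_add_dist h0 h1
  have e1 := hz.im_mul_cosh
  have e2 := hz.symm.im_mul_cosh
  have : dist x z = dist z y := by
    refine eq_of_cosh_eq dist_nonneg dist_nonneg (mul_left_cancel₀ z.im_pos.ne' ?_)
    rw [dist_comm z y, e1, e2, dist_comm y x]
    field_simp
    ring
  exact ⟨z, by linarith, by linarith⟩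

/-! ### Homogeneous coordinates on the boundary -/

/-- First homogeneous coordinate of a boundary point. -/
noncomputable def hx (ξ : Bdry) : ℝ := ξ.elim 1 id

/-- Second homogeneous coordinate of a boundary point. -/
noncomputable def hy (ξ : Bdry) : ℝ := ξ.elim 0 fun _ => 1

@[simp] theorem hx_coe (t : ℝ) : hx (t : Bdry) = t := rfl
@[simp] theorem hy_coe (t : ℝ) : hy (t : Bdry) = 1 := rfl
@[simp] theorem hx_infty : hx OnePoint.infty = 1 := rfl
@[simp] theorem hy_infty : hy OnePoint.infty = 0 := rfl

/-- The determinant of homogeneous coordinates. -/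
noncomputable def br (a b : Bdry) : ℝ := hx a * hy b - hy a * hx b

theorem br_swap (a b : Bdry) : br b a = - br a b := by unfold br; ring

theorem br_eq_zero {a b : Bdry} : br a b = 0 ↔ a = b := by
  constructor
  · intro h
    unfold br at h
    induction a using OnePoint.rec <;> induction b using OnePoint.rec <;> simp at h ⊢
    linarith
  · rintro rfl; unfold br; ring

/-- The common source of `link_of_sepB`, `Ccw4.one_lt_cr` and `Ccw4.inv_cr_add_inv_cr`. -/
theorem plucker (a b c d : Bdry) : br a b * br c d + br a d * br b c = br a c * br b d := by
  unfold br; ring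

/-- The quadratic form vanishing at the boundary points `p` and `q`. -/
noncomputable def sb (p q ξ : Bdry) : ℝ := br ξ p * br ξ q

/-- The affine function (in the paraboloid model) vanishing on the geodesic from `p` to `q`. -/
noncomputable def sd (p q : Bdry) (z : ℍ) : ℝ :=
  hy p * hy q * sqn z - (hx p * hy q + hy p * hx q) * z.re + hx p * hx q

theorem sb_comm (p q ξ : Bdry) : sb p q ξ = sb q p ξ := by unfold sb; ring
theorem sd_comm (p q : Bdry) (z : ℍ) : sd p q z = sd q p z := by unfold sd; ring

theorem IsBary.sd {x y z : ℍ} {α : ℝ} (h : IsBary x y z α) (p q : Bdry) :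
    sd p q z = α * sd p q x + (1 - α) * sd p q y := by
  unfold DualCurrent.sd; rw [h.1, h.2]; ring

/-- The two ends of the complete geodesic through `x` and `z`: the side of `x` with respect to a
geodesic which separates `x` from `z` is the side of the end `a` beyond `x`. -/
theorem exists_ends {x z : ℍ} (hxz : x ≠ z) : ∃ a c : Bdry, ∀ p q : Bdry,
    sd p q x * sd p q z < 0 → 0 < sd p q x * sb p q a ∧ 0 < sd p q z * sb p q c := by
  wlog H : x.re < z.re ∨ (x.re = z.re ∧ sqn x < sqn z) generalizing x z
  · have H' : z.re < x.re ∨ (z.re = x.re ∧ sqn z < sqn x) := by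
      rcases lt_trichotomy x.re z.re with h | h | h
      · exact absurd (Or.inl h) H
      · rcases lt_trichotomy (sqn x) (sqn z) with h' | h' | h'
        · exact absurd (Or.inr ⟨h, h'⟩) H
        · exact absurd (ext_of_re_sqn h h') hxz
        · exact Or.inr ⟨h.symm, h'⟩
      · exact Or.inl h
    obtain ⟨a, c, hac⟩ := this hxz.symm H'
    exact ⟨c, a, fun p q h => (hac p q (by linarith)).symm⟩
  rcases H with H | ⟨H, H'⟩
  -- `m` and `r` below are the centre and the radius of the Euclidean half circle through `x` and
  -- `z`, on which `|ζ|² = 2 m re ζ + k`.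
  · set m := (sqn z - sqn x) / (2 * (z.re - x.re))
    have hm : 2 * m * (z.re - x.re) = sqn z - sqn x := by
      have : z.re - x.re ≠ 0 := by linarith
      simp only [m]; field_simp
    set k := sqn x - 2 * m * x.re
    set r := Real.sqrt (m ^ 2 + k)
    have hx' := sq_re_lt_sqn x
    have hz' := sq_re_lt_sqn z
    have hk1 : (x.re - m) ^ 2 < m ^ 2 + k := by simp only [k]; nlinarith
    have hk2 : (z.re - m) ^ 2 < m ^ 2 + k := by simp only [k]; nlinarith
    have hr : r ^ 2 = m ^ 2 + k := Real.sq_sqrt (by nlinarith [sq_nonneg (x.re - m)])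
    have hx1 := abs_lt.1 (Real.lt_sqrt_of_sq_lt ((sq_abs _).trans_lt hk1))
    have hz1 := abs_lt.1 (Real.lt_sqrt_of_sq_lt ((sq_abs _).trans_lt hk2))
    change -r < x.re - m ∧ x.re - m < r at hx1
    change -r < z.re - m ∧ z.re - m < r at hz1
    have hpos : 0 < z.re - x.re := by linarith
    refine ⟨((m - r : ℝ) : Bdry), ((m + r : ℝ) : Bdry), fun p q h => ?_⟩
    -- In the paraboloid model the end `m - r` lies on the line through `x` and `z`, beyond `x`. The
    -- affine function therefore takes there a combination of its values with positive weight at `x`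
    -- and negative weight at `z`; as these values have opposite signs, the end lies on the side of
    -- `x`.
    have e1 : (z.re - x.re) * sb p q ((m - r : ℝ) : Bdry) =
        (z.re - (m - r)) * sd p q x + (m - r - x.re) * sd p q z := by
      unfold sb sd br; simp only [hx_coe, hy_coe]
      have : sqn z = sqn x + 2 * m * (z.re - x.re) := by linarith
      rw [this]
      simp only [k] at hr
      linear_combination (z.re - x.re) * hy p * hy q * hr
    have e2 : (z.re - x.re) * sb p q ((m + r : ℝ) : Bdry) =
        (z.re - (m + r)) * sd p q x + (m + r - x.re) * sd p q z := by
      unfold sb sd br; simp only [hx_coe, hy_coe]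
      have : sqn z = sqn x + 2 * m * (z.re - x.re) := by linarith
      rw [this]
      simp only [k] at hr
      linear_combination (z.re - x.re) * hy p * hy q * hr
    have hX : 0 < sd p q x ^ 2 := by
      have : sd p q x ≠ 0 := by rintro h0; rw [h0, zero_mul] at h; exact lt_irrefl _ h
      positivity
    have hZ : 0 < sd p q z ^ 2 := by
      have : sd p q z ≠ 0 := by rintro h0; rw [h0, mul_zero] at h; exact lt_irrefl _ h
      positivity
    constructor
    · refine pos_of_mul_pos_right (a := z.re - x.re) ?_ hpos.le
      have : (z.re - x.re) * (sd p q x * sb p q ((m - r : ℝ) : Bdry)) =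
        (z.re - (m - r)) * sd p q x ^ 2 + (x.re - (m - r)) * -(sd p q x * sd p q z) := by
        linear_combination sd p q x * e1
      rw [this]
      exact add_pos (mul_pos (by linarith) hX) (mul_pos (by linarith) (by linarith))
    · refine pos_of_mul_pos_right (a := z.re - x.re) ?_ hpos.le
      have : (z.re - x.re) * (sd p q z * sb p q ((m + r : ℝ) : Bdry)) =
        (m + r - x.re) * sd p q z ^ 2 + (m + r - z.re) * -(sd p q x * sd p q z) := by
        linear_combination sd p q z * e2
      rw [this]
      exact add_pos (mul_pos (by linarith) hZ) (mul_pos (by linarith) (by linarith))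
  -- Vertical geodesic: the value of `sb` at `∞` is the slope of the affine function along the line.
  · refine ⟨(x.re : Bdry), OnePoint.infty, fun p q h => ?_⟩
    have hX : 0 < sd p q x ^ 2 := by
      have : sd p q x ≠ 0 := by rintro h0; rw [h0, zero_mul] at h; exact lt_irrefl _ h
      positivity
    have hZ : 0 < sd p q z ^ 2 := by
      have : sd p q z ≠ 0 := by rintro h0; rw [h0, mul_zero] at h; exact lt_irrefl _ h
      positivity
    have e1 : (sqn z - sqn x) * sb p q (x.re : Bdry) =
        (sqn z - x.re ^ 2) * sd p q x + (x.re ^ 2 - sqn x) * sd p q z := by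
      unfold sb sd br; simp only [hx_coe, hy_coe, ← H]; ring
    have e2 : (sqn z - sqn x) * sb p q OnePoint.infty = sd p q z - sd p q x := by
      unfold sb sd br; simp only [hx_infty, hy_infty, ← H]; ring
    have hx' := sq_re_lt_sqn x
    constructor
    · refine pos_of_mul_pos_right (a := sqn z - sqn x) ?_ (by linarith)
      have : (sqn z - sqn x) * (sd p q x * sb p q (x.re : Bdry)) =
        (sqn z - x.re ^ 2) * sd p q x ^ 2 + (sqn x - x.re ^ 2) * -(sd p q x * sd p q z) := by
        linear_combination sd p q x * e1
      rw [this]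
      exact add_pos (mul_pos (by linarith) hX) (mul_pos (by linarith) (by linarith))
    · refine pos_of_mul_pos_right (a := sqn z - sqn x) ?_ (by linarith)
      have : (sqn z - sqn x) * (sd p q z * sb p q OnePoint.infty) =
        sd p q z ^ 2 + -(sd p q x * sd p q z) := by
        linear_combination sd p q z * e2
      rw [this]
      linarith

/-! ### Cyclic order and linking on the boundary -/

@[simp] theorem cut_coe (t : ℝ) : cut (t : Bdry) = (t : WithTop ℝ) := rfl
@[simp] theorem cut_infty : cut OnePoint.infty = ⊤ := rfl

/-- Every point occurs in two brackets, so the sign does not depend on the choice of homogeneous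
coordinates. This turns cyclic order into polynomial inequalities with no special role for `∞`. -/
theorem ccw_iff {a b c : Bdry} : Ccw a b c ↔ 0 < br a b * br b c * br c a := by
  have key : ∀ x y z : ℝ, ((x < y ∧ y < z) ∨ (y < z ∧ z < x) ∨ (z < x ∧ x < y)) ↔
      0 < (x - y) * (y - z) * (z - x) := by
    intro x y z
    constructor
    · rintro (⟨h1, h2⟩ | ⟨h1, h2⟩ | ⟨h1, h2⟩)
      · exact mul_pos (mul_pos_of_neg_of_neg (by linarith) (by linarith)) (by linarith)
      · rw [mul_assoc]
        exact mul_pos (by linarith) (mul_pos_of_neg_of_neg (by linarith) (by linarith))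
      · rw [mul_comm, ← mul_assoc]
        exact mul_pos (mul_pos_of_neg_of_neg (by linarith) (by linarith)) (by linarith)
    · intro h
      by_contra hc
      push Not at hc
      obtain ⟨h1, h2, h3⟩ := hc
      rcases lt_or_ge x y with h4 | h4
      · have h5 := h1 h4
        have h6 : x ≤ z := by by_contra h7; exact absurd (h3 (by linarith)) (by linarith)
        nlinarith [mul_nonneg (mul_nonneg (sub_nonneg.2 h4.le) (sub_nonneg.2 h5)) (sub_nonneg.2 h6)]
      · rcases lt_or_ge y z with h5 | h5
        · have h6 := h2 h5
          nlinarith [mul_nonneg (mul_nonneg (sub_nonneg.2 h4) (sub_nonneg.2 h5.le)) (sub_nonneg.2 h6)]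
        · nlinarith [mul_nonneg (mul_nonneg (sub_nonneg.2 h4) (sub_nonneg.2 h5)) (sub_nonneg.2 (h5.trans h4))]
  induction a using OnePoint.rec <;> induction b using OnePoint.rec <;>
    induction c using OnePoint.rec <;> simp [Ccw, br, key]

theorem Ccw.rotate {a b c : Bdry} (h : Ccw a b c) : Ccw b c a := by
  unfold Ccw at *; tauto

theorem ccw_rotate_iff {a b c : Bdry} : Ccw a b c ↔ Ccw b c a :=
  ⟨Ccw.rotate, fun h => h.rotate.rotate⟩

theorem Ccw4.all {a b c d : Bdry} (h : Ccw4 a b c d) :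
    Ccw a b c ∧ Ccw a c d ∧ Ccw a b d ∧ Ccw b c d := by
  unfold Ccw4 Ccw at *; grind

theorem Ccw4.rotate {a b c d : Bdry} (h : Ccw4 a b c d) : Ccw4 b c d a :=
  ⟨h.all.2.2.2, h.all.2.2.1.rotate⟩

/-- The pairs `{p, q}` and `{ξ, η}` of boundary points separate each other. -/
def Link (p q ξ η : Bdry) : Prop := sb p q ξ * sb p q η < 0

theorem link_comm {p q ξ η : Bdry} : Link p q ξ η ↔ Link ξ η p q := by
  have : sb p q ξ * sb p q η = sb ξ η p * sb ξ η q := by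
    unfold sb br; ring
  unfold Link; rw [this]

theorem link_swap_right {p q ξ η : Bdry} : Link p q ξ η ↔ Link p q η ξ := by
  unfold Link; rw [mul_comm]

theorem link_iff_ccw4 {a b c d : Bdry} : Link a c b d ↔ Ccw4 a b c d ∨ Ccw4 a d c b := by
  have e1 : (br a b * br b c * br c a) * (br a c * br c d * br d a) =
      br a c ^ 2 * -(sb a c b * sb a c d) := by unfold sb br; ring
  have e2 : br a d * br d c * br c a = - (br a c * br c d * br d a) := by unfold br; ring
  have e3 : br a c * br c b * br b a = - (br a b * br b c * br c a) := by unfold br; ring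
  unfold Ccw4 Link
  rw [ccw_iff, ccw_iff, ccw_iff, ccw_iff, e2, e3]
  set P := br a b * br b c * br c a
  set Q := br a c * br c d * br d a
  constructor
  · intro h
    have hac : br a c ≠ 0 := by
      intro h0
      obtain rfl := br_eq_zero.1 h0
      unfold sb at h
      nlinarith [mul_nonneg (mul_self_nonneg (br b a)) (mul_self_nonneg (br d a))]
    have h1 : 0 < P * Q := by rw [e1]; exact mul_pos (by positivity) (by linarith)
    rcases pos_and_pos_or_neg_and_neg_of_mul_pos h1 with h2 | h2
    · exact Or.inl h2
    · exact Or.inr ⟨by linarith [h2.2], by linarith [h2.1]⟩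
  · intro h
    have h1 : 0 < P * Q := by
      rcases h with h | h
      · exact mul_pos h.1 h.2
      · exact mul_pos_of_neg_of_neg (by linarith [h.2]) (by linarith [h.1])
    rw [e1] at h1
    have := pos_of_mul_pos_right h1 (sq_nonneg _)
    linarith

theorem Ccw4.link {a b c d : Bdry} (h : Ccw4 a b c d) : Link a c b d := link_iff_ccw4.2 (.inl h)

/-- The affine relation between four boundary points. -/
theorem sb_relation (a b c d p q : Bdry) :
    br b c * br c d * br d b * sb p q a + br a b * br b d * br d a * sb p q c =
      br a c * br c d * br d a * sb p q b + br a b * br b c * br c a * sb p q d := by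
  unfold sb br; ring

/-- The geodesic `p q` separates `a`, `b` from `c`, `d`. -/
def SepB (p q a b c d : Bdry) : Prop :=
  0 < sb p q a * sb p q b ∧ 0 < sb p q c * sb p q d ∧ sb p q a * sb p q c < 0

theorem SepB.signs {p q a b c d : Bdry} (h : SepB p q a b c d) :
    (0 < sb p q a ∧ 0 < sb p q b ∧ sb p q c < 0 ∧ sb p q d < 0) ∨
    (sb p q a < 0 ∧ sb p q b < 0 ∧ 0 < sb p q c ∧ 0 < sb p q d) := by
  obtain ⟨h1, h2, h3⟩ := h
  rcases pos_and_pos_or_neg_and_neg_of_mul_pos h1 with h4 | h4 <;>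
  rcases pos_and_pos_or_neg_and_neg_of_mul_pos h2 with h5 | h5
  · exact absurd h3 (not_lt.2 (mul_pos h4.1 h5.1).le)
  · exact .inl ⟨h4.1, h4.2, h5.1, h5.2⟩
  · exact .inr ⟨h4.1, h4.2, h5.1, h5.2⟩
  · exact absurd h3 (not_lt.2 (mul_pos_of_neg_of_neg h4.1 h5.1).le)

/-- In the cyclic order `a, c, b, d` the chords `ab` and `cd` cross: by `sb_relation` a positive
combination of the values at `a`, `b` equals one of the values at `c`, `d`, which is impossible when
the two pairs have opposite signs. -/
theorem SepB.not_ccw4 {p q a b c d : Bdry} (h : SepB p q a b c d) : ¬ Ccw4 a c b d := by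
  intro hc
  obtain ⟨h1, h2, h3, h4⟩ := hc.all
  rw [ccw_iff] at h1 h2 h3 h4
  have := sb_relation a c b d p q
  rcases h.signs with ⟨s1, s2, s3, s4⟩ | ⟨s1, s2, s3, s4⟩
  · have := mul_pos h4 s1
    have := mul_pos h3 s2
    have := mul_neg_of_pos_of_neg h2 s3
    have := mul_neg_of_pos_of_neg h1 s4
    linarith
  · have := mul_neg_of_pos_of_neg h4 s1
    have := mul_neg_of_pos_of_neg h3 s2
    have := mul_pos h2 s3
    have := mul_pos h1 s4
    linarith

theorem SepB.swap {p q a b c d : Bdry} (h : SepB p q a b c d) : SepB p q a b d c :=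
  ⟨h.1, by rw [mul_comm]; exact h.2.1, by
    rcases h.signs with ⟨s1, s2, s3, s4⟩ | ⟨s1, s2, s3, s4⟩
    · exact mul_neg_of_pos_of_neg s1 s4
    · exact mul_neg_of_neg_of_pos s1 s4⟩

theorem SepB.not_link {p q a b c d : Bdry} (h : SepB p q a b c d) : ¬ Link a b c d := by
  rw [link_iff_ccw4]
  rintro (h' | h')
  · exact h.not_ccw4 h'
  · exact h.swap.not_ccw4 h'

theorem sb_ne_of_mul_neg {p q a c : Bdry} (h : sb p q a * sb p q c < 0) : br a c ≠ 0 := by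
  intro h0
  obtain rfl := br_eq_zero.1 h0
  nlinarith [mul_self_nonneg (sb p q a)]

/-- If the pairs `ab | cd` and `ad | bc` are separated by geodesics, then `ac` and `bd` cross. -/
theorem link_of_sepB {p q p' q' a b c d : Bdry} (h : SepB p q a b c d) (h' : SepB p' q' a d b c) :
    Link a c b d := by
  have nac := sb_ne_of_mul_neg h.2.2
  have nad := sb_ne_of_mul_neg h.swap.2.2
  have nab := sb_ne_of_mul_neg h'.2.2
  have l1 := h.not_link
  have l2 := h'.not_link
  have nbc : br b c ≠ 0 := by
    rcases h.signs with ⟨s1, s2, s3, s4⟩ | ⟨s1, s2, s3, s4⟩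
    · exact sb_ne_of_mul_neg (mul_neg_of_pos_of_neg s2 s3)
    · exact sb_ne_of_mul_neg (mul_neg_of_neg_of_pos s2 s3)
  have nbd : br b d ≠ 0 := by
    rcases h.signs with ⟨s1, s2, s3, s4⟩ | ⟨s1, s2, s3, s4⟩
    · exact sb_ne_of_mul_neg (mul_neg_of_pos_of_neg s2 s4)
    · exact sb_ne_of_mul_neg (mul_neg_of_neg_of_pos s2 s4)
  have ncd : br c d ≠ 0 := by
    rcases h'.signs with ⟨s1, s2, s3, s4⟩ | ⟨s1, s2, s3, s4⟩
    · exact sb_ne_of_mul_neg (mul_neg_of_neg_of_pos s4 s2)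
    · exact sb_ne_of_mul_neg (mul_neg_of_pos_of_neg s4 s2)
  -- Now `A + C = B`. The two pairs that do not link give `B * C ≥ 0` and `A * B ≥ 0`, with all
  -- three numbers nonzero, so `A` and `C` have the same sign.
  have hp := plucker a b c d
  set A := br a b * br c d
  set B := br a c * br b d
  set C := br a d * br b c
  have e0 : sb a c b * sb a c d = - (A * C) := by simp only [A, C]; unfold sb br; ring
  have e1 : sb a b c * sb a b d = B * C := by simp only [B, C]; unfold sb br; ring
  have e2 : sb a d b * sb a d c = A * B := by simp only [A, B]; unfold sb br; ring
  unfold Link at *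
  rw [e1] at l1
  rw [e2] at l2
  rw [e0]
  have hA : A ≠ 0 := mul_ne_zero nab ncd
  have hC : C ≠ 0 := mul_ne_zero nad nbc
  have hB : B ≠ 0 := mul_ne_zero nac nbd
  rw [← hp] at l1 l2 hB
  rcases lt_or_gt_of_ne (mul_ne_zero hA hC) with h3 | h3
  · exfalso
    nlinarith [sq_nonneg (A + C), sq_pos_of_ne_zero hB]
  · linarith

/-! ### The space of geodesics -/

theorem Geod.exists_mk (g : Geod) : ∃ p, g = Geod.mk p := by
  obtain ⟨s, hs⟩ := g
  induction s using Sym2.ind with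
  | _ x y => exact ⟨⟨(x, y), fun h => hs (Sym2.mk_isDiag_iff.2 h)⟩, rfl⟩

/-- `sb` as a function of a geodesic. -/
noncomputable def sbG (g : Geod) (ξ : Bdry) : ℝ :=
  Sym2.lift ⟨fun p q => sb p q ξ, fun p q => sb_comm p q ξ⟩ g.1

/-- `sd` as a function of a geodesic. -/
noncomputable def sdG (g : Geod) (z : ℍ) : ℝ :=
  Sym2.lift ⟨fun p q => sd p q z, fun p q => sd_comm p q z⟩ g.1

@[simp] theorem sbG_mk (p : {p : Bdry × Bdry // p.1 ≠ p.2}) (ξ : Bdry) :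
    sbG (Geod.mk p) ξ = sb p.1.1 p.1.2 ξ := rfl

@[simp] theorem sdG_mk (p : {p : Bdry × Bdry // p.1 ≠ p.2}) (z : ℍ) :
    sdG (Geod.mk p) z = sd p.1.1 p.1.2 z := rfl

theorem sbG_eq_zero {g : Geod} {ξ : Bdry} : sbG g ξ = 0 ↔ ξ ∈ g.1 := by
  obtain ⟨p, rfl⟩ := g.exists_mk
  rw [sbG_mk, sb, mul_eq_zero, br_eq_zero, br_eq_zero]
  exact Sym2.mem_iff.symm

theorem IsBary.sdG {x y z : ℍ} {α : ℝ} (h : IsBary x y z α) (g : Geod) :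
    sdG g z = α * sdG g x + (1 - α) * sdG g y := by
  obtain ⟨p, rfl⟩ := g.exists_mk
  exact h.sd _ _

theorem mem_line_iff {g : Geod} {z : ℍ} : z ∈ g.line ↔ sdG g z = 0 := by
  obtain ⟨⟨⟨p, q⟩, hpq⟩, rfl⟩ := g.exists_mk
  rw [sdG_mk]
  constructor
  · rintro (⟨a, b, h, h'⟩ | ⟨a, h, h'⟩) <;> change s(p, q) = _ at h <;>
      rcases Sym2.eq_iff.1 h with ⟨rfl, rfl⟩ | ⟨rfl, rfl⟩ <;> simp [sd, sqn] <;> linarith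
  · intro h
    induction p using OnePoint.rec with
    | infty =>
      induction q using OnePoint.rec with
      | infty => exact absurd rfl hpq
      | coe b =>
        simp [sd] at h
        exact Or.inr ⟨b, Sym2.eq_swap, by linarith⟩
    | coe a =>
      induction q using OnePoint.rec with
      | infty =>
        simp [sd] at h
        exact Or.inr ⟨a, rfl, by linarith⟩
      | coe b =>
        simp [sd, sqn] at h
        exact Or.inl ⟨a, b, rfl, by linarith⟩

/-- The geodesics which strictly separate `x` from `y`. -/
def sepSet (x y : ℍ) : Set Geod := {g | sdG g x * sdG g y < 0}

/-- The geodesics through `x`. -/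
def pencil (x : ℍ) : Set Geod := {g | sdG g x = 0}

/-- Along the segment `sdG g` is affine in the barycentric coordinate and changes sign, so it has
exactly one zero, in the interior. -/
theorem exists_line_inter_seg {g : Geod} {x y : ℍ} (h : g ∈ sepSet x y) :
    ∃ p, p ≠ x ∧ p ≠ y ∧ g.line ∩ seg x y = {p} := by
  replace h : sdG g x * sdG g y < 0 := h
  have hX : sdG g x ≠ 0 := by rintro h0; rw [h0, zero_mul] at h; exact lt_irrefl _ h
  have hY : sdG g y ≠ 0 := by rintro h0; rw [h0, mul_zero] at h; exact lt_irrefl _ h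
  have hXY : sdG g y - sdG g x ≠ 0 := by
    intro h0
    rw [sub_eq_zero.1 h0] at h
    nlinarith [mul_self_nonneg (sdG g x)]
  set α := sdG g y / (sdG g y - sdG g x)
  have hα : α * (sdG g y - sdG g x) = sdG g y := by simp only [α]; field_simp
  have hb : 0 ≤ α ∧ α ≤ 1 := by
    rcases lt_or_gt_of_ne hY with h1 | h1
    · have h2 : 0 < sdG g x := by by_contra h3; nlinarith
      exact ⟨div_nonneg_of_nonpos h1.le (by linarith), by
        simp only [α]; rw [div_le_one_of_neg (by linarith)]; linarith⟩
    · have h2 : sdG g x < 0 := by by_contra h3; nlinarith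
      exact ⟨div_nonneg h1.le (by linarith), by
        simp only [α]; rw [div_le_one (by linarith)]; linarith⟩
  obtain ⟨z, hz⟩ := exists_isBary x y hb.1 hb.2
  have hz0 : sdG g z = 0 := by rw [hz.sdG]; linear_combination -hα
  refine ⟨z, ?_, ?_, ?_⟩
  · rintro rfl; exact hX hz0
  · rintro rfl; exact hY hz0
  · ext w
    constructor
    · rintro ⟨hw1, hw2⟩
      obtain ⟨β, -, -, hβ⟩ := mem_seg_iff.1 hw2
      have h0 := mem_line_iff.1 hw1
      rw [hβ.sdG] at h0
      have : β = α := by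
        refine mul_right_cancel₀ hXY ?_
        rw [hα]; linear_combination -h0
      subst this
      exact ext_of_re_sqn (hβ.1.trans hz.1.symm) (hβ.2.trans hz.2.symm)
    · rintro rfl
      exact ⟨mem_line_iff.2 hz0, mem_seg_iff.2 ⟨α, hb.1, hb.2, hz⟩⟩

theorem sepSet_subset_transversal (x y : ℍ) :
    sepSet x y ⊆ transversal (segCO x y) ∩ transversal (segOC x y) := by
  intro g hg
  obtain ⟨p, hx, hy, h⟩ := exists_line_inter_seg hg
  refine ⟨⟨p, ?_⟩, ⟨p, ?_⟩⟩ <;> simp only [segCO, segOC] <;>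
    rw [← Set.inter_sdiff_assoc, h] <;> ext q <;> simp <;> rintro rfl <;> assumption

theorem subset_sepSet_of_mem_line {x y p : ℍ} {g : Geod} (h1 : p ∈ g.line) (h2 : p ∈ seg x y) :
    g ∈ sepSet x y ∪ pencil x ∪ pencil y := by
  obtain ⟨α, a0, a1, hα⟩ := mem_seg_iff.1 h2
  have h0 := mem_line_iff.1 h1
  rw [hα.sdG] at h0
  by_contra hc
  simp only [Set.mem_union, not_or] at hc
  obtain ⟨⟨hc1, hc2⟩, hc3⟩ := hc
  replace hc1 : ¬ (sdG g x * sdG g y < 0) := hc1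
  replace hc2 : sdG g x ≠ 0 := hc2
  replace hc3 : sdG g y ≠ 0 := hc3
  have hpos : 0 < sdG g x * sdG g y := lt_of_le_of_ne (not_lt.1 hc1) (mul_ne_zero hc2 hc3).symm
  have h4 : α * sdG g x ^ 2 + (1 - α) * (sdG g x * sdG g y) = 0 := by
    linear_combination sdG g x * h0
  have h5 : 0 < sdG g x ^ 2 := by positivity
  rcases a0.eq_or_lt with rfl | a0
  · linarith
  · nlinarith [mul_pos a0 h5, mul_nonneg (sub_nonneg.2 a1) hpos.le]

/-- With `sepSet_subset_transversal` this shows that, up to the pencils at the endpoints, the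
geodesics transverse to a half-open segment are those separating its endpoints. -/
theorem transversal_subset (x y : ℍ) {τ : Set ℍ} (hτ : τ ⊆ seg x y) :
    transversal τ ⊆ sepSet x y ∪ pencil x ∪ pencil y := by
  rintro g ⟨p, hp⟩
  have : p ∈ g.line ∩ τ := by rw [hp]; rfl
  exact subset_sepSet_of_mem_line this.1 (hτ this.2)

/-! ### Continuity of the separation functions -/

/-- The squared norm of the homogeneous coordinates. -/
noncomputable def nm (p : Bdry) : ℝ := hx p ^ 2 + hy p ^ 2

theorem nm_pos (p : Bdry) : 0 < nm p := by
  induction p using OnePoint.rec with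
  | infty => simp [nm]
  | coe t => simp only [nm, hx_coe, hy_coe]; positivity

theorem tendsto_inv_nm : Tendsto (fun t : ℝ => 1 / (t ^ 2 + 1)) (cocompact ℝ) (𝓝 0) := by
  have h1 : Tendsto (fun t : ℝ => t ^ 2 + 1) (cocompact ℝ) atTop := by
    refine tendsto_atTop_add_const_right _ _ ?_
    have := (tendsto_pow_atTop (α := ℝ) two_ne_zero).comp (tendsto_norm_cocompact_atTop (E := ℝ))
    refine this.congr fun t => ?_
    simp
  exact h1.inv_tendsto_atTop.congr fun t => (one_div _).symm

/-- The coordinates `hx`, `hy` are not continuous at `∞`, but the quadratic monomials divided by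
`nm` are. The sign conditions on geodesics used below have degree two in each endpoint, so they can
be normalized in this way. -/
theorem continuous_n1 : Continuous fun p : Bdry => hy p ^ 2 / nm p := by
  rw [OnePoint.continuous_iff]
  constructor
  · simpa [nm] using tendsto_inv_nm
  · have : Continuous fun t : ℝ => 1 / (t ^ 2 + 1) :=
      continuous_const.div (by fun_prop) fun t => by positivity
    simpa [nm] using this

theorem continuous_n3 : Continuous fun p : Bdry => hx p ^ 2 / nm p := by
  have : (fun p : Bdry => hx p ^ 2 / nm p) = fun p => 1 - hy p ^ 2 / nm p := by
    ext p
    have := nm_pos p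
    field_simp
    simp [nm]
  rw [this]
  exact continuous_const.sub continuous_n1

theorem continuous_n2 : Continuous fun p : Bdry => hx p * hy p / nm p := by
  rw [OnePoint.continuous_iff]
  constructor
  · have h1 := ((OnePoint.continuous_iff _).1 continuous_n3).1
    have h2 : Tendsto (fun t : ℝ => t⁻¹) (cocompact ℝ) (𝓝 0) := by
      rw [← Metric.cobounded_eq_cocompact]; exact tendsto_inv₀_cobounded
    rw [coclosedCompact_eq_cocompact] at h1 ⊢
    have h3 := h2.mul h1
    simp only [zero_mul, hy_infty, mul_zero, zero_div] at h3 ⊢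
    refine h3.congr fun t => ?_
    simp only [hx_coe, hy_coe, nm]
    by_cases ht : t = 0
    · simp [ht]
    · field_simp
  · have : Continuous fun t : ℝ => t / (t ^ 2 + 1) :=
      continuous_id.div (by fun_prop) fun t => by positivity
    simpa [nm] using this

/-- The normalized product of the values of `sd p q` at `x` and `y`. -/
noncomputable def sdProd (x y : ℍ) (p : Bdry × Bdry) : ℝ :=
  sd p.1 p.2 x * sd p.1 p.2 y / (nm p.1 * nm p.2)

/-- The normalized product of the values of `sb p q` at `a` and `b`. -/
noncomputable def sbProd (a b : Bdry) (p : Bdry × Bdry) : ℝ :=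
  sb p.1 p.2 a * sb p.1 p.2 b / (nm p.1 * nm p.2)

theorem continuous_br_mul (a b : Bdry) : Continuous fun p : Bdry => br a p * br b p / nm p := by
  have : (fun p : Bdry => br a p * br b p / nm p) = fun p =>
      hx a * hx b * (hy p ^ 2 / nm p) - (hx a * hy b + hy a * hx b) * (hx p * hy p / nm p)
        + hy a * hy b * (hx p ^ 2 / nm p) := by
    ext p
    have := nm_pos p
    unfold br
    field_simp
    ring
  rw [this]
  exact ((continuous_n1.const_mul _).sub (continuous_n2.const_mul _)).add (continuous_n3.const_mul _)

theorem continuous_sbProd (a b : Bdry) : Continuous (sbProd a b) := by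
  have : sbProd a b = fun p => (br a p.1 * br b p.1 / nm p.1) * (br a p.2 * br b p.2 / nm p.2) := by
    ext p
    have := nm_pos p.1
    have := nm_pos p.2
    unfold sbProd sb
    field_simp
  rw [this]
  exact ((continuous_br_mul a b).comp continuous_fst).mul ((continuous_br_mul a b).comp continuous_snd)

theorem continuous_sdProd (x y : ℍ) : Continuous (sdProd x y) := by
  have : sdProd x y = fun p => 
      (sqn x * sqn y) * (hy p.1 ^ 2 / nm p.1) * (hy p.2 ^ 2 / nm p.2)
      - (sqn x * y.re + sqn y * x.re) * ((hx p.1 * hy p.1 / nm p.1) * (hy p.2 ^ 2 / nm p.2) +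
          (hy p.1 ^ 2 / nm p.1) * (hx p.2 * hy p.2 / nm p.2))
      + (x.re * y.re) * ((hx p.1 ^ 2 / nm p.1) * (hy p.2 ^ 2 / nm p.2) +
          2 * ((hx p.1 * hy p.1 / nm p.1) * (hx p.2 * hy p.2 / nm p.2)) +
          (hy p.1 ^ 2 / nm p.1) * (hx p.2 ^ 2 / nm p.2))
      + (sqn x + sqn y) * ((hx p.1 * hy p.1 / nm p.1) * (hx p.2 * hy p.2 / nm p.2))
      - (x.re + y.re) * ((hx p.1 ^ 2 / nm p.1) * (hx p.2 * hy p.2 / nm p.2) +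
          (hx p.1 * hy p.1 / nm p.1) * (hx p.2 ^ 2 / nm p.2))
      + (hx p.1 ^ 2 / nm p.1) * (hx p.2 ^ 2 / nm p.2) := by
    ext p
    have := nm_pos p.1
    have := nm_pos p.2
    unfold sdProd sd
    field_simp
    ring
  rw [this]
  have a1 := continuous_n1.comp (continuous_fst (X := Bdry) (Y := Bdry))
  have a2 := continuous_n2.comp (continuous_fst (X := Bdry) (Y := Bdry))
  have a3 := continuous_n3.comp (continuous_fst (X := Bdry) (Y := Bdry))
  have b1 := continuous_n1.comp (continuous_snd (X := Bdry) (Y := Bdry))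
  have b2 := continuous_n2.comp (continuous_snd (X := Bdry) (Y := Bdry))
  have b3 := continuous_n3.comp (continuous_snd (X := Bdry) (Y := Bdry))
  simp only [Function.comp_def] at a1 a2 a3 b1 b2 b3
  fun_prop

theorem isOpen_of_preimage {S : Set Geod} {U : Set (Bdry × Bdry)} (hU : IsOpen U)
    (h : ∀ p : {p : Bdry × Bdry // p.1 ≠ p.2}, Geod.mk p ∈ S ↔ p.1 ∈ U) : IsOpen S := by
  rw [isOpen_coinduced]
  have : Geod.mk ⁻¹' S = Subtype.val ⁻¹' U := by ext p; exact h p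
  rw [this]
  exact hU.preimage continuous_subtype_val

theorem isOpen_sepSet (x y : ℍ) : IsOpen (sepSet x y) := by
  refine isOpen_of_preimage (isOpen_lt (continuous_sdProd x y) (continuous_const (y := (0 : ℝ)))) ?_
  intro p
  show sd _ _ x * sd _ _ y < 0 ↔ sdProd x y p.1 < 0
  rw [sdProd, div_lt_iff₀ (mul_pos (nm_pos _) (nm_pos _)), zero_mul]

theorem isOpen_sdG_pos (x y : ℍ) : IsOpen {g : Geod | 0 < sdG g x * sdG g y} := by
  refine isOpen_of_preimage (isOpen_lt (continuous_const (y := (0 : ℝ))) (continuous_sdProd x y)) ?_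
  intro p
  show 0 < sd _ _ x * sd _ _ y ↔ 0 < sdProd x y p.1
  rw [sdProd, lt_div_iff₀ (mul_pos (nm_pos _) (nm_pos _)), zero_mul]

/-- The geodesics which separate the boundary points `a` and `b`. -/
def linkSet (a b : Bdry) : Set Geod := {g | sbG g a * sbG g b < 0}

theorem isOpen_linkSet (a b : Bdry) : IsOpen (linkSet a b) := by
  refine isOpen_of_preimage (isOpen_lt (continuous_sbProd a b) (continuous_const (y := (0 : ℝ)))) ?_
  intro p
  show sb _ _ a * sb _ _ b < 0 ↔ sbProd a b p.1 < 0
  rw [sbProd, div_lt_iff₀ (mul_pos (nm_pos _) (nm_pos _)), zero_mul]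

theorem mk_mem_linkSet {p : {p : Bdry × Bdry // p.1 ≠ p.2}} {a b : Bdry} :
    Geod.mk p ∈ linkSet a b ↔ Link p.1.1 p.1.2 a b := Iff.rfl

/-- The geodesics through the boundary point `a`. -/
def idealPencil (a : Bdry) : Set Geod := {g | a ∈ g.1}

theorem isOpen_ccw (a b : Bdry) : IsOpen {ξ | Ccw a ξ b} := by
  have : {ξ | Ccw a ξ b} = {ξ | -(br a ξ * br b ξ / nm ξ) * br b a > 0} := by
    ext ξ
    show Ccw a ξ b ↔ 0 < -(br a ξ * br b ξ / nm ξ) * br b a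
    have e : -(br a ξ * br b ξ / nm ξ) * br b a = (br a ξ * br ξ b * br b a) / nm ξ := by
      rw [br_swap b ξ]; ring
    rw [ccw_iff, e, lt_div_iff₀ (nm_pos _), zero_mul]
  rw [this]
  exact isOpen_lt continuous_const ((continuous_br_mul a b).neg.mul_const _)

/-! ### Boxes -/

/-- For `a`, `b`, `c`, `d` in cyclic order, the box `(a, b) × (c, d)`. -/
def obox (a b c d : Bdry) : Set Geod := linkSet a b ∩ linkSet c d

theorem obox_comm (a b c d : Bdry) : obox a b c d = obox c d a b := Set.inter_comm _ _

theorem linkSet_comm (a b : Bdry) : linkSet a b = linkSet b a := by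
  ext g; unfold linkSet; rw [Set.mem_ofPred_eq, Set.mem_ofPred_eq, mul_comm]

theorem isOpen_obox (a b c d : Bdry) : IsOpen (obox a b c d) :=
  (isOpen_linkSet a b).inter (isOpen_linkSet c d)

theorem link_iff_ccw {a b p q : Bdry} : Link p q a b ↔ (Ccw a p b ∧ Ccw b q a) ∨ (Ccw a q b ∧ Ccw b p a) := by
  rw [link_comm, link_iff_ccw4]
  unfold Ccw4
  rw [ccw_rotate_iff (a := a) (b := b) (c := q), ccw_rotate_iff (a := a) (b := b) (c := p)]

theorem ccw_of_box {a b c d x y : Bdry} (h : Ccw4 a b c d) (hx : Ccw a x b) (hy : Ccw c y d) :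
    Ccw b y a ∧ Ccw d x c := by
  unfold Ccw4 Ccw at *; grind

theorem not_ccw_of_box {a b c d x : Bdry} (h : Ccw4 a b c d) (hx : Ccw a x b) : ¬ Ccw c x d := by
  unfold Ccw4 Ccw at *; grind

/-- Defining `obox` by linking makes it open and compatible with homeomorphisms. It is the expected
product of arcs because each linking puts exactly one end in its arc and the two arcs are disjoint.
-/
theorem mem_obox_iff {a b c d : Bdry} (h : Ccw4 a b c d) {g : Geod} :
    g ∈ obox a b c d ↔ ∃ x y, Ccw a x b ∧ Ccw c y d ∧ g.1 = s(x, y) := by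
  obtain ⟨p, rfl⟩ := g.exists_mk
  constructor
  · rintro ⟨h1, h2⟩
    rw [mk_mem_linkSet, link_iff_ccw] at h1 h2
    rcases h1 with h1 | h1 <;> rcases h2 with h2 | h2
    · exact absurd h2.1 (not_ccw_of_box h h1.1)
    · exact ⟨p.1.1, p.1.2, h1.1, h2.1, rfl⟩
    · exact ⟨p.1.2, p.1.1, h1.1, h2.1, Sym2.eq_swap⟩
    · exact absurd h2.1 (not_ccw_of_box h h1.1)
  · rintro ⟨x, y, hx, hy, he⟩
    obtain ⟨e1, e2⟩ := ccw_of_box h hx hy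
    rcases Sym2.eq_iff.1 he with ⟨h1, h2⟩ | ⟨h1, h2⟩
    · refine ⟨mk_mem_linkSet.2 (link_iff_ccw.2 ?_), mk_mem_linkSet.2 (link_iff_ccw.2 ?_)⟩
      · exact .inl ⟨h1 ▸ hx, h2 ▸ e1⟩
      · exact .inr ⟨h2 ▸ hy, h1 ▸ e2⟩
    · refine ⟨mk_mem_linkSet.2 (link_iff_ccw.2 ?_), mk_mem_linkSet.2 (link_iff_ccw.2 ?_)⟩
      · exact .inr ⟨h2 ▸ hx, h1 ▸ e1⟩
      · exact .inl ⟨h1 ▸ hy, h2 ▸ e2⟩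

theorem obox_subset_box {a b c d : Bdry} (h : Ccw4 a b c d) {I J : Set Bdry}
    (hI : ∀ ξ, Ccw a ξ b → ξ ∈ I) (hJ : ∀ ξ, Ccw c ξ d → ξ ∈ J) : obox a b c d ⊆ box I J := by
  intro g hg
  obtain ⟨x, y, hx, hy, he⟩ := (mem_obox_iff h).1 hg
  exact ⟨x, hI x hx, y, hJ y hy, he⟩

/-- Which endpoints the arcs include only matters on the ideal pencils of the vertices, null sets
for the currents considered here. -/
theorem box_subset_obox {a b c d : Bdry} (h : Ccw4 a b c d) {I J : Set Bdry}
    (hI : ∀ ξ ∈ I, ξ = a ∨ ξ = b ∨ Ccw a ξ b) (hJ : ∀ ξ ∈ J, ξ = c ∨ ξ = d ∨ Ccw c ξ d) :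
    box I J ⊆ obox a b c d ∪ (idealPencil a ∪ idealPencil b ∪ idealPencil c ∪ idealPencil d) := by
  rintro g ⟨x, hx, y, hy, he⟩
  have hxm : x ∈ g.1 := by rw [he]; exact Sym2.mem_mk_left x y
  have hym : y ∈ g.1 := by rw [he]; exact Sym2.mem_mk_right x y
  rcases hI x hx with rfl | rfl | hx
  · exact Or.inr (.inl (.inl (.inl hxm)))
  · exact Or.inr (.inl (.inl (.inr hxm)))
  rcases hJ y hy with rfl | rfl | hy
  · exact Or.inr (.inl (.inr hym))
  · exact Or.inr (.inr hym)
  · exact Or.inl ((mem_obox_iff h).2 ⟨x, y, hx, hy, he⟩)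

theorem exists_ccw4_around {p q : Bdry} (h : p ≠ q) :
    ∃ a b c d, Ccw4 a b c d ∧ Ccw a p b ∧ Ccw c q d := by
  wlog H : cut p < cut q generalizing p q
  · have H' : cut q < cut p := by
      induction p using OnePoint.rec <;> induction q using OnePoint.rec <;> simp_all
      exact lt_of_le_of_ne H (Ne.symm h)
    obtain ⟨a, b, c, d, h1, h2, h3⟩ := this h.symm H'
    exact ⟨c, d, a, b, h1.rotate.rotate, h3, h2⟩
  induction p using OnePoint.rec with
  | infty => simp at H
  | coe s =>
    have co : ∀ x y : ℝ, x < y → (x : WithTop ℝ) < (y : WithTop ℝ) := fun x y => WithTop.coe_lt_coe.2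
    induction q using OnePoint.rec with
    | infty =>
      refine ⟨(s - 1 : ℝ), (s + 1 : ℝ), (s + 2 : ℝ), (s - 2 : ℝ), ⟨?_, ?_⟩, ?_, ?_⟩
      · exact .inl ⟨co _ _ (by linarith), co _ _ (by linarith)⟩
      · exact .inr (.inr ⟨co _ _ (by linarith), co _ _ (by linarith)⟩)
      · exact .inl ⟨co _ _ (by linarith), co _ _ (by linarith)⟩
      · exact .inr (.inr ⟨co _ _ (by linarith), WithTop.coe_lt_top _⟩)
    | coe t =>
      have hst : s < t := WithTop.coe_lt_coe.1 H
      refine ⟨(s - 1 : ℝ), (s + (t - s) / 3 : ℝ), (t - (t - s) / 3 : ℝ), (t + 1 : ℝ), ⟨?_, ?_⟩, ?_, ?_⟩ <;>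
        exact .inl ⟨co _ _ (by linarith), co _ _ (by linarith)⟩

/-! ### Coarsely bi-Lipschitz maps of the hyperbolic plane -/

/-- `exp (-(x | y)_p)`, where `(x | y)_p` is the Gromov product. -/
noncomputable def rho (p x y : ℍ) : ℝ := Real.exp ((dist x y - dist x p - dist y p) / 2)

theorem rho_comm (p x y : ℍ) : rho p x y = rho p y x := by
  unfold rho; rw [dist_comm x y]; ring_nf

/-- This is `exp_four_point` with fourth point `p`, rescaled. The absence of a multiplicative
constant is what allows summation along a chain in `IsCoarse.rho_ray_le`. -/
theorem rho_triangle (p x y z : ℍ) : rho p x z ≤ rho p x y + rho p y z := by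
  have h := exp_four_point x y z p
  have e := Real.exp_pos (-((dist x p + dist y p + dist z p) / 2))
  have h' := mul_le_mul_of_nonneg_right h e.le
  rw [add_mul, ← Real.exp_add, ← Real.exp_add, ← Real.exp_add] at h'
  unfold rho
  rw [show (dist x z - dist x p - dist z p) / 2 = (dist x z + dist y p) / 2 +
      -((dist x p + dist y p + dist z p) / 2) by ring,
    show (dist x y - dist x p - dist y p) / 2 = (dist x y + dist z p) / 2 +
      -((dist x p + dist y p + dist z p) / 2) by ring,
    show (dist y z - dist y p - dist z p) / 2 = (dist y z + dist x p) / 2 +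
      -((dist x p + dist y p + dist z p) / 2) by ring]
  exact h'

theorem rho_le_of_base (p o x y : ℍ) : rho o x y ≤ Real.exp (dist p o) * rho p x y := by
  unfold rho
  rw [← Real.exp_add]
  refine Real.exp_le_exp.2 ?_
  have h1 := dist_triangle x o p
  have h2 := dist_triangle y o p
  rw [dist_comm p o]
  linarith

/-- Repeated bisection bounds the image distance by `C * 2 ^ n` when the distance is at most `2 ^
n`; rounding up to a power of two costs the factor `2`. -/
theorem dist_le_of_step {f : ℍ → ℍ} {C : ℝ} (h : ∀ z w, dist z w ≤ 1 → dist (f z) (f w) ≤ C)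
    (z w : ℍ) : dist (f z) (f w) ≤ C * (2 * dist z w + 1) := by
  have hC : 0 ≤ C := by
    have := h z z (by simp)
    rwa [dist_self] at this
  have key : ∀ n : ℕ, ∀ z w, dist z w ≤ 2 ^ n → dist (f z) (f w) ≤ C * 2 ^ n := by
    intro n
    induction n with
    | zero => intro z w hzw; simpa using h z w (by simpa using hzw)
    | succ n ih =>
      intro z w hzw
      obtain ⟨m, h1, h2⟩ := exists_midpoint z w
      rw [pow_succ] at hzw ⊢
      have e1 := ih z m (by linarith)
      have e2 := ih m w (by linarith)
      have := dist_triangle (f z) (f m) (f w)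
      linarith
  rcases le_or_gt (dist z w) 1 with h1 | h1
  · have := h z w h1
    nlinarith [dist_nonneg (x := z) (y := w)]
  · obtain ⟨n, hn1, hn2⟩ := exists_nat_pow_near h1.le (one_lt_two)
    have := key (n + 1) z w hn2.le
    rw [pow_succ] at this
    nlinarith

/-- `f` is coarsely Lipschitz, and coarsely expanding. -/
structure IsCoarse (f : ℍ → ℍ) (C L : ℝ) : Prop where
  pos : 0 < L
  step : ∀ z w, dist z w ≤ 1 → dist (f z) (f w) ≤ C
  lower : ∀ z w, dist z w / L - 1 ≤ dist (f z) (f w)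

/-- The constant in `rho_ray_le`. -/
noncomputable def rayConst (C L : ℝ) : ℝ := Real.exp (C / 2 + 1) * (1 - Real.exp (-1 / L))⁻¹

theorem rayConst_pos (C : ℝ) {L : ℝ} (hL : 0 < L) : 0 < rayConst C L := by
  have : Real.exp (-1 / L) < 1 := (by rw [Real.exp_lt_one_iff, neg_div]; simpa using hL)
  have : 0 < 1 - Real.exp (-1 / L) := by linarith
  unfold rayConst; positivity

/-- On the `n`-th unit step of the ray the images are within `C` of each other and at distance at
least `(A + n) / L - 1` from `f o`, so `rho` is at most `exp (C / 2 + 1 - (A + n) / L)`. The steps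
sum to a geometric series. -/
theorem IsCoarse.rho_ray_le {f : ℍ → ℍ} {C L : ℝ} (h : IsCoarse f C L) (o : ℍ) {γ : ℝ → ℍ} {A : ℝ}
    (h1 : ∀ s t, dist (γ s) (γ t) ≤ |s - t|) (h2 : ∀ s, 0 ≤ s → A + s ≤ dist (γ s) o)
    {S : ℝ} (hS : 0 ≤ S) :
    rho (f o) (f (γ 0)) (f (γ S)) ≤ rayConst C L * Real.exp (-A / L) := by
  have hL := h.pos
  set K := Real.exp (C / 2 + 1) * Real.exp (-A / L)
  set q := Real.exp (-1 / L)
  have hq0 : 0 < q := Real.exp_pos _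
  have hq1 : q < 1 := (by rw [Real.exp_lt_one_iff, neg_div]; simpa using hL)
  have step : ∀ n : ℕ, ∀ t : ℝ, n ≤ t → t ≤ n + 1 → rho (f o) (f (γ n)) (f (γ t)) ≤ K * q ^ n := by
    intro n t hn ht
    have e1 := h.step (γ n) (γ t) ((h1 _ _).trans (by rw [abs_le]; constructor <;> linarith))
    have e2 := h.lower (γ n) o
    have e3 := h.lower (γ t) o
    have e4 := h2 n (by positivity)
    have e5 := h2 t (le_trans (by positivity) hn)
    have e6 : (A + n) / L ≤ dist (γ n) o / L := div_le_div_of_nonneg_right e4 hL.le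
    have e7 : (A + n) / L ≤ dist (γ t) o / L := div_le_div_of_nonneg_right (by linarith) hL.le
    have : K * q ^ n = Real.exp (C / 2 + 1 - (A + n) / L) := by
      simp only [K, q]
      rw [← Real.exp_nat_mul, ← Real.exp_add, ← Real.exp_add]
      congr 1
      field_simp
      ring
    rw [this]
    exact Real.exp_le_exp.2 (by linarith)
  have main : ∀ n : ℕ, ∀ t : ℝ, n ≤ t → t ≤ n + 1 →
      rho (f o) (f (γ 0)) (f (γ t)) ≤ K * ∑ k ∈ Finset.range (n + 1), q ^ k := by
    intro n
    induction n with
    | zero =>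
      intro t h0 ht
      simpa using step 0 t h0 ht
    | succ n ih =>
      intro t h0 ht
      have e1 := ih (n + 1 : ℕ) (by push_cast; linarith) (by push_cast; linarith)
      have e2 := step (n + 1) t h0 ht
      rw [Finset.sum_range_succ, mul_add]
      exact (rho_triangle _ _ _ _).trans (add_le_add e1 e2)
  have e := main ⌊S⌋₊ S (Nat.floor_le hS) (Nat.lt_floor_add_one S).le
  refine e.trans ?_
  have hs : ∑ k ∈ Finset.range (⌊S⌋₊ + 1), q ^ k ≤ (1 - q)⁻¹ := by
    rw [← tsum_geometric_of_lt_one hq0.le hq1]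
    exact (summable_geometric_of_lt_one hq0.le hq1).sum_le_tsum _ fun _ _ => by positivity
  calc _ ≤ K * (1 - q)⁻¹ := mul_le_mul_of_nonneg_left hs (by positivity)
    _ = _ := by simp only [rayConst, K, q]; ring

theorem exists_circlePt (z : ℍ) : ∃ s, z = circlePt (Real.sqrt (sqn z))
    (Real.sqrt_pos.2 ((sq_nonneg _).trans_lt (sq_re_lt_sqn z))) s := by
  have hz := z.im_pos
  have hs : Real.sqrt (1 + (z.re / z.im) ^ 2) = Real.sqrt (sqn z) / z.im := by
    rw [← Real.sqrt_sq hz.le, ← Real.sqrt_div' _ (sq_nonneg _), Real.sqrt_sq hz.le]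
    congr 1
    unfold sqn
    field_simp
    ring
  have hr := Real.sqrt_pos.2 ((sq_nonneg _).trans_lt (sq_re_lt_sqn z))
  refine ⟨Real.arsinh (z.re / z.im), UpperHalfPlane.ext (Complex.ext ?_ ?_)⟩
  · show z.re = _ * _
    rw [Real.tanh_eq_sinh_div_cosh, Real.cosh_arsinh, Real.sinh_arsinh, hs]
    field_simp
  · show z.im = _ / _
    rw [Real.cosh_arsinh, hs]
    field_simp

theorem axisPt_eq_circlePt (r : ℝ) (hr : 0 < r) : axisPt r hr = circlePt r hr 0 := by
  refine UpperHalfPlane.ext (Complex.ext ?_ ?_)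
  · show (0 : ℝ) = _ * _
    simp
  · show r = _ / _
    simp

/-- The Pythagorean formula gives `exp d ≥ cosh d ≥ (r / 2) * (exp |s| / 2)`; the two halves make up
the `log 4`. -/
theorem le_dist_circlePt (r : ℝ) (hr : 0 < r) (s : ℝ) :
    Real.log r - Real.log 4 + |s| ≤ dist (circlePt r hr s) (axisPt 1 one_pos) := by
  rw [dist_comm]
  have h := cosh_dist_axisPt_circlePt r 1 s hr one_pos
  set d := dist (axisPt 1 one_pos) (circlePt r hr s)
  have hd : 0 ≤ d := dist_nonneg
  have h1 : Real.cosh d ≤ Real.exp d := by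
    rw [Real.cosh_eq]
    have : Real.exp (-d) ≤ Real.exp d := Real.exp_le_exp.2 (by linarith)
    linarith
  have h2 : Real.exp |s| / 2 ≤ Real.cosh s := by
    rw [← Real.cosh_abs, Real.cosh_eq]
    have := Real.exp_pos (-|s|)
    linarith
  have h3 : r / 2 ≤ (r ^ 2 + 1 ^ 2) / (2 * r * 1) := by
    rw [div_le_div_iff₀ two_pos (by positivity)]; nlinarith
  have h4 : r / 4 * Real.exp |s| ≤ Real.exp d := by
    calc _ = r / 2 * (Real.exp |s| / 2) := by ring
      _ ≤ (r ^ 2 + 1 ^ 2) / (2 * r * 1) * Real.cosh s := by gcongr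
      _ ≤ _ := h ▸ h1
  rw [← Real.exp_le_exp, Real.exp_add, Real.exp_sub, Real.exp_log hr, Real.exp_log (by norm_num)]
  exact h4

theorem IsCoarse.rho_circlePt_le {f : ℍ → ℍ} {C L : ℝ} (h : IsCoarse f C L) {r : ℝ} (hr : 0 < r)
    (s : ℝ) : rho (f (axisPt 1 one_pos)) (f (axisPt r hr)) (f (circlePt r hr s)) ≤
      rayConst C L * Real.exp (-(Real.log r - Real.log 4) / L) := by
  rw [axisPt_eq_circlePt r hr]
  rcases le_total 0 s with h0 | h0
  · exact h.rho_ray_le (γ := fun t => circlePt r hr t) _ (fun s t => (dist_circlePt _ _ _ _).le)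
      (fun s h0 => by simpa [abs_of_nonneg h0] using le_dist_circlePt r hr s) h0
  · have := h.rho_ray_le (γ := fun t => circlePt r hr (-t)) (axisPt 1 one_pos)
      (fun s t => by rw [dist_circlePt, neg_sub_neg, abs_sub_comm])
      (fun s h0 => by simpa [abs_of_nonneg h0] using le_dist_circlePt r hr (-s)) (neg_nonneg.2 h0)
    simpa using this

theorem IsCoarse.rho_circle_le {f : ℍ → ℍ} {C L : ℝ} (h : IsCoarse f C L) (z : ℍ) :
    rho (f (axisPt 1 one_pos)) (f (axisPt (Real.sqrt (sqn z))
      (Real.sqrt_pos.2 ((sq_nonneg _).trans_lt (sq_re_lt_sqn z))))) (f z) ≤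
      rayConst C L * Real.exp (-(Real.log (Real.sqrt (sqn z)) - Real.log 4) / L) := by
  obtain ⟨s, hs⟩ := exists_circlePt z
  have := h.rho_circlePt_le (Real.sqrt_pos.2 ((sq_nonneg _).trans_lt (sq_re_lt_sqn z))) s
  rwa [← hs] at this

theorem IsCoarse.rho_axis_le {f : ℍ → ℍ} {C L : ℝ} (h : IsCoarse f C L) {r t : ℝ} (hr : 0 < r)
    (hrt : r ≤ t) :
    rho (f (axisPt 1 one_pos)) (f (axisPt r hr)) (f (axisPt t (hr.trans_le hrt))) ≤
      rayConst C L * Real.exp (-(Real.log r - Real.log 4) / L) := by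
  have e := h.rho_ray_le (γ := fun s => axisPt (r * Real.exp s) (by positivity)) (axisPt 1 one_pos)
    (A := Real.log r - Real.log 4) (S := Real.log t - Real.log r)
    (fun s t => by
      have := hr.ne'
      rw [dist_axisPt, Real.log_mul (by positivity) (by positivity),
        Real.log_mul (by positivity) (by positivity), Real.log_exp, Real.log_exp, add_sub_add_left_eq_sub])
    (fun s hs => by
      rw [dist_axisPt, Real.log_mul (by positivity) (by positivity), Real.log_exp, Real.log_one, sub_zero]
      have : 0 ≤ Real.log 4 := Real.log_nonneg (by norm_num)
      exact le_trans (by linarith) (le_abs_self _))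
    (sub_nonneg.2 (Real.log_le_log hr hrt))
  have e1 : r * Real.exp 0 = r := by simp
  have e2 : r * Real.exp (Real.log t - Real.log r) = t := by
    rw [Real.exp_sub, Real.exp_log hr, Real.exp_log (hr.trans_le hrt)]; field_simp
  simpa only [e1, e2] using e

/-- Go from `z` along its circle centred at `0` to the imaginary axis, along the axis, and along a
circle to `w`. All three pieces stay far from `i`, and each contributes at most `b (√R)`. -/
theorem IsCoarse.rho_small {f : ℍ → ℍ} {C L : ℝ} (h : IsCoarse f C L) {ε : ℝ} (hε : 0 < ε) :
    ∃ R : ℝ, 0 < R ∧ ∀ z w, R ≤ sqn z → R ≤ sqn w → rho (f (axisPt 1 one_pos)) (f z) (f w) < ε := by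
  have hL := h.pos
  set b : ℝ → ℝ := fun r => rayConst C L * Real.exp (-(Real.log r - Real.log 4) / L)
  have hM := rayConst_pos C hL
  have hb : Tendsto (fun R => 3 * b (Real.sqrt R)) atTop (𝓝 0) := by
    have h1 : Tendsto (fun R : ℝ => -(Real.log (Real.sqrt R) - Real.log 4) / L) atTop atBot := by
      refine Tendsto.atBot_div_const hL (tendsto_neg_atTop_atBot.comp ?_)
      exact tendsto_atTop_add_const_right _ _ (Real.tendsto_log_atTop.comp Real.tendsto_sqrt_atTop)
    have := ((Real.tendsto_exp_atBot.comp h1).const_mul (rayConst C L)).const_mul 3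
    rwa [mul_zero, mul_zero] at this
  obtain ⟨R, hR1, hR2⟩ := ((hb.eventually (gt_mem_nhds hε)).and (eventually_gt_atTop 0)).exists
  refine ⟨R, hR2, fun z w => ?_⟩
  have anti : ∀ s t, 0 < s → s ≤ t → b t ≤ b s := by
    intro s t hs hst
    refine mul_le_mul_of_nonneg_left (Real.exp_le_exp.2 ?_) hM.le
    have := Real.log_le_log hs hst
    exact div_le_div_of_nonneg_right (by linarith) hL.le
  have hsR := Real.sqrt_pos.2 hR2
  wlog hzw : Real.sqrt (sqn z) ≤ Real.sqrt (sqn w) generalizing z w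
  · intro hz hw
    rw [rho_comm]
    exact this w z (le_of_not_ge hzw) hw hz
  intro hz hw
  have a1 := h.rho_circle_le z
  have a2 := h.rho_circle_le w
  have a3 := h.rho_axis_le (Real.sqrt_pos.2 ((sq_nonneg _).trans_lt (sq_re_lt_sqn z))) hzw
  rw [rho_comm] at a1
  have b1 := anti _ _ hsR (Real.sqrt_le_sqrt hz)
  have b2 := anti _ _ hsR (Real.sqrt_le_sqrt hw)
  have t1 := rho_triangle (f (axisPt 1 one_pos)) (f z) (f (axisPt (Real.sqrt (sqn w))
    (Real.sqrt_pos.2 ((sq_nonneg _).trans_lt (sq_re_lt_sqn w))))) (f w)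
  have t2 := rho_triangle (f (axisPt 1 one_pos)) (f z) (f (axisPt (Real.sqrt (sqn z))
    (Real.sqrt_pos.2 ((sq_nonneg _).trans_lt (sq_re_lt_sqn z))))) (f (axisPt (Real.sqrt (sqn w))
    (Real.sqrt_pos.2 ((sq_nonneg _).trans_lt (sq_re_lt_sqn w)))))
  simp only [b] at hR1 b1 b2
  linarith

/-! ### Moving a real boundary point to infinity -/

/-- The isometry `u ↦ t - 1 / u` of `ℍ`. -/
noncomputable def invPt (t : ℝ) (u : ℍ) : ℍ :=
  ⟨⟨t - u.re / sqn u, u.im / sqn u⟩,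
    div_pos u.im_pos ((sq_nonneg _).trans_lt (sq_re_lt_sqn u))⟩

theorem dist_invPt (t : ℝ) (u v : ℍ) : dist (invPt t u) (invPt t v) = dist u v := by
  refine eq_of_cosh_eq dist_nonneg dist_nonneg ?_
  rw [cosh_dist_coords, cosh_dist_coords]
  show ((t - u.re / sqn u - (t - v.re / sqn v)) ^ 2 + (u.im / sqn u) ^ 2 + (v.im / sqn v) ^ 2) /
    (2 * (u.im / sqn u) * (v.im / sqn v)) = _
  have hu := (sq_nonneg _).trans_lt (sq_re_lt_sqn u)
  have hv := (sq_nonneg _).trans_lt (sq_re_lt_sqn v)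
  have := u.im_pos
  have := v.im_pos
  have e1 : u.im ^ 2 = sqn u - u.re ^ 2 := by unfold sqn; ring
  have e2 : v.im ^ 2 = sqn v - v.re ^ 2 := by unfold sqn; ring
  field_simp
  rw [e1, e2]
  ring

/-- Points near `t` are the images of points of large modulus, so behaviour at real boundary points
reduces to behaviour at `∞`. -/
theorem exists_invPt (t : ℝ) (z : ℍ) : ∃ u, invPt t u = z ∧ sqn u = ((z.re - t) ^ 2 + z.im ^ 2)⁻¹ := by
  have hz := z.im_pos
  have hn : 0 < (z.re - t) ^ 2 + z.im ^ 2 := by positivity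
  set n := (z.re - t) ^ 2 + z.im ^ 2
  let u : ℍ := ⟨⟨-(z.re - t) / n, z.im / n⟩, div_pos hz hn⟩
  have hu : sqn u = n⁻¹ := by
    show (-(z.re - t) / n) ^ 2 + (z.im / n) ^ 2 = n⁻¹
    field_simp
    simp [n]
  refine ⟨u, UpperHalfPlane.ext (Complex.ext ?_ ?_), hu⟩
  · show t - -(z.re - t) / n / sqn u = z.re
    rw [hu]; field_simp; ring
  · show z.im / n / sqn u = z.im
    rw [hu]; field_simp

theorem IsCoarse.comp_invPt {f : ℍ → ℍ} {C L : ℝ} (h : IsCoarse f C L) (t : ℝ) :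
    IsCoarse (fun u => f (invPt t u)) C L where
  pos := h.pos
  step z w hzw := h.step _ _ (by rwa [dist_invPt])
  lower z w := by
    have := h.lower (invPt t z) (invPt t w)
    rwa [dist_invPt] at this

/-! ### The filters `atBdry` -/

theorem tendsto_atBdry {α : Type*} {l : Filter α} {f : α → ℍ} {ξ : Bdry} :
    Tendsto f l (atBdry ξ) ↔ Tendsto (fun a => ((f a : ℂ) : OnePoint ℂ)) l
      (𝓝 (OnePoint.map (fun t : ℝ => (t : ℂ)) ξ)) := tendsto_comap_iff

theorem sq_norm_coe (z : ℍ) : ‖(z : ℂ)‖ ^ 2 = sqn z := by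
  rw [Complex.sq_norm, Complex.normSq_apply]; unfold sqn; simp; ring

theorem eventually_atBdry_infty (R : ℝ) : ∀ᶠ z in atBdry OnePoint.infty, R ≤ sqn z := by
  have h : Tendsto (fun z : ℍ => (z : ℂ)) (atBdry OnePoint.infty) (cocompact ℂ) := by
    have h0 := (tendsto_atBdry (f := id) (l := atBdry OnePoint.infty)).1 tendsto_id
    have h1 : comap ((↑) : ℂ → OnePoint ℂ) (𝓝 OnePoint.infty) = cocompact ℂ := by
      rw [OnePoint.comap_coe_nhds_infty, coclosedCompact_eq_cocompact]
    rw [← h1]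
    exact tendsto_comap_iff.2 h0
  have h1 := (tendsto_pow_atTop (α := ℝ) two_ne_zero).comp ((tendsto_norm_cocompact_atTop (E := ℂ)).comp h)
  filter_upwards [h1.eventually_ge_atTop R] with z hz
  rw [← sq_norm_coe]; exact hz

theorem tendsto_coe_atBdry_coe (t : ℝ) : Tendsto (fun z : ℍ => (z : ℂ)) (atBdry (t : Bdry)) (𝓝 (t : ℂ)) := by
  rw [← OnePoint.comap_coe_nhds]
  exact tendsto_comap_iff.2 ((tendsto_atBdry (f := id) (l := atBdry (t : Bdry))).1 tendsto_id)

theorem eventually_atBdry_coe (t : ℝ) {R : ℝ} (hR : 0 < R) :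
    ∀ᶠ z in atBdry (t : Bdry), R ≤ ((z.re - t) ^ 2 + z.im ^ 2)⁻¹ := by
  have h : Tendsto (fun z : ℍ => ‖(z : ℂ) - t‖ ^ 2) (atBdry (t : Bdry)) (𝓝 (‖(t : ℂ) - t‖ ^ 2)) :=
    ((tendsto_coe_atBdry_coe t).sub_const _).norm.pow 2
  rw [sub_self, norm_zero, zero_pow two_ne_zero] at h
  filter_upwards [h.eventually (gt_mem_nhds (inv_pos.2 hR))] with z hz
  have e : ‖(z : ℂ) - t‖ ^ 2 = (z.re - t) ^ 2 + z.im ^ 2 := by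
    rw [Complex.sq_norm, Complex.normSq_apply]; simp; ring
  rw [e] at hz
  have := z.im_pos
  exact (le_inv_comm₀ hR (by positivity)).2 hz.le

/-- On sets of bounded modulus a small `rho` at `i` means Euclidean closeness. The factors come from
`2 √(im z) exp (d(z, i) / 2) = |z - i| + |z + i| ≤ 2 (|z| + 1)`. -/
theorem rho_ge (z w : ℍ) : dist (z : ℂ) w ≤
    2 * (‖(z : ℂ)‖ + 1) * (‖(w : ℂ)‖ + 1) * rho (axisPt 1 one_pos) z w := by
  have h1 := two_mul_exp_half_dist z w
  have h2 := two_mul_exp_half_dist z (axisPt 1 one_pos)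
  have h3 := two_mul_exp_half_dist w (axisPt 1 one_pos)
  rw [axisPt_im, Real.sqrt_one, mul_one] at h2 h3
  have hI : ‖((axisPt 1 one_pos : ℍ) : ℂ)‖ = 1 := by
    have := sq_norm_coe (axisPt 1 one_pos)
    have e : sqn (axisPt 1 one_pos) = 1 := by simp [sqn, axisPt_re, axisPt_im]
    rw [e] at this
    nlinarith [norm_nonneg ((axisPt 1 one_pos : ℍ) : ℂ)]
  have bound : ∀ u : ℍ, dist (u : ℂ) (axisPt 1 one_pos : ℍ) +
      dist (u : ℂ) (starRingEnd ℂ (axisPt 1 one_pos : ℍ)) ≤ 2 * (‖(u : ℂ)‖ + 1) := by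
    intro u
    have a1 := dist_le_norm_add_norm (u : ℂ) (axisPt 1 one_pos : ℍ)
    have a2 := dist_le_norm_add_norm (u : ℂ) (starRingEnd ℂ (axisPt 1 one_pos : ℍ))
    rw [Complex.norm_conj] at a2
    rw [hI] at a1 a2
    linarith
  have hz := Real.sqrt_pos.2 z.im_pos
  have hw := Real.sqrt_pos.2 w.im_pos
  have e : Real.exp (dist z w / 2) = Real.exp (dist z (axisPt 1 one_pos) / 2) *
      Real.exp (dist w (axisPt 1 one_pos) / 2) * rho (axisPt 1 one_pos) z w := by
    unfold rho; rw [← Real.exp_add, ← Real.exp_add]; ring_nf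
  have hr : 0 < rho (axisPt 1 one_pos) z w := Real.exp_pos _
  have h4 : dist (z : ℂ) w ≤ 2 * √z.im * √w.im * Real.exp (dist z w / 2) := by
    rw [h1]; exact le_add_of_nonneg_right dist_nonneg
  calc _ ≤ _ := h4
    _ = (2 * √z.im * Real.exp (dist z (axisPt 1 one_pos) / 2)) *
        (2 * √w.im * Real.exp (dist w (axisPt 1 one_pos) / 2)) * rho (axisPt 1 one_pos) z w / 2 := by
      rw [e]; ring
    _ ≤ (2 * (‖(z : ℂ)‖ + 1)) * (2 * (‖(w : ℂ)‖ + 1)) * rho (axisPt 1 one_pos) z w / 2 := by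
      rw [h2, h3]
      gcongr
      · exact bound z
      · exact bound w
    _ = _ := by ring

/-- Here `rho z z = exp (-d(z, i))`, while `2 cosh d(z, i) = (|z|² + 1) / im z`. This forces finite
limit points to be real. -/
theorem im_le_rho (z : ℍ) : z.im ≤ (‖(z : ℂ)‖ ^ 2 + 1) * rho (axisPt 1 one_pos) z z := by
  have h := cosh_dist_coords z (axisPt 1 one_pos)
  rw [axisPt_re, axisPt_im, Real.cosh_eq] at h
  have hz := z.im_pos
  have e : rho (axisPt 1 one_pos) z z = Real.exp (-dist z (axisPt 1 one_pos)) := by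
    unfold rho; rw [dist_self]; ring_nf
  rw [e, sq_norm_coe, Real.exp_neg]
  have hp := Real.exp_pos (dist z (axisPt 1 one_pos))
  have hp' := Real.exp_pos (-dist z (axisPt 1 one_pos))
  rw [← div_eq_mul_inv, le_div_iff₀ hp]
  have : Real.exp (dist z (axisPt 1 one_pos)) + Real.exp (-dist z (axisPt 1 one_pos)) = (sqn z + 1) / z.im := by
    unfold sqn; field_simp at h ⊢; linarith
  have h2 : Real.exp (dist z (axisPt 1 one_pos)) ≤ (sqn z + 1) / z.im := by linarith
  rw [le_div_iff₀ hz] at h2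
  linarith

/-- A filter on `ℍ` along which the Gromov products tend to infinity converges to a boundary
point. -/
theorem exists_le_atBdry {F : Filter ℍ} [F.NeBot]
    (h : ∀ ε : ℝ, 0 < ε → ∃ s ∈ F, ∀ z ∈ s, ∀ w ∈ s, rho (axisPt 1 one_pos) z w < ε) :
    ∃ η : Bdry, F ≤ atBdry η := by
  set G := map (fun z : ℍ => ((z : ℂ) : OnePoint ℂ)) F
  -- The Riemann sphere is compact: either there is a finite cluster point, which the smallness of
  -- `rho` upgrades to a real limit, or `∞` is the only cluster point and hence the limit.
  by_cases hc : ∃ ζ : ℂ, ClusterPt (ζ : OnePoint ℂ) G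
  · obtain ⟨ζ, hζ⟩ := hc
    have hfreq : ∀ δ : ℝ, 0 < δ → ∀ s ∈ F, ∃ z ∈ s, dist (z : ℂ) ζ < δ := by
      intro δ hδ s hs
      have hU : ((↑) : ℂ → OnePoint ℂ) '' Metric.ball ζ δ ∈ 𝓝 (ζ : OnePoint ℂ) :=
        OnePoint.isOpenEmbedding_coe.image_mem_nhds.2 (Metric.ball_mem_nhds ζ hδ)
      obtain ⟨_, ⟨u, hu, rfl⟩, z, hz, he⟩ := (clusterPt_iff_nonempty.1 hζ) hU (image_mem_map hs)
      have he' : (z : ℂ) = u := OnePoint.coe_injective he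
      exact ⟨z, hz, by rw [he']; exact hu⟩
    have hlim : Tendsto (fun z : ℍ => (z : ℂ)) F (𝓝 ζ) := by
      rw [Metric.tendsto_nhds]
      intro ε hε
      set B := ‖ζ‖ + 2
      have hB : 0 < B := by positivity
      -- The first bound absorbs the unknown `dist z w` on the right of `h5` into half of the left
      -- side; the second makes the remaining term at most `ε / 4`.
      set κ := min (1 / (4 * B)) (ε / (8 * B ^ 2))
      have hκ : 0 < κ := by positivity
      obtain ⟨s, hs, hsκ⟩ := h κ hκ
      obtain ⟨z, hz, hzζ⟩ := hfreq (min 1 (ε / 2)) (by positivity) s hs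
      filter_upwards [hs] with w hw
      have h1 := rho_ge z w
      have h2 := hsκ z hz w hw
      have h3 : ‖(z : ℂ)‖ + 1 ≤ B := by
        have := norm_le_norm_add_norm_sub' (z : ℂ) ζ
        rw [← dist_eq_norm] at this
        have := hzζ.trans_le (min_le_left _ _)
        simp only [B]; linarith
      have h4 : ‖(w : ℂ)‖ + 1 ≤ B + dist (z : ℂ) w := by
        have := norm_le_norm_add_norm_sub (z : ℂ) w
        rw [← dist_eq_norm] at this
        linarith
      have hd := dist_nonneg (x := (z : ℂ)) (y := w)
      have h5 : dist (z : ℂ) w ≤ 2 * B * (B + dist (z : ℂ) w) * κ := by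
        refine h1.trans ?_
        have : 0 < rho (axisPt 1 one_pos) z w := Real.exp_pos _
        gcongr
      have k1 : 4 * B * κ ≤ 1 := by
        have : κ ≤ 1 / (4 * B) := min_le_left _ _
        rw [le_div_iff₀ (by positivity)] at this
        linarith
      have k2 : 8 * B ^ 2 * κ ≤ ε := by
        have : κ ≤ ε / (8 * B ^ 2) := min_le_right _ _
        rw [le_div_iff₀ (by positivity)] at this
        linarith
      have h6 : dist (z : ℂ) w ≤ ε / 2 := by nlinarith
      have h7 := hzζ.trans_le (min_le_right _ _)
      have h8 := dist_triangle_left (w : ℂ) ζ (z : ℂ)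
      linarith
    have him : ζ.im = 0 := by
      have h1 : Tendsto (fun z : ℍ => z.im) F (𝓝 ζ.im) := (Complex.continuous_im.tendsto ζ).comp hlim
      refine le_antisymm (le_of_forall_pos_le_add fun ε hε => ?_) (ge_of_tendsto' h1 fun z => z.im_pos.le)
      have h2 : Tendsto (fun z : ℍ => ‖(z : ℂ)‖ ^ 2 + 1) F (𝓝 (‖ζ‖ ^ 2 + 1)) := (hlim.norm.pow 2).add_const 1
      set B := ‖ζ‖ ^ 2 + 2
      have hB : 0 < B := by positivity
      obtain ⟨s, hs, hsκ⟩ := h (ε / B) (by positivity)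
      refine le_of_tendsto h1 ?_
      filter_upwards [hs, h2.eventually (gt_mem_nhds (show _ < B by simp only [B]; linarith))] with z hz hzB
      have e1 := im_le_rho z
      have e2 := (hsκ z hz z hz).le
      have e3 : 0 < rho (axisPt 1 one_pos) z z := Real.exp_pos _
      have : (‖(z : ℂ)‖ ^ 2 + 1) * rho (axisPt 1 one_pos) z z ≤ B * (ε / B) := by gcongr
      rw [mul_div_cancel₀ _ hB.ne'] at this
      linarith
    refine ⟨(ζ.re : Bdry), tendsto_id'.1 (tendsto_atBdry.2 ?_)⟩
    have e : ((ζ.re : ℝ) : ℂ) = ζ := Complex.ext rfl (by simp [him])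
    rw [OnePoint.map_some, e]
    exact (OnePoint.continuous_coe.tendsto ζ).comp hlim
  · refine ⟨OnePoint.infty, tendsto_id'.1 (tendsto_atBdry.2 ?_)⟩
    refine le_nhds_of_unique_clusterPt fun x hx => ?_
    induction x using OnePoint.rec with
    | infty => rfl
    | coe ζ => exact absurd ⟨ζ, hx⟩ hc

/-! ### Uniqueness of boundary limits. -/

instance atBdry_neBot (ξ : Bdry) : (atBdry ξ).NeBot := by
  have key : ∀ f : ℕ → ℍ, Tendsto f atTop (atBdry ξ) → (atBdry ξ).NeBot := fun f hf => hf.neBot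
  induction ξ using OnePoint.rec with
  | infty =>
    refine key (fun n => axisPt (n + 1) (by positivity)) (tendsto_atBdry.2 ?_)
    have h1 : Tendsto (fun n : ℕ => ((axisPt (n + 1) (by positivity) : ℍ) : ℂ)) atTop (cocompact ℂ) := by
      rw [← Metric.cobounded_eq_cocompact, ← tendsto_norm_atTop_iff_cobounded]
      refine tendsto_atTop_mono (fun n => ?_) tendsto_natCast_atTop_atTop
      have h2 := Complex.abs_im_le_norm ((axisPt (n + 1) (by positivity) : ℍ) : ℂ)
      have h3 : ((axisPt (n + 1) (by positivity) : ℍ) : ℂ).im = n + 1 := rfl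
      rw [h3] at h2
      exact le_trans (by linarith) ((le_abs_self _).trans h2)
    have h2 : Tendsto ((↑) : ℂ → OnePoint ℂ) (cocompact ℂ) (𝓝 OnePoint.infty) := by
      rw [← coclosedCompact_eq_cocompact]; exact OnePoint.tendsto_coe_infty
    exact h2.comp h1
  | coe t =>
    refine key (fun n => ⟨⟨t, 1 / ((n : ℝ) + 1)⟩, by positivity⟩) (tendsto_atBdry.2 ?_)
    refine (OnePoint.continuous_coe.tendsto _).comp ?_
    have h1 : Tendsto (fun n : ℕ => (t : ℂ) + ((1 / ((n : ℝ) + 1) : ℝ) : ℂ) * Complex.I) atTop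
        (𝓝 ((t : ℂ) + ((0 : ℝ) : ℂ) * Complex.I)) :=
      (((Complex.continuous_ofReal.tendsto 0).comp tendsto_one_div_add_atTop_nhds_zero_nat).mul_const _).const_add _
    simp only [Complex.ofReal_zero, zero_mul, add_zero] at h1
    refine h1.congr fun n => Complex.ext ?_ ?_
    · simp
    · rw [Complex.add_im, Complex.ofReal_im, Complex.im_ofReal_mul, Complex.I_im, zero_add, mul_one]

theorem continuous_map_ofReal : Continuous (OnePoint.map (fun t : ℝ => (t : ℂ))) :=
  OnePoint.continuous_map Complex.continuous_ofReal
    (by simpa only [coclosedCompact_eq_cocompact] using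
      Complex.isometry_ofReal.isClosedEmbedding.tendsto_cocompact)

theorem map_ofReal_injective : Function.Injective (OnePoint.map (fun t : ℝ => (t : ℂ))) := by
  intro a b h
  induction a using OnePoint.rec <;> induction b using OnePoint.rec <;> simp at h ⊢
  exact h

theorem atBdry_unique {α : Type*} {l : Filter α} [l.NeBot] {f : α → ℍ} {η η' : Bdry}
    (h : Tendsto f l (atBdry η)) (h' : Tendsto f l (atBdry η')) : η = η' :=
  map_ofReal_injective (tendsto_nhds_unique (tendsto_atBdry.1 h) (tendsto_atBdry.1 h'))

/-! ### The continuous boundary extension of a coarse map. -/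

theorem IsCoarse.exists_tendsto {f : ℍ → ℍ} {C L : ℝ} (h : IsCoarse f C L) (ξ : Bdry) :
    ∃ η, Tendsto f (atBdry ξ) (atBdry η) := by
  -- Changing the base point multiplies `rho` by at most `exp` of the distance moved, so any
  -- convenient base point will do.
  suffices H : ∃ p : ℍ, ∀ ε : ℝ, 0 < ε → ∃ s ∈ atBdry ξ, ∀ z ∈ s, ∀ w ∈ s, rho p (f z) (f w) < ε by
    obtain ⟨p, hp⟩ := H
    refine exists_le_atBdry (F := map f (atBdry ξ)) fun ε hε => ?_
    have he := Real.exp_pos (dist p (axisPt 1 one_pos))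
    obtain ⟨s, hs, hs'⟩ := hp (ε / Real.exp (dist p (axisPt 1 one_pos))) (by positivity)
    refine ⟨f '' s, image_mem_map hs, ?_⟩
    rintro _ ⟨z, hz, rfl⟩ _ ⟨w, hw, rfl⟩
    have h1 := rho_le_of_base p (axisPt 1 one_pos) (f z) (f w)
    have h2 := hs' z hz w hw
    rw [lt_div_iff₀ he] at h2
    linarith
  induction ξ using OnePoint.rec with
  | infty =>
    refine ⟨f (axisPt 1 one_pos), fun ε hε => ?_⟩
    obtain ⟨R, -, hR⟩ := h.rho_small hε
    exact ⟨_, eventually_atBdry_infty R, fun z hz w hw => hR z w hz hw⟩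
  | coe t =>
    refine ⟨f (invPt t (axisPt 1 one_pos)), fun ε hε => ?_⟩
    obtain ⟨R, hR0, hR⟩ := (h.comp_invPt t).rho_small hε
    refine ⟨_, eventually_atBdry_coe t hR0, fun z hz w hw => ?_⟩
    obtain ⟨u, rfl, hu⟩ := exists_invPt t z
    obtain ⟨v, rfl, hv⟩ := exists_invPt t w
    exact hR u v (by rw [hu]; exact hz) (by rw [hv]; exact hw)

theorem IsCoarse.tendsto_boundaryMap {f : ℍ → ℍ} {C L : ℝ} (h : IsCoarse f C L) (ξ : Bdry) :
    Tendsto f (atBdry ξ) (atBdry (boundaryMap f ξ)) :=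
  Classical.epsilon_spec (h.exists_tendsto ξ)

theorem boundaryMap_boundaryMap {f g : ℍ → ℍ} {C L C' L' : ℝ} (hf : IsCoarse f C L)
    (hg : IsCoarse g C' L') (hfg : ∀ z, g (f z) = z) (ξ : Bdry) :
    boundaryMap g (boundaryMap f ξ) = ξ := by
  have h1 := (hg.tendsto_boundaryMap _).comp (hf.tendsto_boundaryMap ξ)
  refine atBdry_unique h1 (l := atBdry ξ) ?_
  have : g ∘ f = id := funext hfg
  rw [this]; exact tendsto_id

/-- Extension by limits into a regular space: if `f` maps the trace of an open set into a closed
neighbourhood, then so do the limits at all boundary points of that open set. -/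
theorem IsCoarse.continuous_boundaryMap {f : ℍ → ℍ} {C L : ℝ} (h : IsCoarse f C L) :
    Continuous (boundaryMap f) := by
  set e := OnePoint.map (fun t : ℝ => (t : ℂ))
  have hemb : Topology.IsClosedEmbedding e :=
    continuous_map_ofReal.isClosedEmbedding map_ofReal_injective
  rw [hemb.isInducing.continuous_iff, continuous_iff_continuousAt]
  intro ξ
  refine (closed_nhds_basis (e (boundaryMap f ξ))).tendsto_right_iff.2 ?_
  rintro N ⟨hN, hNc⟩
  have h1 := tendsto_atBdry.1 (h.tendsto_boundaryMap ξ) hN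
  obtain ⟨U, hU, hUs⟩ := mem_comap.1 h1
  obtain ⟨V, hVU, hV, hξV⟩ := mem_nhds_iff.1 hU
  filter_upwards [(hV.preimage continuous_map_ofReal).mem_nhds hξV] with ξ' hξ'
  refine hNc.mem_of_tendsto (tendsto_atBdry.1 (h.tendsto_boundaryMap ξ')) ?_
  filter_upwards [preimage_mem_comap (hV.mem_nhds hξ')] with z hz
  exact hUs (hVU hz)

/-! ### Lifts of homeomorphisms of closed surfaces -/

/-- By equivariance `z` may be moved into a compact fundamental set, whose closed `1`-neighbourhood
is compact and has a bounded image. -/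
theorem exists_step {Γ : Subgroup SL(2, ℝ)} (hΓ : IsClosedSurfaceGroup Γ) {f : ℍ → ℍ}
    (hf : Continuous f) (he : ∀ A ∈ Γ, ∃ B : SL(2, ℝ), ∀ z : ℍ, f (A • z) = B • f z) :
    ∃ C, ∀ z w, dist z w ≤ 1 → dist (f z) (f w) ≤ C := by
  obtain ⟨K, hK, hK'⟩ := hΓ.cocompact
  have hK1 : IsCompact (Metric.cthickening 1 K) := hK.cthickening
  obtain ⟨C, hC⟩ := Metric.isBounded_iff.1 (hK1.image hf).isBounded
  refine ⟨C, fun z w hzw => ?_⟩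
  obtain ⟨A, hA, hAz⟩ := hK' z
  obtain ⟨B, hB⟩ := he A hA
  rw [← dist_smul B (f z), ← hB, ← hB]
  refine hC (Set.mem_image_of_mem f ?_) (Set.mem_image_of_mem f ?_)
  · exact Metric.self_subset_cthickening K hAz
  · exact Metric.mem_cthickening_of_dist_le _ (A • z) _ _ hAz (by rwa [dist_smul, dist_comm])

/-- The lower bound for `f` is the upper bound of `dist_le_of_step` for its left inverse `g`;
replacing `C'` by `|C'| + 1` keeps the constant positive. -/
theorem isCoarse_of_step {f g : ℍ → ℍ} {C C' : ℝ} (h : ∀ z w, dist z w ≤ 1 → dist (f z) (f w) ≤ C)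
    (h' : ∀ z w, dist z w ≤ 1 → dist (g z) (g w) ≤ C') (hgf : ∀ z, g (f z) = z) :
    IsCoarse f C (2 * (|C'| + 1)) where
  pos := by positivity
  step := h
  lower z w := by
    have h1 := dist_le_of_step (C := |C'| + 1) (fun z w hzw => (h' z w hzw).trans
      (by linarith [le_abs_self C'])) (f z) (f w)
    rw [hgf, hgf] at h1
    rw [sub_le_iff_le_add, div_le_iff₀ (by positivity)]
    nlinarith [abs_nonneg C']

theorem IsMarking.exists_isCoarse {Γ Γ' : Subgroup SL(2, ℝ)} (hΓ : IsClosedSurfaceGroup Γ)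
    (hΓ' : IsClosedSurfaceGroup Γ') {φ : ℍ ≃ₜ ℍ} (hφ : IsMarking Γ Γ' φ) :
    (∃ C L, IsCoarse φ C L) ∧ ∃ C L, IsCoarse φ.symm C L := by
  obtain ⟨C, hC⟩ := exists_step hΓ φ.continuous fun A hA => by
    obtain ⟨B, -, hB⟩ := hφ.map A hA; exact ⟨B, hB⟩
  obtain ⟨C', hC'⟩ := exists_step hΓ' φ.symm.continuous fun B hB => by
    obtain ⟨A, -, hA⟩ := hφ.inv B hB
    refine ⟨A, fun z => ?_⟩
    rw [Homeomorph.symm_apply_eq, hA, Homeomorph.apply_symm_apply]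
  exact ⟨⟨_, _, isCoarse_of_step hC hC' φ.symm_apply_apply⟩,
    ⟨_, _, isCoarse_of_step hC' hC φ.apply_symm_apply⟩⟩

/-- The boundary homeomorphism of the inverse of a lift of a homeomorphism of closed surfaces. -/
theorem IsMarking.exists_homeomorph {Γ Γ' : Subgroup SL(2, ℝ)} (hΓ : IsClosedSurfaceGroup Γ)
    (hΓ' : IsClosedSurfaceGroup Γ') {φ : ℍ ≃ₜ ℍ} (hφ : IsMarking Γ Γ' φ) :
    ∃ f : Bdry ≃ₜ Bdry, ∀ ξ, f ξ = boundaryMap φ.symm ξ := by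
  obtain ⟨⟨C, L, h⟩, ⟨C', L', h'⟩⟩ := hφ.exists_isCoarse hΓ hΓ'
  exact ⟨{ toFun := boundaryMap φ.symm
           invFun := boundaryMap φ
           left_inv := boundaryMap_boundaryMap h' h φ.apply_symm_apply
           right_inv := boundaryMap_boundaryMap h h' φ.symm_apply_apply
           continuous_toFun := h'.continuous_boundaryMap
           continuous_invFun := h.continuous_boundaryMap }, fun _ => rfl⟩

/-! ### The Liouville measure of boxes -/

theorem measurableSet_idealPencil (a : Bdry) : MeasurableSet (idealPencil a) := by
  have : (idealPencil a)ᶜ = {g | 0 < sbG g a * sbG g a} := by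
    ext g
    show ¬ (a ∈ g.1) ↔ 0 < sbG g a * sbG g a
    rw [← sbG_eq_zero, mul_self_pos]
  rw [← MeasurableSet.compl_iff, this]
  refine (isOpen_of_preimage (isOpen_lt (continuous_const (y := (0 : ℝ))) (continuous_sbProd a a)) ?_).measurableSet
  intro p
  show 0 < sb _ _ a * sb _ _ a ↔ 0 < sbProd a a p.1
  rw [sbProd, lt_div_iff₀ (mul_pos (nm_pos _) (nm_pos _)), zero_mul]

theorem liouville_eq_zero {S : Set Geod} (hS : MeasurableSet S) {N : Set (ℝ × ℝ)}
    (hN : volume N = 0) (h : ∀ p, Geod.ofReal p ∈ S → p.1 ∈ N) : liouville S = 0 := by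
  rw [liouville, Measure.map_apply measurable_ofReal hS]
  refine withDensity_absolutelyContinuous _ _ ?_
  have hm : MeasurableSet {p : ℝ × ℝ | p.1 < p.2} := measurableSet_lt measurable_fst measurable_snd
  refine ((MeasurableEmbedding.subtype_coe hm).comap_apply volume _).trans ?_
  refine measure_mono_null ?_ hN
  rintro _ ⟨p, hp, rfl⟩
  exact h p hp

theorem liouville_idealPencil (a : Bdry) : liouville (idealPencil a) = 0 := by
  induction a using OnePoint.rec with
  | infty =>
    refine liouville_eq_zero (measurableSet_idealPencil _) (N := ∅) (by simp) fun p hp => ?_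
    rcases Sym2.mem_iff.1 hp with h | h <;> simp at h
  | coe t =>
    refine liouville_eq_zero (measurableSet_idealPencil _) (N := {t} ×ˢ Set.univ ∪ Set.univ ×ˢ {t}) ?_
      fun p hp => ?_
    · rw [measure_union_null_iff, Measure.volume_eq_prod, Measure.prod_prod, Measure.prod_prod]
      simp
    · rcases Sym2.mem_iff.1 hp with h | h
      · exact .inl ⟨(OnePoint.coe_injective h).symm, trivial⟩
      · exact .inr ⟨trivial, (OnePoint.coe_injective h).symm⟩

theorem ccw_coe_coe {a b : ℝ} (hab : a < b) {ξ : Bdry} :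
    Ccw a ξ b ↔ ∃ t : ℝ, ξ = t ∧ a < t ∧ t < b := by
  induction ξ using OnePoint.rec with
  | infty => simp [Ccw, hab.le]
  | coe t =>
    simp only [Ccw, cut_coe, WithTop.coe_lt_coe, OnePoint.coe_eq_coe]
    constructor
    · rintro (h | h | h)
      · exact ⟨t, rfl, h⟩
      · linarith
      · linarith
    · rintro ⟨_, rfl, h⟩; exact .inl h

theorem ccw_coe_infty {a : ℝ} {ξ : Bdry} :
    Ccw a ξ OnePoint.infty ↔ ∃ t : ℝ, ξ = t ∧ a < t := by
  induction ξ using OnePoint.rec <;> simp [Ccw]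

theorem ccw_infty_coe {b : ℝ} {ξ : Bdry} :
    Ccw OnePoint.infty ξ b ↔ ∃ t : ℝ, ξ = t ∧ t < b := by
  induction ξ using OnePoint.rec <;> simp [Ccw]

/-- The cross ratio. -/
noncomputable def cr (a b c d : Bdry) : ℝ := br a c * br b d / (br a d * br b c)

theorem Ccw4.br_pos {a b c d : Bdry} (h : Ccw4 a b c d) :
    0 < (br a b * br c d) * (br a d * br b c) := by
  have h1 := h.link
  have e : sb a c b * sb a c d = - ((br a b * br c d) * (br a d * br b c)) := by
    unfold sb br; ring
  unfold Link at h1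
  linarith

theorem Ccw4.one_lt_cr {a b c d : Bdry} (h : Ccw4 a b c d) : 1 < cr a b c d := by
  have h1 := h.br_pos
  have hne : br a d * br b c ≠ 0 := by
    intro h0; rw [h0, mul_zero] at h1; exact lt_irrefl _ h1
  have e : cr a b c d = 1 + (br a b * br c d) * (br a d * br b c) / (br a d * br b c) ^ 2 := by
    unfold cr
    rw [← plucker, sq, mul_div_mul_right _ _ hne, add_div, div_self hne, add_comm]
  rw [e]
  have : 0 < (br a b * br c d) * (br a d * br b c) / (br a d * br b c) ^ 2 := by positivity
  linarith

/-- The Plücker relation divided by `br a c * br b d`. This identity between a box and its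
perpendicular is the origin of the constant `log 2`. -/
theorem Ccw4.inv_cr_add_inv_cr {a b c d : Bdry} (h : Ccw4 a b c d) :
    (cr a b c d)⁻¹ + (cr b c d a)⁻¹ = 1 := by
  have h1 := h.one_lt_cr
  have hac : br a c ≠ 0 := by rintro h0; simp [cr, h0] at h1; linarith
  have hbd : br b d ≠ 0 := by rintro h0; simp [cr, h0] at h1; linarith
  unfold cr
  rw [inv_div, inv_div, br_swap a b, br_swap a c, neg_mul, mul_neg, neg_div_neg_eq,
    mul_comm (br b d), ← add_div, div_eq_one_iff_eq (mul_ne_zero hac hbd)]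
  have := plucker a b c d
  linarith

theorem ccw4_of_lt {a b c d : ℝ} (hab : a < b) (hbc : b < c) (hcd : c < d) :
    Ccw4 (a : Bdry) b c d :=
  ⟨(ccw_coe_coe (hab.trans hbc)).2 ⟨b, rfl, hab, hbc⟩,
    (ccw_coe_coe (hab.trans (hbc.trans hcd))).2 ⟨c, rfl, hab.trans hbc, hcd⟩⟩

theorem ccw4_infty {a b c : ℝ} (hab : a < b) (hbc : b < c) : Ccw4 (a : Bdry) b c OnePoint.infty :=
  ⟨(ccw_coe_coe (hab.trans hbc)).2 ⟨b, rfl, hab, hbc⟩, ccw_coe_infty.2 ⟨c, rfl, hab.trans hbc⟩⟩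

theorem liouville_idealPencils (a b c d : Bdry) :
    liouville (idealPencil a ∪ idealPencil b ∪ idealPencil c ∪ idealPencil d) = 0 := by
  simp [liouville_idealPencil]

theorem liouville_obox_coe {a b c d : ℝ} (hab : a < b) (hbc : b < c) (hcd : c < d) :
    liouville (obox a b c d) = ENNReal.ofReal (Real.log (cr a b c d)) := by
  have h4 := ccw4_of_lt hab hbc hcd
  have e : liouville (obox a b c d) =
      liouville (box ((fun t : ℝ => (t : Bdry)) '' Set.Icc a b) ((fun t : ℝ => (t : Bdry)) '' Set.Icc c d)) := by
    refine le_antisymm (measure_mono (obox_subset_box h4 ?_ ?_)) ((measure_mono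
      (box_subset_obox h4 ?_ ?_)).trans ((measure_union_le _ _).trans_eq
        (by rw [liouville_idealPencils, add_zero])))
    · intro ξ hξ
      obtain ⟨t, rfl, h1, h2⟩ := (ccw_coe_coe hab).1 hξ
      exact ⟨t, ⟨h1.le, h2.le⟩, rfl⟩
    · intro ξ hξ
      obtain ⟨t, rfl, h1, h2⟩ := (ccw_coe_coe hcd).1 hξ
      exact ⟨t, ⟨h1.le, h2.le⟩, rfl⟩
    · rintro _ ⟨t, ⟨h1, h2⟩, rfl⟩
      rcases h1.eq_or_lt with rfl | h1
      · exact .inl rfl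
      rcases h2.eq_or_lt with rfl | h2
      · exact .inr (.inl rfl)
      exact .inr (.inr ((ccw_coe_coe hab).2 ⟨t, rfl, h1, h2⟩))
    · rintro _ ⟨t, ⟨h1, h2⟩, rfl⟩
      rcases h1.eq_or_lt with rfl | h1
      · exact .inl rfl
      rcases h2.eq_or_lt with rfl | h2
      · exact .inr (.inl rfl)
      exact .inr (.inr ((ccw_coe_coe hcd).2 ⟨t, rfl, h1, h2⟩))
  have e2 : |a - c| * |b - d| / (|a - d| * |b - c|) = cr a b c d := by
    rw [abs_of_neg (by linarith), abs_of_neg (by linarith), abs_of_neg (by linarith),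
      abs_of_neg (by linarith)]
    simp only [cr, br, hx_coe, hy_coe]
    ring
  rw [e, liouville_box hab hbc hcd, e2, abs_of_nonneg (Real.log_nonneg h4.one_lt_cr.le)]

theorem liouville_iUnion_eq {S : ℕ → Set Geod} (hS : Monotone S) {u : ℕ → ℝ} {v : ℝ}
    (h : ∀ n, liouville (S n) = ENNReal.ofReal (Real.log (u n))) (hv : v ≠ 0)
    (hu : Tendsto u atTop (𝓝 v)) : liouville (⋃ n, S n) = ENNReal.ofReal (Real.log v) := by
  refine tendsto_nhds_unique (tendsto_measure_iUnion_atTop hS) ?_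
  have := ENNReal.tendsto_ofReal (hu.log hv)
  exact this.congr fun n => (h n).symm

theorem tendsto_sub_div_sub (x y z : ℝ) :
    Tendsto (fun n : ℕ => (x - (z + n)) / (y - (z + n))) atTop (𝓝 1) := by
  have h1 : Tendsto (fun n : ℕ => z - y + (n : ℝ)) atTop atTop :=
    tendsto_atTop_add_const_left _ _ tendsto_natCast_atTop_atTop
  have h2 : Tendsto (fun n : ℕ => 1 + (y - x) / (z - y + (n : ℝ))) atTop (𝓝 (1 + 0)) :=
    (tendsto_const_nhds.div_atTop h1).const_add 1
  rw [add_zero] at h2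
  refine h2.congr' ?_
  filter_upwards [h1.eventually_gt_atTop 0] with n hn
  have : y - (z + n) ≠ 0 := by linarith
  have := hn.ne'
  field_simp
  ring

/-- Exhaust by boxes whose last vertex is a real number tending to `∞`; their cross ratios converge.
-/
theorem liouville_obox_infty_right {a b c : ℝ} (hab : a < b) (hbc : b < c) :
    liouville (obox a b c OnePoint.infty) = ENNReal.ofReal (Real.log (cr a b c OnePoint.infty)) := by
  have hlt : ∀ n : ℕ, c < c + 1 + n := fun n => by
    have : (0 : ℝ) ≤ n := by positivity
    linarith
  have h4 : ∀ n : ℕ, Ccw4 (a : Bdry) b c (c + 1 + n : ℝ) := fun n => ccw4_of_lt hab hbc (hlt n)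
  have e : obox a b c OnePoint.infty = ⋃ n : ℕ, obox a b c (c + 1 + n : ℝ) := by
    ext g
    rw [Set.mem_iUnion, mem_obox_iff (ccw4_infty hab hbc)]
    constructor
    · rintro ⟨x, y, hx, hy, he⟩
      obtain ⟨t, rfl, ht⟩ := ccw_coe_infty.1 hy
      obtain ⟨m, hm⟩ := exists_nat_gt (t - c - 1)
      exact ⟨m, (mem_obox_iff (h4 m)).2 ⟨x, t, hx, (ccw_coe_coe (hlt m)).2
        ⟨t, rfl, ht, by linarith⟩, he⟩⟩
    · rintro ⟨n, hn⟩
      obtain ⟨x, y, hx, hy, he⟩ := (mem_obox_iff (h4 n)).1 hn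
      obtain ⟨t, rfl, ht, -⟩ := (ccw_coe_coe (hlt n)).1 hy
      exact ⟨x, t, hx, ccw_coe_infty.2 ⟨t, rfl, ht⟩, he⟩
  rw [e]
  refine liouville_iUnion_eq ?_ (fun n => liouville_obox_coe hab hbc (hlt n))
    (zero_lt_one.trans (ccw4_infty hab hbc).one_lt_cr).ne' ?_
  · intro m n hmn g hg
    obtain ⟨x, y, hx, hy, he⟩ := (mem_obox_iff (h4 m)).1 hg
    obtain ⟨t, rfl, ht, ht'⟩ := (ccw_coe_coe (hlt m)).1 hy
    have : (m : ℝ) ≤ n := Nat.cast_le.2 hmn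
    exact (mem_obox_iff (h4 n)).2 ⟨x, t, hx, (ccw_coe_coe (hlt n)).2 ⟨t, rfl, ht, by linarith⟩, he⟩
  · have h1 := (tendsto_sub_div_sub b a (c + 1)).const_mul ((a - c) / (b - c))
    have e1 : cr a b c OnePoint.infty = (a - c) / (b - c) * 1 := by
      rw [mul_one, ← neg_div_neg_eq (a - c)]; simp [cr, br]
    rw [e1]
    refine h1.congr fun n => ?_
    simp only [cr, br, hx_coe, hy_coe, mul_one, one_mul]
    rw [div_mul_div_comm, mul_comm (b - c)]

theorem liouville_obox_infty_left {a b c : ℝ} (hab : a < b) (hbc : b < c) :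
    liouville (obox OnePoint.infty a b c) = ENNReal.ofReal (Real.log (cr OnePoint.infty a b c)) := by
  have hlt : ∀ n : ℕ, a - 1 - n < a := fun n => by
    have : (0 : ℝ) ≤ n := by positivity
    linarith
  have h4 : ∀ n : ℕ, Ccw4 ((a - 1 - n : ℝ) : Bdry) a b c := fun n => ccw4_of_lt (hlt n) hab hbc
  have h4' : Ccw4 OnePoint.infty (a : Bdry) b c := (ccw4_infty hab hbc).rotate.rotate.rotate
  have e : obox OnePoint.infty a b c = ⋃ n : ℕ, obox (a - 1 - n : ℝ) a b c := by
    ext g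
    rw [Set.mem_iUnion, mem_obox_iff h4']
    constructor
    · rintro ⟨x, y, hx, hy, he⟩
      obtain ⟨t, rfl, ht⟩ := ccw_infty_coe.1 hx
      obtain ⟨m, hm⟩ := exists_nat_gt (a - 1 - t)
      exact ⟨m, (mem_obox_iff (h4 m)).2 ⟨t, y, (ccw_coe_coe (hlt m)).2
          ⟨t, rfl, by linarith, ht⟩, hy, he⟩⟩
    · rintro ⟨n, hn⟩
      obtain ⟨x, y, hx, hy, he⟩ := (mem_obox_iff (h4 n)).1 hn
      obtain ⟨t, rfl, -, ht⟩ := (ccw_coe_coe (hlt n)).1 hx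
      exact ⟨t, y, ccw_infty_coe.2 ⟨t, rfl, ht⟩, hy, he⟩
  rw [e]
  refine liouville_iUnion_eq ?_ (fun n => liouville_obox_coe (hlt n) hab hbc)
    (zero_lt_one.trans h4'.one_lt_cr).ne' ?_
  · intro m n hmn g hg
    obtain ⟨x, y, hx, hy, he⟩ := (mem_obox_iff (h4 m)).1 hg
    obtain ⟨t, rfl, ht, ht'⟩ := (ccw_coe_coe (hlt m)).1 hx
    have : (m : ℝ) ≤ n := Nat.cast_le.2 hmn
    exact (mem_obox_iff (h4 n)).2 ⟨t, y, (ccw_coe_coe (hlt n)).2 ⟨t, rfl, by linarith, ht'⟩, hy, he⟩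
  · have h1 := (tendsto_sub_div_sub (-b) (-c) (-a + 1)).const_mul ((a - c) / (a - b))
    have e1 : cr OnePoint.infty a b c = (a - c) / (a - b) * 1 := by
      simp [cr, br]
    rw [e1]
    refine h1.congr fun n => ?_
    simp only [cr, br, hx_coe, hy_coe, mul_one, one_mul]
    rw [div_mul_div_comm, show -b - (-a + 1 + (n : ℝ)) = a - 1 - n - b by ring,
      show -c - (-a + 1 + (n : ℝ)) = a - 1 - n - c by ring, mul_comm (a - c), mul_comm (a - b)]

theorem cr_comm (a b c d : Bdry) : cr c d a b = cr a b c d := by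
  unfold cr
  rw [br_swap a c, br_swap b d, br_swap b c, br_swap a d]
  ring

/-- The Liouville measure of a box is the logarithm of the cross ratio of its vertices. -/
theorem liouville_obox {a b c d : Bdry} (h : Ccw4 a b c d) :
    liouville (obox a b c d) = ENNReal.ofReal (Real.log (cr a b c d)) := by
  -- Exchanging the two sides of the box changes neither `obox` nor `cr`, so it suffices that the
  -- smallest of the four vertices, for the order cut at `∞`, is `a` or `d`.
  have key : ∀ a b c d : Bdry, Ccw4 a b c d →
      ((cut a < cut b ∧ cut b < cut c ∧ cut c < cut d) ∨
        (cut d < cut a ∧ cut a < cut b ∧ cut b < cut c)) →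
      liouville (obox a b c d) = ENNReal.ofReal (Real.log (cr a b c d)) := by
    intro a b c d h hc
    have real : ∀ {x y : Bdry}, cut x < cut y → ∃ t : ℝ, x = t := by
      intro x y hxy
      induction x using OnePoint.rec with
      | infty => simp at hxy
      | coe t => exact ⟨t, rfl⟩
    rcases hc with ⟨h1, h2, h3⟩ | ⟨h1, h2, h3⟩
    · obtain ⟨a, rfl⟩ := real h1
      obtain ⟨b, rfl⟩ := real h2
      obtain ⟨c, rfl⟩ := real h3
      have h1 : a < b := WithTop.coe_lt_coe.1 h1
      have h2 : b < c := WithTop.coe_lt_coe.1 h2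
      induction d using OnePoint.rec with
      | infty => exact liouville_obox_infty_right h1 h2
      | coe d => exact liouville_obox_coe h1 h2 (WithTop.coe_lt_coe.1 h3)
    · obtain ⟨d, rfl⟩ := real h1
      obtain ⟨a, rfl⟩ := real h2
      obtain ⟨b, rfl⟩ := real h3
      have h1 : d < a := WithTop.coe_lt_coe.1 h1
      have h2 : a < b := WithTop.coe_lt_coe.1 h2
      induction c using OnePoint.rec with
      | infty =>
        rw [obox_comm, ← cr_comm]
        exact liouville_obox_infty_left h1 h2
      | coe c =>
        -- Here `∞` lies inside the arc from `c` to `d`. Cutting that arc at `∞` splits the box, up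
        -- to a null pencil, into two disjoint boxes with vertex `∞`, and the cross ratios multiply.
        have h3 : b < c := WithTop.coe_lt_coe.1 h3
        have c1 := ccw4_infty h2 h3
        have c2 : Ccw4 OnePoint.infty (d : Bdry) a b := (ccw4_infty h1 h2).rotate.rotate.rotate
        have m1 := liouville_obox_infty_right h2 h3
        have m2 := liouville_obox_infty_left h1 h2
        rw [obox_comm, cr_comm] at m2
        have hsub : obox (a : Bdry) b c OnePoint.infty ∪ obox a b OnePoint.infty d ⊆ obox a b c d := by
          rintro g (hg | hg)
          · obtain ⟨x, y, hx, hy, he⟩ := (mem_obox_iff c1).1 hg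
            refine (mem_obox_iff h).2 ⟨x, y, hx, ?_, he⟩
            obtain ⟨t, rfl, ht⟩ := ccw_coe_infty.1 hy
            exact .inr (.inr ⟨WithTop.coe_lt_coe.2 (by linarith), WithTop.coe_lt_coe.2 ht⟩)
          · obtain ⟨x, y, hx, hy, he⟩ := (mem_obox_iff c2.rotate.rotate).1 hg
            refine (mem_obox_iff h).2 ⟨x, y, hx, ?_, he⟩
            obtain ⟨t, rfl, ht⟩ := ccw_infty_coe.1 hy
            exact .inr (.inl ⟨WithTop.coe_lt_coe.2 ht, WithTop.coe_lt_coe.2 (by linarith)⟩)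
        have hsup : obox (a : Bdry) b c d ⊆
            (obox (a : Bdry) b c OnePoint.infty ∪ obox a b OnePoint.infty d) ∪ idealPencil OnePoint.infty := by
          intro g hg
          obtain ⟨x, y, hx, hy, he⟩ := (mem_obox_iff h).1 hg
          induction y using OnePoint.rec with
          | infty => exact .inr (show _ ∈ g.1 by rw [he]; exact Sym2.mem_mk_right _ _)
          | coe t =>
            refine .inl ?_
            rcases hy with hy | hy | hy
            · exact absurd (WithTop.coe_lt_coe.1 (hy.1.trans hy.2)) (by linarith)
            · exact .inr ((mem_obox_iff c2.rotate.rotate).2 ⟨x, t, hx, ccw_infty_coe.2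
                ⟨t, rfl, WithTop.coe_lt_coe.1 hy.1⟩, he⟩)
            · exact .inl ((mem_obox_iff c1).2 ⟨x, t, hx, ccw_coe_infty.2
                ⟨t, rfl, WithTop.coe_lt_coe.1 hy.2⟩, he⟩)
        have hdisj : Disjoint (obox (a : Bdry) b c OnePoint.infty) (obox a b OnePoint.infty d) := by
          rw [Set.disjoint_left]
          intro g hg hg'
          obtain ⟨x, y, hx, hy, he⟩ := (mem_obox_iff c1).1 hg
          obtain ⟨x', y', hx', hy', he'⟩ := (mem_obox_iff c2.rotate.rotate).1 hg'
          obtain ⟨t, rfl, ht⟩ := ccw_coe_infty.1 hy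
          obtain ⟨t', rfl, ht'⟩ := ccw_infty_coe.1 hy'
          obtain ⟨s, rfl, hs⟩ := (ccw_coe_coe h2).1 hx
          obtain ⟨s', rfl, hs'⟩ := (ccw_coe_coe h2).1 hx'
          rw [he] at he'
          rcases Sym2.eq_iff.1 he' with ⟨e1, e2⟩ | ⟨e1, e2⟩
          · have := OnePoint.coe_injective e2
            linarith
          · have := OnePoint.coe_injective e1
            linarith
        have e : liouville (obox (a : Bdry) b c d) =
            liouville (obox (a : Bdry) b c OnePoint.infty ∪ obox a b OnePoint.infty d) := by
          refine le_antisymm ((measure_mono hsup).trans ((measure_union_le _ _).trans_eq ?_))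
            (measure_mono hsub)
          rw [liouville_idealPencil, add_zero]
        have l1 := c1.one_lt_cr
        have l2 := c2.rotate.rotate.one_lt_cr
        rw [e, measure_union hdisj (isOpen_obox _ _ _ _).measurableSet, m1, m2,
          ← ENNReal.ofReal_add (Real.log_nonneg l1.le) (Real.log_nonneg l2.le),
          ← Real.log_mul (by linarith) (by linarith)]
        congr 2
        have : a - d ≠ 0 := by linarith
        have : b - c ≠ 0 := by linarith
        simp only [cr, br, hx_coe, hy_coe, hx_infty, hy_infty]
        field_simp
  obtain ⟨h1, h2, h3, h4⟩ := h.all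
  have : ((cut a < cut b ∧ cut b < cut c ∧ cut c < cut d) ∨
        (cut d < cut a ∧ cut a < cut b ∧ cut b < cut c)) ∨
      ((cut c < cut d ∧ cut d < cut a ∧ cut a < cut b) ∨
        (cut b < cut c ∧ cut c < cut d ∧ cut d < cut a)) := by
    clear h3 h4 key h
    unfold Ccw at h1 h2
    rcases h1 with h1 | h1 | h1 <;> rcases h2 with h2 | h2 | h2 <;> try tauto
    all_goals grind
  rcases this with h' | h'
  · exact key a b c d h h'
  · rw [obox_comm, ← cr_comm]
    exact key c d a b h.rotate.rotate h'

/-! ### Homeomorphisms of the boundary preserve linking -/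

theorem isPreconnected_ccw (a b : Bdry) : IsPreconnected {ξ | Ccw a ξ b} := by
  have img : ∀ s : Set ℝ, s.OrdConnected → IsPreconnected ((fun t : ℝ => (t : Bdry)) '' s) :=
    fun s hs => (hs.isPreconnected).image _ OnePoint.continuous_coe.continuousOn
  have cl : ∀ (s : Set ℝ) (l : Filter ℝ) [l.NeBot], l ≤ cocompact ℝ → s ∈ l → s.OrdConnected →
      IsPreconnected ((fun t : ℝ => (t : Bdry)) '' s ∪ {OnePoint.infty}) := by
    intro s l _ hl hs hc
    refine (img s hc).subset_closure Set.subset_union_left (Set.union_subset subset_closure ?_)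
    rintro _ rfl
    have h1 : Tendsto ((↑) : ℝ → Bdry) l (𝓝 OnePoint.infty) := by
      refine OnePoint.tendsto_coe_infty.mono_left ?_
      rwa [coclosedCompact_eq_cocompact]
    exact mem_closure_of_tendsto h1 (mem_of_superset hs fun t ht => ⟨t, ht, rfl⟩)
  induction a using OnePoint.rec with
  | infty =>
    induction b using OnePoint.rec with
    | infty =>
      have : {ξ | Ccw OnePoint.infty ξ OnePoint.infty} = ∅ := by
        ext ξ; simp [Ccw]
      rw [this]; exact isPreconnected_empty
    | coe b =>
      convert img (Set.Iio b) Set.ordConnected_Iio using 1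
      ext ξ
      rw [Set.mem_ofPred_eq, ccw_infty_coe]
      exact ⟨fun ⟨t, h, h'⟩ => ⟨t, h', h.symm⟩, fun ⟨t, h, h'⟩ => ⟨t, h'.symm, h⟩⟩
  | coe a =>
    induction b using OnePoint.rec with
    | infty =>
      convert img (Set.Ioi a) Set.ordConnected_Ioi using 1
      ext ξ
      rw [Set.mem_ofPred_eq, ccw_coe_infty]
      exact ⟨fun ⟨t, h, h'⟩ => ⟨t, h', h.symm⟩, fun ⟨t, h, h'⟩ => ⟨t, h'.symm, h⟩⟩
    | coe b =>
      rcases lt_trichotomy a b with hab | hab | hab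
      · convert img (Set.Ioo a b) Set.ordConnected_Ioo using 1
        ext ξ
        rw [Set.mem_ofPred_eq, ccw_coe_coe hab]
        exact ⟨fun ⟨t, h, h'⟩ => ⟨t, h', h.symm⟩, fun ⟨t, h, h'⟩ => ⟨t, h'.symm, h⟩⟩
      · subst hab
        have : {ξ : Bdry | Ccw a ξ a} = ∅ := by
          ext ξ
          rw [Set.mem_ofPred_eq]
          unfold Ccw
          simp only [lt_irrefl, false_and, and_false, or_false, Set.mem_empty_iff_false, iff_false]
          exact fun h => lt_asymm h.1 h.2
        rw [this]; exact isPreconnected_empty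
      · have h1 := cl (Set.Ioi a) atTop atTop_le_cocompact (Ioi_mem_atTop a) Set.ordConnected_Ioi
        have h2 := cl (Set.Iio b) atBot atBot_le_cocompact (Iio_mem_atBot b) Set.ordConnected_Iio
        convert IsPreconnected.union OnePoint.infty (Or.inr rfl) (Or.inr rfl) h1 h2 using 1
        ext ξ
        induction ξ using OnePoint.rec with
        | infty => simp [Ccw, hab]
        | coe t =>
          simp only [Set.mem_ofPred_eq, Ccw, cut_coe, WithTop.coe_lt_coe, Set.mem_union, Set.mem_image,
            OnePoint.coe_eq_coe, exists_eq_right, Set.mem_singleton_iff, OnePoint.coe_ne_infty,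
            or_false, Set.mem_Ioi, Set.mem_Iio]
          constructor
          · rintro (h | h | h)
            · linarith
            · exact .inr h.1
            · exact .inl h.2
          · rintro (h | h)
            · exact .inr (.inr ⟨hab, h⟩)
            · exact .inr (.inl ⟨h, hab⟩)

theorem ccw_total {a b ξ : Bdry} (hab : a ≠ b) (ha : ξ ≠ a) (hb : ξ ≠ b) : Ccw a ξ b ∨ Ccw b ξ a := by
  rw [ccw_iff, ccw_iff]
  have h1 : br a ξ ≠ 0 := fun h => ha (br_eq_zero.1 h).symm
  have h2 : br ξ b ≠ 0 := fun h => hb (br_eq_zero.1 h)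
  have h3 : br b a ≠ 0 := fun h => hab (br_eq_zero.1 h).symm
  have e : br b ξ * br ξ a * br a b = -(br a ξ * br ξ b * br b a) := by
    rw [br_swap ξ b, br_swap a ξ, br_swap b a]; ring
  rw [e]
  rcases lt_or_gt_of_ne (mul_ne_zero (mul_ne_zero h1 h2) h3) with h | h
  · exact .inr (by linarith)
  · exact .inl h

theorem Ccw.asymm {a b ξ : Bdry} (h : Ccw a ξ b) : ¬ Ccw b ξ a := by
  unfold Ccw at *; grind

theorem Ccw.ne {a b c : Bdry} (h : Ccw a b c) : a ≠ b ∧ b ≠ c ∧ a ≠ c := by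
  refine ⟨?_, ?_, ?_⟩ <;> rintro rfl <;> unfold Ccw at h <;> grind

/-- If `f b` and `f d` lay in one arc of the circle minus `{f a, f c}`, the preimage of that arc
would be connected, would avoid `a` and `c`, and would contain `b` and `d`, which lie in different
complementary arcs. The orientation behaviour of `f` is never needed. -/
theorem Link.map {a c b d : Bdry} (h : Link a c b d) (f : Bdry ≃ₜ Bdry) :
    Link (f a) (f c) (f b) (f d) := by
  have main : ∀ a c b d : Bdry, Ccw a b c → Ccw c d a → ∀ x y : Bdry, (x = f a ∧ y = f c ∨ x = f c ∧ y = f a) →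
      Ccw x (f b) y → ¬ Ccw x (f d) y := by
    intro a c b d h1 h2 x y hxy hb hd
    set U := f.symm '' {ξ | Ccw x ξ y}
    have hU : IsPreconnected U := (isPreconnected_ccw x y).image _ f.symm.continuous.continuousOn
    have hbU : b ∈ U := ⟨f b, hb, f.symm_apply_apply b⟩
    have hdU : d ∈ U := ⟨f d, hd, f.symm_apply_apply d⟩
    have hsub : U ⊆ {ξ | Ccw a ξ c} ∪ {ξ | Ccw c ξ a} := by
      rintro _ ⟨ξ, hξ, rfl⟩
      obtain ⟨n1, n2, -⟩ := Ccw.ne hξ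
      refine ccw_total h1.ne.2.2 ?_ ?_ <;> intro he <;> rw [Homeomorph.symm_apply_eq] at he <;> subst he
      · rcases hxy with ⟨rfl, rfl⟩ | ⟨rfl, rfl⟩
        · exact n1 rfl
        · exact n2 rfl
      · rcases hxy with ⟨rfl, rfl⟩ | ⟨rfl, rfl⟩
        · exact n2 rfl
        · exact n1 rfl
    have hdisj : Disjoint {ξ | Ccw a ξ c} {ξ | Ccw c ξ a} :=
      Set.disjoint_left.2 fun ξ hξ => hξ.asymm
    rcases hU.subset_or_subset (isOpen_ccw a c) (isOpen_ccw c a) hdisj hsub with h3 | h3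
    · exact (h3 hdU).asymm h2
    · exact (h3 hbU).asymm h1
  have main2 : ∀ a c b d : Bdry, Ccw a b c → Ccw c d a → Link (f a) (f c) (f b) (f d) := by
    intro a c b d h1 h2
    obtain ⟨n1, n2, n3⟩ := h1.ne
    obtain ⟨m1, m2, -⟩ := h2.ne
    have tb := ccw_total (f.injective.ne n3) (f.injective.ne n1.symm) (f.injective.ne n2)
    have td := ccw_total (f.injective.ne n3) (f.injective.ne m2) (f.injective.ne m1.symm)
    rw [link_comm, link_iff_ccw]
    rcases tb with tb | tb
    · rcases td with td | td
      · exact absurd td (main a c b d h1 h2 _ _ (.inl ⟨rfl, rfl⟩) tb)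
      · exact .inl ⟨tb, td⟩
    · rcases td with td | td
      · exact .inr ⟨td, tb⟩
      · exact absurd td (main a c b d h1 h2 _ _ (.inr ⟨rfl, rfl⟩) tb)
  rw [link_comm, link_iff_ccw] at h
  rcases h with h | h
  · exact main2 a c b d h.1 h.2
  · rw [link_swap_right]
    exact main2 a c d b h.1 h.2

theorem link_map_iff {a c b d : Bdry} (f : Bdry ≃ₜ Bdry) :
    Link (f a) (f c) (f b) (f d) ↔ Link a c b d :=
  ⟨fun h => by simpa using h.map f.symm, fun h => h.map f⟩

/-! ### Push-forwards of the Liouville measure -/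

theorem Geod.map_mk (f : Bdry ≃ₜ Bdry) (p : {p : Bdry × Bdry // p.1 ≠ p.2}) :
    Geod.map f (Geod.mk p) = Geod.mk ⟨(f p.1.1, f p.1.2), f.injective.ne p.2⟩ := by
  have h : ¬ ((Geod.mk p).1.map f).IsDiag := fun h => f.injective.ne p.2 (Sym2.mk_isDiag_iff.1 h)
  exact (dif_neg h).trans rfl

theorem measurable_geod_map (f : Bdry ≃ₜ Bdry) : Measurable (Geod.map f) := by
  refine Continuous.measurable (continuous_coinduced_dom.2 ?_)
  have : Geod.map f ∘ Geod.mk = fun p => Geod.mk ⟨(f p.1.1, f p.1.2), f.injective.ne p.2⟩ :=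
    funext (Geod.map_mk f)
  rw [this]
  have h1 : Continuous Geod.mk := continuous_coinduced_rng
  refine h1.comp (Continuous.subtype_mk ?_ _)
  exact (f.continuous.comp (continuous_fst.comp continuous_subtype_val)).prodMk
    (f.continuous.comp (continuous_snd.comp continuous_subtype_val))

theorem preimage_linkSet (f : Bdry ≃ₜ Bdry) (a b : Bdry) :
    Geod.map f ⁻¹' linkSet (f a) (f b) = linkSet a b := by
  ext g
  obtain ⟨p, rfl⟩ := g.exists_mk
  rw [Set.mem_preimage, Geod.map_mk, mk_mem_linkSet, mk_mem_linkSet]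
  exact link_map_iff f

theorem map_liouville_obox (f : Bdry ≃ₜ Bdry) (a b c d : Bdry) :
    liouville.map (Geod.map f) (obox (f a) (f b) (f c) (f d)) = liouville (obox a b c d) := by
  rw [Measure.map_apply (measurable_geod_map f) (isOpen_obox _ _ _ _).measurableSet, obox,
    Set.preimage_inter, preimage_linkSet, preimage_linkSet]
  rfl

theorem map_liouville_idealPencil (f : Bdry ≃ₜ Bdry) (a : Bdry) :
    liouville.map (Geod.map f) (idealPencil a) = 0 := by
  rw [Measure.map_apply (measurable_geod_map f) (measurableSet_idealPencil a)]
  refine measure_mono_null ?_ (liouville_idealPencil (f.symm a))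
  intro g hg
  obtain ⟨p, rfl⟩ := g.exists_mk
  rw [Set.mem_preimage, Geod.map_mk] at hg
  rcases Sym2.mem_iff.1 hg with rfl | rfl
  · exact Sym2.mem_iff.2 (.inl (f.symm_apply_apply _))
  · exact Sym2.mem_iff.2 (.inr (f.symm_apply_apply _))

/-- `sd p q x` is linear in the homogeneous coordinates of `q`, with coefficient vector `(A, B) ≠
0`: a point and one end determine the geodesic. -/
theorem eq_of_sd_eq_zero {p q q' : Bdry} {x : ℍ} (h : sd p q x = 0) (h' : sd p q' x = 0) : q = q' := by
  rw [← br_eq_zero]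
  set A := hy p * sqn x - hx p * x.re
  set B := hx p - hy p * x.re
  have e : hy q * A + hx q * B = 0 := by rw [← h]; simp only [A, B]; unfold sd; ring
  have e' : hy q' * A + hx q' * B = 0 := by rw [← h']; simp only [A, B]; unfold sd; ring
  have hA : A * br q q' = 0 := by unfold br; linear_combination hx q * e' - hx q' * e
  have hB : B * br q q' = 0 := by unfold br; linear_combination hy q' * e - hy q * e'
  by_contra hne
  have hA0 := (mul_eq_zero.1 hA).resolve_right hne
  have hB0 := (mul_eq_zero.1 hB).resolve_right hne
  have h1 : hy p * (sqn x - x.re ^ 2) = 0 := by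
    simp only [A, B] at hA0 hB0
    linear_combination hA0 + x.re * hB0
  have h2 : hy p = 0 := (mul_eq_zero.1 h1).resolve_right (by linarith [sq_re_lt_sqn x])
  have h3 : hx p = 0 := by simp only [B, h2] at hB0; linarith
  have := nm_pos p
  simp [nm, h2, h3] at this

theorem measurableSet_pencil (x : ℍ) : MeasurableSet (pencil x) := by
  have : (pencil x)ᶜ = {g | 0 < sdG g x * sdG g x} := by
    ext g; exact mul_self_pos.symm
  rw [← MeasurableSet.compl_iff, this]
  exact (isOpen_sdG_pos x x).measurableSet

/-- For every first end there is at most one second end, and `f` is injective, so Fubini applies to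
the preimage; `f` may well be singular with respect to Lebesgue measure. -/
theorem map_liouville_pencil (f : Bdry ≃ₜ Bdry) (x : ℍ) :
    liouville.map (Geod.map f) (pencil x) = 0 := by
  rw [Measure.map_apply (measurable_geod_map f) (measurableSet_pencil x)]
  set F : ℝ × ℝ → Bdry × Bdry := fun p => (f p.1, f p.2)
  have hF : Continuous F := (f.continuous.comp (OnePoint.continuous_coe.comp continuous_fst)).prodMk
    (f.continuous.comp (OnePoint.continuous_coe.comp continuous_snd))
  have hz : ∀ p, sdProd x x p = 0 ↔ sd p.1 p.2 x = 0 := by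
    intro p
    have h1 := (nm_pos p.1).ne'
    have h2 := (nm_pos p.2).ne'
    unfold sdProd
    simp [h1, h2]
  refine liouville_eq_zero (measurable_geod_map f (measurableSet_pencil x))
    (N := F ⁻¹' {p | sdProd x x p = 0}) ?_ ?_
  · have hN : MeasurableSet (F ⁻¹' {p | sdProd x x p = 0}) :=
      ((isClosed_eq (continuous_sdProd x x) continuous_const).preimage hF).measurableSet
    rw [Measure.volume_eq_prod, Measure.measure_prod_null hN]
    refine Eventually.of_forall fun s => Set.Subsingleton.measure_zero ?_ _
    intro t ht t' ht'
    have h1 := (hz _).1 (show sdProd x x (F (s, t)) = 0 from ht)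
    have h2 := (hz _).1 (show sdProd x x (F (s, t')) = 0 from ht')
    exact OnePoint.coe_injective (f.injective (eq_of_sd_eq_zero h1 h2))
  · intro p hp
    rw [Set.mem_preimage, Geod.ofReal, Geod.map_mk] at hp
    exact (hz _).2 hp

/-! ### Transport of Liouville box measures by a boundary homeomorphism. -/

theorem obox_reverse (a b c d : Bdry) : obox b a d c = obox a b c d := by
  unfold obox; rw [linkSet_comm b a, linkSet_comm d c]

theorem obox_reverse' (a b c d : Bdry) : obox a d c b = obox b c d a := by
  unfold obox; rw [linkSet_comm a d, linkSet_comm c b, Set.inter_comm]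

/-- The properties of the Liouville current of a marked surface on which its dual space depends:
null pencils, and the value on boxes. -/
structure IsLiouvilleLike (μ : Measure Geod) : Prop where
  idealPencil_eq_zero : ∀ a, μ (idealPencil a) = 0
  pencil_eq_zero : ∀ x, μ (pencil x) = 0
  obox_eq : ∀ a b c d, Ccw4 a b c d → ∃ u v : ℝ, 1 < u ∧ 1 < v ∧ u⁻¹ + v⁻¹ = 1 ∧
    μ (obox a b c d) = ENNReal.ofReal (Real.log u) ∧ μ (obox b c d a) = ENNReal.ofReal (Real.log v)
  exists_obox_eq : ∃ a b c d, Ccw4 a b c d ∧ μ (obox a b c d) = ENNReal.ofReal (Real.log 2) ∧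
    μ (obox b c d a) = ENNReal.ofReal (Real.log 2)

theorem isLiouvilleLike_map (f : Bdry ≃ₜ Bdry) : IsLiouvilleLike (liouville.map (Geod.map f)) where
  idealPencil_eq_zero := map_liouville_idealPencil f
  pencil_eq_zero := map_liouville_pencil f
  obox_eq a b c d h := by
    obtain ⟨a, rfl⟩ := f.surjective a
    obtain ⟨b, rfl⟩ := f.surjective b
    obtain ⟨c, rfl⟩ := f.surjective c
    obtain ⟨d, rfl⟩ := f.surjective d
    rw [map_liouville_obox, map_liouville_obox]
    rcases link_iff_ccw4.1 ((link_map_iff f).1 h.link) with h' | h'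
    · exact ⟨_, _, h'.one_lt_cr, h'.rotate.one_lt_cr, h'.inv_cr_add_inv_cr, liouville_obox h',
        liouville_obox h'.rotate⟩
    -- Orientation is reversed: the same two boxes are read off with their vertices in the opposite
    -- cyclic order.
    · have h2 := h'.rotate.rotate.rotate
      refine ⟨_, _, h2.one_lt_cr, h'.one_lt_cr, ?_, ?_, ?_⟩
      · rw [cr_comm _ _ b a, add_comm]; exact h'.inv_cr_add_inv_cr
      · rw [← obox_reverse]; exact liouville_obox h2
      · rw [← obox_reverse']; exact liouville_obox h'
  exists_obox_eq := by
    -- A harmonic quadruple: the box and its perpendicular both have cross ratio `2`.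
    have h : Ccw4 ((-1 : ℝ) : Bdry) (0 : ℝ) (1 : ℝ) OnePoint.infty :=
      ccw4_infty (by norm_num) (by norm_num)
    have e1 : liouville (obox ((-1 : ℝ) : Bdry) (0 : ℝ) (1 : ℝ) OnePoint.infty) =
        ENNReal.ofReal (Real.log 2) := by
      rw [liouville_obox h]; congr 2; simp [cr, br]; norm_num
    have e2 : liouville (obox ((0 : ℝ) : Bdry) (1 : ℝ) OnePoint.infty (-1 : ℝ)) =
        ENNReal.ofReal (Real.log 2) := by
      rw [liouville_obox h.rotate]; congr 2; simp [cr, br]; norm_num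
    rcases link_iff_ccw4.1 (h.link.map f) with h' | h'
    · exact ⟨_, _, _, _, h', by rw [map_liouville_obox, e1], by rw [map_liouville_obox, e2]⟩
    · refine ⟨_, _, _, _, h', ?_, ?_⟩
      · rw [obox_reverse', map_liouville_obox, e2]
      · rw [← obox_reverse, obox_comm, map_liouville_obox, e1]

theorem IsLiouvilleLike.obox_lt_top {μ : Measure Geod} (hμ : IsLiouvilleLike μ) {a b c d : Bdry}
    (h : Ccw4 a b c d) : μ (obox a b c d) < ∞ := by
  obtain ⟨u, v, -, -, -, h1, -⟩ := hμ.obox_eq a b c d h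
  rw [h1]; exact ENNReal.ofReal_lt_top

/-! ### Finiteness of the dual pseudo-distance. -/

theorem sd_self_pos (p : Bdry) (x : ℍ) : 0 < sd p p x := by
  have e : sd p p x = (hx p - hy p * x.re) ^ 2 + hy p ^ 2 * x.im ^ 2 := by
    unfold sd sqn; ring
  rw [e]
  have hx' := x.im_pos
  by_cases h : hy p = 0
  · have h1 := nm_pos p
    simp only [nm, h] at h1
    simp only [h]
    nlinarith
  · positivity

/-- The geodesics which separate two given points have finite measure. -/
theorem IsLiouvilleLike.sepSet_lt_top {μ : Measure Geod} (hμ : IsLiouvilleLike μ) (x y : ℍ) :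
    μ (sepSet x y) < ∞ := by
  -- `K` is compact in the torus and misses the diagonal, where `sd` is positive, so finitely many
  -- boxes of finite measure cover it.
  set K : Set (Bdry × Bdry) := {p | sdProd x y p ≤ 0}
  have hK : IsCompact K := (isClosed_le (continuous_sdProd x y) continuous_const).isCompact
  have hne : ∀ p ∈ K, p.1 ≠ p.2 := by
    rintro ⟨p, q⟩ hp (rfl : p = q)
    have hp' : sdProd x y (p, p) ≤ 0 := hp
    have : 0 < sdProd x y (p, p) :=
      div_pos (mul_pos (sd_self_pos p x) (sd_self_pos p y)) (mul_pos (nm_pos p) (nm_pos p))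
    linarith
  have main : μ {g | ∃ p ∈ K, g.1 = s(p.1, p.2)} < ∞ := by
    refine hK.induction_on (p := fun s => μ {g | ∃ p ∈ s, g.1 = s(p.1, p.2)} < ∞) ?_ ?_ ?_ ?_
    · simp
    · intro s t hst ht
      refine (measure_mono ?_).trans_lt ht
      rintro g ⟨p, hp, h⟩
      exact ⟨p, hst hp, h⟩
    · intro s t hs ht
      refine (measure_mono ?_).trans_lt (measure_union_lt_top hs ht)
      rintro g ⟨p, hp | hp, h⟩
      · exact .inl ⟨p, hp, h⟩
      · exact .inr ⟨p, hp, h⟩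
    · intro p hp
      obtain ⟨a, b, c, d, h, h1, h2⟩ := exists_ccw4_around (hne p hp)
      refine ⟨{ξ | Ccw a ξ b} ×ˢ {ξ | Ccw c ξ d}, mem_nhdsWithin_of_mem_nhds
        (((isOpen_ccw a b).prod (isOpen_ccw c d)).mem_nhds ⟨h1, h2⟩),
        (measure_mono ?_).trans_lt (hμ.obox_lt_top h)⟩
      rintro g ⟨q, hq, he⟩
      exact (mem_obox_iff h).2 ⟨q.1, q.2, hq.1, hq.2, he⟩
  refine (measure_mono ?_).trans_lt main
  intro g hg
  obtain ⟨p, rfl⟩ := g.exists_mk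
  exact ⟨p.1, div_nonpos_of_nonpos_of_nonneg (le_of_lt hg) (mul_pos (nm_pos _) (nm_pos _)).le, rfl⟩

theorem IsLiouvilleLike.transversal_eq {μ : Measure Geod} (hμ : IsLiouvilleLike μ) (x y : ℍ) :
    μ (transversal (segCO x y)) = μ (sepSet x y) ∧ μ (transversal (segOC x y)) = μ (sepSet x y) := by
  have key : ∀ τ ⊆ seg x y, sepSet x y ⊆ transversal τ → μ (transversal τ) = μ (sepSet x y) := by
    intro τ hτ h
    refine le_antisymm ((measure_mono (transversal_subset x y hτ)).trans
      ((measure_union_le _ _).trans ?_)) (measure_mono h)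
    rw [hμ.pencil_eq_zero, add_zero]
    refine (measure_union_le _ _).trans ?_
    rw [hμ.pencil_eq_zero, add_zero]
  exact ⟨key _ Set.sdiff_subset fun g hg => (sepSet_subset_transversal x y hg).1,
    key _ Set.sdiff_subset fun g hg => (sepSet_subset_transversal x y hg).2⟩

theorem IsLiouvilleLike.dualPseudoDist_eq {μ : Measure Geod} (hμ : IsLiouvilleLike μ) (x y : ℍ) :
    dualPseudoDist μ x y = (μ (sepSet x y)).toReal := by
  unfold dualPseudoDist
  rw [(hμ.transversal_eq x y).1, (hμ.transversal_eq x y).2, ← two_mul,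
    mul_comm, ENNReal.mul_div_cancel_right two_ne_zero ENNReal.ofNat_ne_top]

/-! ### The quantity `δ_μ` -/

theorem IsLiouvilleLike.box_eq {μ : Measure Geod} (hμ : IsLiouvilleLike μ) {a b c d : Bdry}
    (h : Ccw4 a b c d) {I J : Set Bdry} (hI : ∀ ξ, Ccw a ξ b → ξ ∈ I)
    (hI' : ∀ ξ ∈ I, ξ = a ∨ ξ = b ∨ Ccw a ξ b) (hJ : ∀ ξ, Ccw c ξ d → ξ ∈ J)
    (hJ' : ∀ ξ ∈ J, ξ = c ∨ ξ = d ∨ Ccw c ξ d) : μ (box I J) = μ (obox a b c d) := by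
  have h0 : μ (idealPencil a ∪ idealPencil b ∪ idealPencil c ∪ idealPencil d) = 0 := by
    simp only [measure_union_null_iff, hμ.idealPencil_eq_zero, and_self]
  exact le_antisymm ((measure_mono (box_subset_obox h hI' hJ')).trans
    ((measure_union_le _ _).trans_eq (by rw [h0, add_zero]))) (measure_mono (obox_subset_box h hI hJ))

theorem IsLiouvilleLike.box_OC_CO {μ : Measure Geod} (hμ : IsLiouvilleLike μ) {a b c d : Bdry}
    (h : Ccw4 a b c d) : μ (box (arcOC a b) (arcCO c d)) = μ (obox a b c d) :=
  hμ.box_eq h (fun _ => .inr) (fun _ hξ => .inr hξ) (fun _ => .inr) fun _ hξ => hξ.imp_right .inr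

theorem IsLiouvilleLike.box_CO_OC {μ : Measure Geod} (hμ : IsLiouvilleLike μ) {a b c d : Bdry}
    (h : Ccw4 a b c d) : μ (box (arcCO a b) (arcOC c d)) = μ (obox a b c d) :=
  hμ.box_eq h (fun _ => .inr) (fun _ hξ => hξ.imp_right .inr) (fun _ => .inr) fun _ hξ => .inr hξ

/-- As `1/u + 1/v = 1`, the numbers `u` and `v` cannot both exceed `2`. -/
theorem IsLiouvilleLike.min_le {μ : Measure Geod} (hμ : IsLiouvilleLike μ) {a b c d : Bdry}
    (h : Ccw4 a b c d) : μ (obox a b c d) ≤ ENNReal.ofReal (Real.log 2) ∨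
      μ (obox b c d a) ≤ ENNReal.ofReal (Real.log 2) := by
  obtain ⟨u, v, hu, hv, huv, h1, h2⟩ := hμ.obox_eq a b c d h
  rw [h1, h2]
  rcases le_or_gt u 2 with h3 | h3
  · exact .inl (ENNReal.ofReal_le_ofReal (Real.log_le_log (by linarith) h3))
  · refine .inr (ENNReal.ofReal_le_ofReal (Real.log_le_log (by linarith) ?_))
    have h4 : u⁻¹ < 2⁻¹ := inv_strictAnti₀ two_pos h3
    have h5 : 2⁻¹ ≤ v⁻¹ := by linarith
    exact (inv_le_inv₀ two_pos (by linarith)).1 h5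

theorem IsLiouvilleLike.deltaBox_eq {μ : Measure Geod} (hμ : IsLiouvilleLike μ) :
    deltaBox μ = ENNReal.ofReal (Real.log 2) := by
  set l := ENNReal.ofReal (Real.log 2)
  have hl : (l + l) / 2 = l := by
    rw [← two_mul, mul_comm, ENNReal.mul_div_cancel_right two_ne_zero ENNReal.ofNat_ne_top]
  unfold deltaBox
  refine (congrArg (· / 2) (le_antisymm (b := l + l) ?_ ?_)).trans hl
  · refine iSup_le fun a => iSup_le fun b => iSup_le fun c => iSup_le fun d => iSup_le fun h => ?_
    rw [hμ.box_OC_CO h, hμ.box_CO_OC h, hμ.box_OC_CO h.rotate, hμ.box_CO_OC h.rotate]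
    rcases hμ.min_le h with h' | h'
    · exact (min_le_left _ _).trans (add_le_add h' h')
    · exact (min_le_right _ _).trans (add_le_add h' h')
  · obtain ⟨a, b, c, d, h, h1, h2⟩ := hμ.exists_obox_eq
    refine le_trans ?_ (le_iSup_of_le a (le_iSup_of_le b (le_iSup_of_le c (le_iSup_of_le d
      (le_iSup_of_le h le_rfl)))))
    rw [hμ.box_OC_CO h, hμ.box_CO_OC h, hμ.box_OC_CO h.rotate, hμ.box_CO_OC h.rotate, h1, h2, min_self]

/-! ### The four point condition for the dual pseudo-distance -/

/-- The geodesics which separate `x`, `y` from `z`, `w`. -/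
def sep4 (x y z w : ℍ) : Set Geod :=
  {g | 0 < sdG g x * sdG g y} ∩ {g | 0 < sdG g z * sdG g w} ∩ sepSet x z

theorem measurableSet_sepSet (x y : ℍ) : MeasurableSet (sepSet x y) := (isOpen_sepSet x y).measurableSet

theorem measurableSet_sep4 (x y z w : ℍ) : MeasurableSet (sep4 x y z w) :=
  (((isOpen_sdG_pos x y).inter (isOpen_sdG_pos z w)).inter (isOpen_sepSet x z)).measurableSet

/-- Sixteen sign patterns. A geodesic cutting off one point, or splitting `xw|yz`, contributes
equally to the two sums of distances; the splittings `xy|zw` and `xz|yw` each create a discrepancy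
of two, which the doubled indicators correct. -/
theorem indicator_four_point {g : Geod} {x y z w : ℍ} (h1 : sdG g x ≠ 0) (h2 : sdG g y ≠ 0)
    (h3 : sdG g z ≠ 0) (h4 : sdG g w ≠ 0) :
    (sepSet x z).indicator (1 : Geod → ℝ≥0∞) g + (sepSet y w).indicator 1 g +
        ((sep4 x z y w).indicator 1 g + (sep4 x z y w).indicator 1 g) =
      (sepSet x y).indicator 1 g + (sepSet z w).indicator 1 g +
        ((sep4 x y z w).indicator 1 g + (sep4 x y z w).indicator 1 g) := by
  classical
  simp only [Set.indicator_apply, sep4, sepSet, Set.mem_inter_iff, Set.mem_ofPred_eq, mul_neg_iff, mul_pos_iff]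
  rcases lt_or_gt_of_ne h1 with a1 | a1 <;> rcases lt_or_gt_of_ne h2 with a2 | a2 <;>
  rcases lt_or_gt_of_ne h3 with a3 | a3 <;> rcases lt_or_gt_of_ne h4 with a4 | a4 <;>
  simp [a1, a2, a3, a4, a1.not_gt, a2.not_gt, a3.not_gt, a4.not_gt]

theorem IsLiouvilleLike.four_point {μ : Measure Geod} (hμ : IsLiouvilleLike μ) (x y z w : ℍ) :
    μ (sepSet x z) + μ (sepSet y w) + (μ (sep4 x z y w) + μ (sep4 x z y w)) =
      μ (sepSet x y) + μ (sepSet z w) + (μ (sep4 x y z w) + μ (sep4 x y z w)) := by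
  have hae : ∀ u, ∀ᵐ g ∂μ, sdG g u ≠ 0 := fun u => by
    have := hμ.pencil_eq_zero u
    exact measure_eq_zero_iff_ae_notMem.1 this
  have h := lintegral_congr_ae (μ := μ) ((((hae x).and (hae y)).and ((hae z).and (hae w))).mono
    fun g hg => indicator_four_point hg.1.1 hg.1.2 hg.2.1 hg.2.2)
  have e : ∀ S T U : Set Geod, MeasurableSet S → MeasurableSet T → MeasurableSet U →
      ∫⁻ g, S.indicator (1 : Geod → ℝ≥0∞) g + T.indicator 1 g + (U.indicator 1 g + U.indicator 1 g) ∂μ =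
        μ S + μ T + (μ U + μ U) := by
    intro S T U hS hT hU
    have m : ∀ {V : Set Geod}, MeasurableSet V → Measurable (V.indicator (1 : Geod → ℝ≥0∞)) :=
      fun hV => measurable_one.indicator hV
    have m' : Measurable fun g => S.indicator (1 : Geod → ℝ≥0∞) g + T.indicator 1 g := (m hS).add (m hT)
    rw [lintegral_add_left m', lintegral_add_left (m hS), lintegral_add_left (m hU),
      lintegral_indicator_one hS, lintegral_indicator_one hT, lintegral_indicator_one hU]
  rwa [e _ _ _ (measurableSet_sepSet _ _) (measurableSet_sepSet _ _) (measurableSet_sep4 _ _ _ _),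
    e _ _ _ (measurableSet_sepSet _ _) (measurableSet_sepSet _ _) (measurableSet_sep4 _ _ _ _)] at h

/-- The measure of the set of geodesics that separate `x` from `y`. -/
noncomputable def sepDist (μ : Measure Geod) (x y : ℍ) : ℝ := (μ (sepSet x y)).toReal

theorem sepSet_comm (x y : ℍ) : sepSet x y = sepSet y x := by
  ext g; unfold sepSet; rw [Set.mem_ofPred_eq, Set.mem_ofPred_eq, mul_comm]

theorem sepDist_comm (μ : Measure Geod) (x y : ℍ) : sepDist μ x y = sepDist μ y x := by
  unfold sepDist; rw [sepSet_comm]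

theorem IsLiouvilleLike.sep4_ne_top {μ : Measure Geod} (hμ : IsLiouvilleLike μ) (x y z w : ℍ) :
    μ (sep4 x y z w) ≠ ∞ :=
  ((measure_mono Set.inter_subset_right).trans_lt (hμ.sepSet_lt_top x z)).ne

theorem IsLiouvilleLike.sepDist_four_point {μ : Measure Geod} (hμ : IsLiouvilleLike μ) (x y z w : ℍ) :
    sepDist μ x z + sepDist μ y w + 2 * (μ (sep4 x z y w)).toReal =
      sepDist μ x y + sepDist μ z w + 2 * (μ (sep4 x y z w)).toReal := by
  have h := congrArg ENNReal.toReal (hμ.four_point x y z w)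
  have f1 := fun u v => (hμ.sepSet_lt_top u v).ne
  have f2 := hμ.sep4_ne_top
  rw [ENNReal.toReal_add (by simp [f1]) (by simp [f2]), ENNReal.toReal_add (f1 _ _) (f1 _ _),
    ENNReal.toReal_add (f2 _ _ _ _) (f2 _ _ _ _), ENNReal.toReal_add (by simp [f1]) (by simp [f2]),
    ENNReal.toReal_add (f1 _ _) (f1 _ _), ENNReal.toReal_add (f2 _ _ _ _) (f2 _ _ _ _)] at h
  unfold sepDist
  linarith

theorem sign_transfer {x a y b : ℝ} (h : 0 < x * a) (h' : 0 < y * b) :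
    (0 < x * y ↔ 0 < a * b) ∧ (x * y < 0 ↔ a * b < 0) := by
  have : 0 < (x * y) * (a * b) := by nlinarith [mul_pos h h']
  exact ⟨pos_iff_pos_of_mul_pos this, neg_iff_neg_of_mul_pos this⟩

theorem neg_of_sep {x y z w : ℝ} (h1 : 0 < x * y) (h2 : 0 < z * w) (h3 : x * z < 0) : y * w < 0 :=
  (sign_transfer h1 h2).2.1 h3

/-- Extend the diagonals `xz` and `yw` to ends `a, c` and `b, d`. A geodesic splitting the four
points in either of these two ways splits the ends likewise. If both ways occur then `ac` and `bd`
link, so the two sets lie in a box and its perpendicular, and `IsLiouvilleLike.min_le` bounds one of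
them. -/
theorem IsLiouvilleLike.sep4_le {μ : Measure Geod} (hμ : IsLiouvilleLike μ) (x y z w : ℍ) :
    μ (sep4 x y z w) ≤ ENNReal.ofReal (Real.log 2) ∨ μ (sep4 x w z y) ≤ ENNReal.ofReal (Real.log 2) := by
  rcases (sep4 x y z w).eq_empty_or_nonempty with h0 | ⟨g₁, hg₁⟩
  · left; rw [h0]; simp
  rcases (sep4 x w z y).eq_empty_or_nonempty with h0 | ⟨g₂, hg₂⟩
  · right; rw [h0]; simp
  have hxz : x ≠ z := by
    rintro rfl
    exact absurd (show sdG g₁ x * sdG g₁ x < 0 from hg₁.2) (not_lt.2 (mul_self_nonneg _))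
  have hyw : y ≠ w := by
    rintro rfl
    exact absurd (neg_of_sep hg₁.1.1 hg₁.1.2 hg₁.2) (not_lt.2 (mul_self_nonneg _))
  obtain ⟨a, c, hac⟩ := exists_ends hxz
  obtain ⟨b, d, hbd⟩ := exists_ends hyw
  have key1 : ∀ p, Geod.mk p ∈ sep4 x y z w → SepB p.1.1 p.1.2 a b c d := by
    rintro p ⟨⟨h1, h2⟩, h3⟩
    obtain ⟨s1, s2⟩ := hac _ _ h3
    obtain ⟨s3, s4⟩ := hbd _ _ (neg_of_sep h1 h2 h3)
    exact ⟨(sign_transfer s1 s3).1.1 h1, (sign_transfer s2 s4).1.1 h2, (sign_transfer s1 s2).2.1 h3⟩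
  have key2 : ∀ p, Geod.mk p ∈ sep4 x w z y → SepB p.1.1 p.1.2 a d b c := by
    rintro p ⟨⟨h1, h2⟩, h3⟩
    obtain ⟨s1, s2⟩ := hac _ _ h3
    have h4 := neg_of_sep h1 h2 h3
    rw [mul_comm] at h4
    obtain ⟨s3, s4⟩ := hbd _ _ h4
    exact SepB.swap ⟨(sign_transfer s1 s4).1.1 h1, (sign_transfer s2 s3).1.1 h2, (sign_transfer s1 s2).2.1 h3⟩
  have hl : Link a c b d := by
    obtain ⟨p₁, rfl⟩ := g₁.exists_mk
    obtain ⟨p₂, rfl⟩ := g₂.exists_mk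
    exact link_of_sepB (key1 _ hg₁) (key2 _ hg₂)
  have sub1 : sep4 x y z w ⊆ obox b c d a := by
    intro g hg
    obtain ⟨p, rfl⟩ := g.exists_mk
    have h := key1 p hg
    rcases h.signs with ⟨s1, s2, s3, s4⟩ | ⟨s1, s2, s3, s4⟩
    · exact ⟨mul_neg_of_pos_of_neg s2 s3, mul_neg_of_neg_of_pos s4 s1⟩
    · exact ⟨mul_neg_of_neg_of_pos s2 s3, mul_neg_of_pos_of_neg s4 s1⟩
  have sub2 : sep4 x w z y ⊆ obox a b c d := by
    intro g hg
    obtain ⟨p, rfl⟩ := g.exists_mk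
    have h := key2 p hg
    rcases h.signs with ⟨s1, s2, s3, s4⟩ | ⟨s1, s2, s3, s4⟩
    · exact ⟨mul_neg_of_pos_of_neg s1 s3, mul_neg_of_neg_of_pos s4 s2⟩
    · exact ⟨mul_neg_of_neg_of_pos s1 s3, mul_neg_of_pos_of_neg s4 s2⟩
  rcases link_iff_ccw4.1 hl with h | h
  · rcases hμ.min_le h with h' | h'
    · exact .inr ((measure_mono sub2).trans h')
    · exact .inl ((measure_mono sub1).trans h')
  · rcases hμ.min_le h with h' | h'
    · rw [obox_reverse'] at h'
      exact .inl ((measure_mono sub1).trans h')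
    · rw [obox_comm, obox_reverse] at h'
      exact .inr ((measure_mono sub2).trans h')

theorem IsLiouvilleLike.isGromovHyperbolic_sepDist {μ : Measure Geod} (hμ : IsLiouvilleLike μ) :
    IsGromovHyperbolic (sepDist μ) (Real.log 2) := by
  intro x y z w
  have hl : 0 ≤ Real.log 2 := Real.log_nonneg one_le_two
  rcases hμ.sep4_le x y z w with h | h
  · have h1 := hμ.sepDist_four_point x y z w
    have h2 := ENNReal.toReal_le_of_le_ofReal hl h
    have h3 : 0 ≤ (μ (sep4 x z y w)).toReal := ENNReal.toReal_nonneg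
    have h4 := le_max_left (sepDist μ x y + sepDist μ z w) (sepDist μ y z + sepDist μ x w)
    linarith
  · have h1 := hμ.sepDist_four_point x w z y
    have h2 := ENNReal.toReal_le_of_le_ofReal hl h
    have h3 : 0 ≤ (μ (sep4 x z w y)).toReal := ENNReal.toReal_nonneg
    have h4 := le_max_right (sepDist μ x y + sepDist μ z w) (sepDist μ y z + sepDist μ x w)
    rw [sepDist_comm μ w y, sepDist_comm μ z y] at h1
    linarith

/-! ### Optimality -/

/-- Points on the geodesic from `a` to `c`, as positive combinations of its ends. -/
theorem exists_between {a c : Bdry} (hac : a ≠ c) {s t : ℝ} (hs : 0 < s) (ht : 0 < t) :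
    ∃ x : ℍ, ∃ k : ℝ, 0 < k ∧ ∀ g : Geod, k * sdG g x = s * sbG g a + t * sbG g c := by
  -- A boundary point has paraboloid coordinates `(hx * hy, hx ^ 2, hy ^ 2)`; `k` is the last
  -- coordinate of the combination, by which one divides. The result is interior because the defect
  -- is `s * t * br a c ^ 2 > 0`.
  set k := s * hy a ^ 2 + t * hy c ^ 2
  have hbr : br a c ≠ 0 := fun h => hac (br_eq_zero.1 h)
  have hk : 0 < k := by
    by_cases h : hy a = 0
    · have : hy c ≠ 0 := by
        intro h'; apply hbr; unfold br; rw [h, h']; ring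
      simp only [k]; positivity
    · simp only [k]; positivity
  have hlt : ((s * (hx a * hy a) + t * (hx c * hy c)) / k) ^ 2 < (s * hx a ^ 2 + t * hx c ^ 2) / k := by
    rw [div_pow, div_lt_div_iff₀ (by positivity) hk]
    have e : (s * hx a ^ 2 + t * hx c ^ 2) * k ^ 2 - (s * (hx a * hy a) + t * (hx c * hy c)) ^ 2 * k =
        k * (s * t * br a c ^ 2) := by
      simp only [k]; unfold br; ring
    have : 0 < k * (s * t * br a c ^ 2) := by positivity
    linarith
  obtain ⟨x, h1, h2⟩ := exists_re_sqn hlt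
  refine ⟨x, k, hk, fun g => ?_⟩
  obtain ⟨p, rfl⟩ := g.exists_mk
  rw [sdG_mk, sbG_mk, sbG_mk]
  unfold sd sb br
  rw [h1, h2]
  field_simp
  simp only [k]
  ring

/-- The geodesics which separate the boundary points `a`, `b` from `c`, `d`. -/
def sepBSet (a b c d : Bdry) : Set Geod :=
  {g | 0 < sbG g a * sbG g b ∧ 0 < sbG g c * sbG g d ∧ sbG g a * sbG g c < 0}

/-- A geodesic separating `b` from `c` and `d` from `a` splits the vertices as `ab|cd` or as
`ac|bd`; the cyclic order excludes the latter. -/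
theorem obox_subset_sepBSet {a b c d : Bdry} (h : Ccw4 a b c d) : obox b c d a ⊆ sepBSet a b c d := by
  intro g hg
  obtain ⟨p, rfl⟩ := g.exists_mk
  obtain ⟨h1, h2⟩ := hg
  replace h1 : sb p.1.1 p.1.2 b * sb p.1.1 p.1.2 c < 0 := h1
  replace h2 : sb p.1.1 p.1.2 d * sb p.1.1 p.1.2 a < 0 := h2
  have hn : ¬ SepB p.1.1 p.1.2 a c b d := fun h' => h'.not_ccw4 h
  show SepB p.1.1 p.1.2 a b c d
  unfold SepB at *
  rcases mul_neg_iff.1 h1 with ⟨s1, s2⟩ | ⟨s1, s2⟩ <;> rcases mul_neg_iff.1 h2 with ⟨s3, s4⟩ | ⟨s3, s4⟩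
  · exact absurd ⟨mul_pos_of_neg_of_neg s4 s2, mul_pos s1 s3, mul_neg_of_neg_of_pos s4 s1⟩ hn
  · exact ⟨mul_pos s4 s1, mul_pos_of_neg_of_neg s2 s3, mul_neg_of_pos_of_neg s4 s2⟩
  · exact ⟨mul_pos_of_neg_of_neg s4 s1, mul_pos s2 s3, mul_neg_of_neg_of_pos s4 s2⟩
  · exact absurd ⟨mul_pos s4 s2, mul_pos_of_neg_of_neg s1 s3, mul_neg_of_pos_of_neg s4 s1⟩ hn

/-- `x n` is a sequence of points on the geodesic from `a` to `c` which converges to `a`. -/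
def IsApprox (a c : Bdry) (α γ : ℝ) (x : ℕ → ℍ) : Prop :=
  ∀ n, ∃ k : ℝ, 0 < k ∧ ∀ g : Geod, k * sdG g (x n) = (n + 1) * α * sbG g a + γ * sbG g c

theorem exists_isApprox {a c : Bdry} (hac : a ≠ c) {α γ : ℝ} (hα : 0 < α) (hγ : 0 < γ) :
    ∃ x, IsApprox a c α γ x := by
  choose x hx using fun n : ℕ => exists_between hac (s := (n + 1) * α) (t := γ) (by positivity) hγ
  exact ⟨x, hx⟩

/-- The geodesics that meet the geodesic from `a` to `c` behind the `n`-th point. -/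
def approxSet (a c : Bdry) (α γ : ℝ) (n : ℕ) : Set Geod :=
  {g | 0 < sbG g a * ((n + 1) * α * sbG g a + γ * sbG g c)}

theorem approxSet_mono {a c : Bdry} {α γ : ℝ} (hα : 0 < α) : Monotone (approxSet a c α γ) := by
  intro m n hmn g hg
  replace hg : 0 < sbG g a * ((m + 1) * α * sbG g a + γ * sbG g c) := hg
  refine lt_of_lt_of_le hg ?_
  have h : (m : ℝ) ≤ n := Nat.cast_le.2 hmn
  nlinarith [mul_nonneg (mul_nonneg (sub_nonneg.2 h) hα.le) (sq_nonneg (sbG g a))]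

theorem exists_mem_approxSet {a c : Bdry} {α γ : ℝ} (hα : 0 < α) {g : Geod} (hg : sbG g a ≠ 0) :
    ∃ n, g ∈ approxSet a c α γ n := by
  have h : 0 < α * sbG g a ^ 2 := by positivity
  obtain ⟨n, hn⟩ := exists_nat_gt (-(γ * sbG g a * sbG g c) / (α * sbG g a ^ 2))
  rw [div_lt_iff₀ h] at hn
  refine ⟨n, ?_⟩
  show 0 < sbG g a * ((n + 1) * α * sbG g a + γ * sbG g c)
  nlinarith

theorem IsApprox.sign {a c : Bdry} {α γ : ℝ} {x : ℕ → ℍ} (h : IsApprox a c α γ x) {n : ℕ} {g : Geod}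
    (hg : g ∈ approxSet a c α γ n) : 0 < sbG g a * sdG g (x n) := by
  obtain ⟨k, hk, e⟩ := h n
  replace hg : 0 < sbG g a * ((n + 1) * α * sbG g a + γ * sbG g c) := hg
  rw [← e] at hg
  exact pos_of_mul_pos_right (a := k) (by linarith) hk.le

/-- Every geodesic strictly separating the ends eventually separates the approximating points in the
same way. The sets `R n` on which this has happened by time `n` increase to `sepBSet`, and
continuity from below applies. -/
theorem IsApprox.tendsto {a b c d : Bdry} {α β γ δ : ℝ} (hα : 0 < α) (hβ : 0 < β) (hγ : 0 < γ)
    (hδ : 0 < δ) {x y z w : ℕ → ℍ} (h1 : IsApprox a c α γ x) (h2 : IsApprox b d β δ y)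
    (h3 : IsApprox c a γ α z) (h4 : IsApprox d b δ β w) (μ : Measure Geod) {l : ℝ}
    (hl : ENNReal.ofReal l < μ (sepBSet a b c d)) :
    ∀ᶠ n in atTop, ENNReal.ofReal l < μ (sep4 (x n) (y n) (z n) (w n)) := by
  set R : ℕ → Set Geod := fun n => sepBSet a b c d ∩ ((approxSet a c α γ n ∩ approxSet b d β δ n) ∩
    (approxSet c a γ α n ∩ approxSet d b δ β n))
  have m1 := approxSet_mono (a := a) (c := c) (γ := γ) hα
  have m2 := approxSet_mono (a := b) (c := d) (γ := δ) hβ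
  have m3 := approxSet_mono (a := c) (c := a) (γ := α) hγ
  have m4 := approxSet_mono (a := d) (c := b) (γ := β) hδ
  have hR : Monotone R := fun m n hmn => Set.inter_subset_inter_right _
    (Set.inter_subset_inter (Set.inter_subset_inter (m1 hmn) (m2 hmn))
      (Set.inter_subset_inter (m3 hmn) (m4 hmn)))
  have hU : ⋃ n, R n = sepBSet a b c d := by
    refine Set.Subset.antisymm (Set.iUnion_subset fun n => Set.inter_subset_left) ?_
    rintro g ⟨g1, g2, g3⟩
    have na : sbG g a ≠ 0 := fun h0 => by rw [h0, zero_mul] at g1; exact lt_irrefl _ g1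
    have nb : sbG g b ≠ 0 := fun h0 => by rw [h0, mul_zero] at g1; exact lt_irrefl _ g1
    have nc : sbG g c ≠ 0 := fun h0 => by rw [h0, zero_mul] at g2; exact lt_irrefl _ g2
    have nd : sbG g d ≠ 0 := fun h0 => by rw [h0, mul_zero] at g2; exact lt_irrefl _ g2
    obtain ⟨n1, hn1⟩ := exists_mem_approxSet (c := c) (γ := γ) hα na
    obtain ⟨n2, hn2⟩ := exists_mem_approxSet (c := d) (γ := δ) hβ nb
    obtain ⟨n3, hn3⟩ := exists_mem_approxSet (c := a) (γ := α) hγ nc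
    obtain ⟨n4, hn4⟩ := exists_mem_approxSet (c := b) (γ := β) hδ nd
    refine Set.mem_iUnion.2 ⟨max (max n1 n2) (max n3 n4), ⟨g1, g2, g3⟩, ⟨m1 ?_ hn1, m2 ?_ hn2⟩,
      ⟨m3 ?_ hn3, m4 ?_ hn4⟩⟩ <;> simp
  have hlim := tendsto_measure_iUnion_atTop (μ := μ) hR
  rw [hU] at hlim
  filter_upwards [hlim.eventually (lt_mem_nhds hl)] with n hn
  refine lt_of_lt_of_le hn (measure_mono ?_)
  rintro g ⟨⟨g1, g2, g3⟩, ⟨a1, a2⟩, ⟨a3, a4⟩⟩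
  exact ⟨⟨(sign_transfer (h1.sign a1) (h2.sign a2)).1.1 g1, (sign_transfer (h3.sign a3) (h4.sign a4)).1.1 g2⟩,
    (sign_transfer (h1.sign a1) (h3.sign a3)).2.1 g3⟩

/-- The relation expresses that the segments `xz` and `yw` cross, so no geodesic has one of them on
each side. -/
theorem sep4_eq_empty_of_relation {x y z w : ℍ} {k₁ k₂ k₃ k₄ : ℝ} (h1 : 0 < k₁) (h2 : 0 < k₂) (h3 : 0 < k₃)
    (h4 : 0 < k₄) (h : ∀ g, k₁ * sdG g x + k₃ * sdG g z = k₂ * sdG g y + k₄ * sdG g w) :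
    sep4 x z y w = ∅ := by
  rw [Set.eq_empty_iff_forall_notMem]
  rintro g ⟨⟨g1, g2⟩, g3⟩
  have e := h g
  replace g1 : 0 < sdG g x * sdG g z := g1
  replace g2 : 0 < sdG g y * sdG g w := g2
  replace g3 : sdG g x * sdG g y < 0 := g3
  rcases pos_and_pos_or_neg_and_neg_of_mul_pos g1 with ⟨s1, s2⟩ | ⟨s1, s2⟩ <;>
  rcases pos_and_pos_or_neg_and_neg_of_mul_pos g2 with ⟨s3, s4⟩ | ⟨s3, s4⟩
  · exact absurd g3 (not_lt.2 (mul_pos s1 s3).le)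
  · have := mul_pos h1 s1
    have := mul_pos h3 s2
    have := mul_neg_of_pos_of_neg h2 s3
    have := mul_neg_of_pos_of_neg h4 s4
    linarith
  · have := mul_neg_of_pos_of_neg h1 s1
    have := mul_neg_of_pos_of_neg h3 s2
    have := mul_pos h2 s3
    have := mul_pos h4 s4
    linarith
  · exact absurd g3 (not_lt.2 (mul_pos_of_neg_of_neg s1 s3).le)

theorem lt_toReal_of_ofReal_lt {ε : ℝ} {m : ℝ≥0∞} (hm : m ≠ ∞) (h : ENNReal.ofReal ε < m) :
    ε < m.toReal := by
  rw [← ENNReal.ofReal_toReal hm] at h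
  exact (ENNReal.ofReal_lt_ofReal_iff'.1 h).1

/-- Points run to the vertices of a harmonic box along its diagonals, so that both `xy|zw` and
`xw|zy` eventually have measure above any `ε < log 2`, while `xz|yw` stays empty. The diagonal sum
then exceeds both other sums by more than `2ε`. -/
theorem IsLiouvilleLike.log_two_le {μ : Measure Geod} (hμ : IsLiouvilleLike μ) {ε : ℝ}
    (h : IsGromovHyperbolic (sepDist μ) ε) : Real.log 2 ≤ ε := by
  by_contra hlt
  push Not at hlt
  obtain ⟨a, b, c, d, h4, e1, e2⟩ := hμ.exists_obox_eq
  obtain ⟨p1, p2, p3, p4⟩ := h4.all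
  have hac : a ≠ c := p1.ne.2.2
  have hbd : b ≠ d := p4.ne.2.2
  rw [ccw_iff] at p1 p2 p3 p4
  -- The weights are the coefficients of `sb_relation`, positive up to a cyclic permutation of the
  -- factors by the cyclic order; they make the segments `xz` and `yw` cross for every `n`, not just
  -- in the limit.
  set α := br b c * br c d * br d b
  set γ := br a b * br b d * br d a
  set β := br a c * br c d * br d a
  set δ := br a b * br b c * br c a
  obtain ⟨x, hx⟩ := exists_isApprox hac p4 p3
  obtain ⟨z, hz⟩ := exists_isApprox hac.symm p3 p4
  obtain ⟨y, hy⟩ := exists_isApprox hbd p2 p1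
  obtain ⟨w, hw⟩ := exists_isApprox hbd.symm p1 p2
  have hlog : 0 < Real.log 2 := Real.log_pos one_lt_two
  have hl : ENNReal.ofReal ε < ENNReal.ofReal (Real.log 2) := (ENNReal.ofReal_lt_ofReal_iff hlog).2 hlt
  have b1 : ENNReal.ofReal ε < μ (sepBSet a b c d) :=
    (e2 ▸ hl).trans_le (measure_mono (obox_subset_sepBSet h4))
  have b2 : ENNReal.ofReal ε < μ (sepBSet a d c b) := by
    refine (e1 ▸ hl).trans_le (measure_mono ?_)
    have h5 := obox_subset_sepBSet h4.rotate.rotate.rotate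
    rintro g ⟨g1, g2⟩
    obtain ⟨q1, q2, q3⟩ := h5 (show g ∈ obox a b c d from ⟨g1, g2⟩)
    refine ⟨by rw [mul_comm]; exact q1, by rw [mul_comm]; exact q2, ?_⟩
    exact neg_of_sep q1 q2 q3
  obtain ⟨n, hn1, hn2⟩ := ((hx.tendsto p4 p2 p3 p1 hy hz hw μ b1).and
    (hx.tendsto p4 p1 p3 p2 hw hz hy μ b2)).exists
  have hempty : sep4 (x n) (z n) (y n) (w n) = ∅ := by
    obtain ⟨k₁, q1, r1⟩ := hx n
    obtain ⟨k₂, q2, r2⟩ := hy n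
    obtain ⟨k₃, q3, r3⟩ := hz n
    obtain ⟨k₄, q4, r4⟩ := hw n
    refine sep4_eq_empty_of_relation q1 q2 q3 q4 fun g => ?_
    rw [r1, r2, r3, r4]
    obtain ⟨p, rfl⟩ := g.exists_mk
    have := sb_relation a b c d p.1.1 p.1.2
    simp only [sbG_mk]
    -- In the sum over `x n` and `z n` each end receives its weight `n + 1` times from the near
    -- point and once from the far one; likewise for `y n` and `w n`.
    linear_combination (n + 2 : ℝ) * this
  have hempty' : sep4 (x n) (z n) (w n) (y n) = ∅ := by
    rw [Set.eq_empty_iff_forall_notMem] at hempty ⊢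
    rintro g ⟨⟨g1, g2⟩, g3⟩
    refine hempty g ⟨⟨g1, by rw [Set.mem_ofPred_eq, mul_comm]; exact g2⟩, ?_⟩
    replace g1 : 0 < sdG g (x n) * sdG g (z n) := g1
    replace g2 : 0 < sdG g (w n) * sdG g (y n) := g2
    replace g3 : sdG g (x n) * sdG g (w n) < 0 := g3
    have g4 := neg_of_sep g1 g2 g3
    have g5 : 0 < sdG g (z n) * sdG g (x n) := by rwa [mul_comm]
    have g6 : 0 < sdG g (y n) * sdG g (y n) := by
      refine lt_of_le_of_ne (mul_self_nonneg _) (Ne.symm (mul_self_ne_zero.2 fun h0 => ?_))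
      rw [h0, mul_zero] at g4; exact lt_irrefl _ g4
    exact neg_of_sep g5 g6 g4
  have f1 := hμ.sepDist_four_point (x n) (y n) (z n) (w n)
  have f2 := hμ.sepDist_four_point (x n) (w n) (z n) (y n)
  rw [hempty] at f1
  rw [hempty', sepDist_comm μ (w n), sepDist_comm μ (z n)] at f2
  simp only [measure_empty, ENNReal.toReal_zero, mul_zero, add_zero] at f1 f2
  have g1 := lt_toReal_of_ofReal_lt (hμ.sep4_ne_top _ _ _ _) hn1
  have g2 := lt_toReal_of_ofReal_lt (hμ.sep4_ne_top _ _ _ _) hn2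
  have h5 := h (x n) (y n) (z n) (w n)
  rcases max_choice (sepDist μ (x n) (y n) + sepDist μ (z n) (w n))
    (sepDist μ (y n) (z n) + sepDist μ (x n) (w n)) with h6 | h6 <;> rw [h6] at h5 <;> linarith

/-! ### The dual space -/

theorem IsLiouvilleLike.sepDist_triangle {μ : Measure Geod} (hμ : IsLiouvilleLike μ) (x y z : ℍ) :
    sepDist μ x z ≤ sepDist μ x y + sepDist μ y z := by
  unfold sepDist
  rw [← ENNReal.toReal_add (hμ.sepSet_lt_top _ _).ne (hμ.sepSet_lt_top _ _).ne]
  refine ENNReal.toReal_mono (ENNReal.add_ne_top.2 ⟨(hμ.sepSet_lt_top _ _).ne, (hμ.sepSet_lt_top _ _).ne⟩) ?_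
  have hsub : sepSet x z ⊆ (sepSet x y ∪ sepSet y z) ∪ pencil y := by
    intro g hg
    by_contra hc
    simp only [Set.mem_union, not_or] at hc
    obtain ⟨⟨h1, h2⟩, h3⟩ := hc
    replace hg : sdG g x * sdG g z < 0 := hg
    replace h1 : ¬ sdG g x * sdG g y < 0 := h1
    replace h2 : ¬ sdG g y * sdG g z < 0 := h2
    replace h3 : sdG g y ≠ 0 := h3
    have : 0 < sdG g y ^ 2 := by positivity
    nlinarith [mul_nonneg (not_lt.1 h1) (not_lt.1 h2)]
  refine (measure_mono hsub).trans ((measure_union_le _ _).trans ?_)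
  rw [hμ.pencil_eq_zero, add_zero]
  exact measure_union_le _ _

theorem sepDist_self (μ : Measure Geod) (x : ℍ) : sepDist μ x x = 0 := by
  have : sepSet x x = ∅ := by
    rw [Set.eq_empty_iff_forall_notMem]
    exact fun g => not_lt.2 (mul_self_nonneg (sdG g x))
  unfold sepDist; rw [this]; simp

theorem IsLiouvilleLike.dualPseudoDist_eq_sepDist {μ : Measure Geod} (hμ : IsLiouvilleLike μ) :
    dualPseudoDist μ = sepDist μ := by
  ext x y; exact hμ.dualPseudoDist_eq x y

/-- Vanishing distance is already an equivalence relation by the triangle inequality, so `Quot`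
identifies no further points and the infimum in `dualDist` is over a single value. -/
theorem IsLiouvilleLike.sepDist_eq_zero_of_mk_eq {μ : Measure Geod} (hμ : IsLiouvilleLike μ) {x y : ℍ}
    (h : (Quot.mk _ x : DualSpace μ) = Quot.mk _ y) : sepDist μ x y = 0 := by
  have he : Equivalence fun x y : ℍ => dualPseudoDist μ x y = 0 := by
    rw [hμ.dualPseudoDist_eq_sepDist]
    refine ⟨sepDist_self μ, fun h => by rwa [sepDist_comm], fun {x y z} h1 h2 => ?_⟩
    have := hμ.sepDist_triangle x y z
    have h0 : 0 ≤ sepDist μ x z := ENNReal.toReal_nonneg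
    linarith
  have := he.eqvGen_iff.1 (Quot.eqvGen_exact h)
  rwa [hμ.dualPseudoDist_eq_sepDist] at this

theorem IsLiouvilleLike.dualDist_mk {μ : Measure Geod} (hμ : IsLiouvilleLike μ) (x y : ℍ) :
    dualDist μ (Quot.mk _ x) (Quot.mk _ y) = sepDist μ x y := by
  have : {r : ℝ | ∃ x' y' : ℍ, (Quot.mk _ x' : DualSpace μ) = Quot.mk _ x ∧
      (Quot.mk _ y' : DualSpace μ) = Quot.mk _ y ∧ r = dualPseudoDist μ x' y'} = {sepDist μ x y} := by
    ext r
    constructor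
    · rintro ⟨x', y', h1, h2, rfl⟩
      rw [Set.mem_singleton_iff, hμ.dualPseudoDist_eq_sepDist]
      have e1 := hμ.sepDist_eq_zero_of_mk_eq h1
      have e2 := hμ.sepDist_eq_zero_of_mk_eq h2
      have t1 := hμ.sepDist_triangle x' x y'
      have t2 := hμ.sepDist_triangle x y y'
      have t3 := hμ.sepDist_triangle x x' y
      have t4 := hμ.sepDist_triangle x' y' y
      rw [sepDist_comm μ y y'] at t2
      rw [sepDist_comm μ x x'] at t3
      exact le_antisymm (by linarith) (by linarith)
    · rintro rfl
      exact ⟨x, y, rfl, rfl, by rw [hμ.dualPseudoDist_eq_sepDist]⟩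
  unfold dualDist
  rw [this, csInf_singleton]

theorem IsLiouvilleLike.isGromovHyperbolic_dualDist_iff {μ : Measure Geod} (hμ : IsLiouvilleLike μ)
    {δ : ℝ} : IsGromovHyperbolic (dualDist μ) δ ↔ IsGromovHyperbolic (sepDist μ) δ := by
  constructor
  · intro h x y z w
    have := h (Quot.mk _ x) (Quot.mk _ y) (Quot.mk _ z) (Quot.mk _ w)
    simpa only [hμ.dualDist_mk] using this
  · intro h x y z w
    induction x using Quot.ind
    induction y using Quot.ind
    induction z using Quot.ind
    induction w using Quot.ind
    simp only [hμ.dualDist_mk]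
    exact h _ _ _ _

theorem IsMarking.isLiouvilleLike {Γ Γ' : Subgroup SL(2, ℝ)} (hΓ : IsClosedSurfaceGroup Γ)
    (hΓ' : IsClosedSurfaceGroup Γ') {φ : ℍ ≃ₜ ℍ} (hφ : IsMarking Γ Γ' φ) :
    IsLiouvilleLike (liouvilleCurrent φ) := by
  obtain ⟨f, hf⟩ := hφ.exists_homeomorph hΓ hΓ'
  have : boundaryMap φ.symm = f := funext fun ξ => (hf ξ).symm
  unfold liouvilleCurrent
  rw [this]
  exact isLiouvilleLike_map f

end DualCurrent

theorem mainTheorem9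
    (Γ Γ' : Subgroup (Matrix.SpecialLinearGroup (Fin 2) ℝ))
    (hΓ : DualCurrent.IsClosedSurfaceGroup Γ) (hΓ' : DualCurrent.IsClosedSurfaceGroup Γ')
    (φ : UpperHalfPlane ≃ₜ UpperHalfPlane) (hφ : DualCurrent.IsMarking Γ Γ' φ) :
    DualCurrent.deltaBox (DualCurrent.liouvilleCurrent φ) = ENNReal.ofReal (Real.log 2) ∧
    IsLeast {δ : ℝ | DualCurrent.IsGromovHyperbolic
      (DualCurrent.dualDist (DualCurrent.liouvilleCurrent φ)) δ} (Real.log 2) ∧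
    IsLeast {δ : ℝ | DualCurrent.IsGromovHyperbolic
      (fun z w : UpperHalfPlane => dist z w) δ} (Real.log 2) := by
  have hμ := hφ.isLiouvilleLike hΓ hΓ'
  refine ⟨hμ.deltaBox_eq, ⟨?_, fun δ h => ?_⟩, DualCurrent.isGromovHyperbolic_log_two,
    fun δ h => DualCurrent.log_two_le_of_isGromovHyperbolic h⟩
  · exact hμ.isGromovHyperbolic_dualDist_iff.2 hμ.isGromovHyperbolic_sepDist
  · exact hμ.log_two_le (hμ.isGromovHyperbolic_dualDist_iff.1 h)
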